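/- Let $F$ be a number field with adele ring $\mathbb A$ and let $n\ge 2$. Fix Haar measures on $\mathbb A^\times$ and on $\mathrm{GL}_{n-1}(\mathbb A)$, and give $F^\times\backslash\mathbb A^\times$ and $\mathrm{GL}_{n-1}(F)\backslash\mathrm{GL}_{n-1}(\mathbb A)$ the quotient measures by the counting measures. An automorphic form on $\mathrm{GL}_m(\mathbb A)$ means a smooth automorphic form: a function that is left invariant under $\mathrm{GL}_m(F)$, smooth in the archimedean variable, right invariant under an open subgroup of $\mathrm{GL}_m(\mathbb A_{\rm fin})$, finite under the centre of the universal enveloping algebra of $\mathfrak{gl}_m(F\otimes\mathbb R)$, and of uniform moderate growth. It is a cusp form if moreover its integral over $U(F)\backslash U(\mathbb A)$ vanishes, at every translate, for the unipotent radical $U$ of every proper standard parabolic subgroup. Let $\Phi$ be a cusp form on $Z_{n+1}(\mathbb A)\mathrm{GL}_{n+1}(F)\backslash \mathrm{GL}_{n+1}(\mathbb A)$, and let $\varphi$ be an automorphic form on $\mathrm{GL}_{n-1}(F)\backslash\mathrm{GL}_{n-1}(\mathbb A)$ that is invariant under the centre $Z_{n-1}(\mathbb A)$. For $s,w\in\mathbb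 C$, $h\in\mathrm{GL}_n(\mathbb A)$ and a function $\phi$ on $\mathrm{GL}_n(\mathbb A)$ put $$\mathcal A_s\Phi(h)=|\det h|^{s-\frac12}\int_{F^\times\backslash\mathbb A^\times}\Phi\begin{pmatrix} uh&\\&1\end{pmatrix}|u|^{n(s-\frac12)}\,d^\times u,$$ $$I(w,\phi,\varphi)=\int_{\mathrm{GL}_{n-1}(F)\backslash\mathrm{GL}_{n-1}(\mathbb A)}\phi\begin{pmatrix} h&\\&1\end{pmatrix}\varphi(h)\,|\det h|^{w-\frac12}\,dh .$$ Let $\check\Phi(g)=\Phi(g\,w_{12})$, where $$w_{12}=\begin{pmatrix} I_{n-1}&&\\&&1\\&1&\end{pmatrix}.$$ Then for all $s,w\in\mathbb C$, with $$s'=\frac{1+(n-1)w-s}{n},\qquad w'=\frac{(n+1)s+w-1}{n},$$ the integrals defining $\mathcal A_s\Phi(h)$ and $\mathcal A_{s'}\check\Phi(h)$ (for every $h\in\mathrm{GL}_n(\mathbb A)$), $I(w,\mathcal A_s\Phi,\varphi)$ and $I(w',\mathcal A_{s'}\check\Phi,\varphi)$ converge absolutely, and $$I(w,\mathcal A_s\Phi,\varphi)=I(w',\mathcal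 A_{s'}\check\Phi,\varphi).$$ -/

import Mathlib

open NumberField MeasureTheory Topology
open scoped ContDiff Pointwise

noncomputable section

namespace AdelicPeriods

/-! ### Quotient measures -/

/-- The canonical projection `G → Γ \ G`. The type `MulAction.orbitRel.Quotient Γ G` is the set of
orbits `Γ g` of the left multiplication action of `Γ` on `G`. -/
def toQuot {G : Type*} [Group G] (Γ : Subgroup G) (g : G) : MulAction.orbitRel.Quotient Γ G :=
  Quotient.mk'' g

/-- The quotient measure on `Γ \ G` of a measure `μ` on `G` by the counting measure of `Γ`, for a
discrete countable subgroup `Γ`: the smallest measure on `Γ \ G` that dominates the push-forward of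
`μ|_S` for every measurable `S ⊆ G` meeting each orbit `Γ g` at most once.  If `𝓕` is a
fundamental domain, it is the push-forward of `μ|_𝓕` (`quotientMeasure_eq_map_restrict`). -/
def quotientMeasure {G : Type*} [Group G] [MeasurableSpace G] (Γ : Subgroup G) (μ : Measure G) :
    Measure (MulAction.orbitRel.Quotient Γ G) :=
  ⨆ (S : Set G) (_ : MeasurableSet S) (_ : Set.InjOn (toQuot Γ) S),
    (μ.restrict S).map (toQuot Γ)

theorem measurable_toQuot {G : Type*} [Group G] [MeasurableSpace G] (Γ : Subgroup G) :
    Measurable (toQuot Γ) :=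
  measurable_quotient_mk''

theorem toQuot_eq_iff {G : Type*} [Group G] (Γ : Subgroup G) (x y : G) :
    toQuot Γ x = toQuot Γ y ↔ ∃ γ : Γ, γ • y = x := by
  unfold toQuot
  rw [Quotient.eq'']
  rfl

theorem quotientMeasure_eq_map_restrict {G : Type*} [Group G] [MeasurableSpace G]
    [MeasurableMul G] (Γ : Subgroup G) [Countable Γ] (μ : Measure G) [μ.IsMulLeftInvariant]
    (𝓕 : Set G) (h𝓕 : IsFundamentalDomain Γ 𝓕 μ) :
    quotientMeasure Γ μ = (μ.restrict 𝓕).map (toQuot Γ) := by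
  have hfree : ∀ (γ : Γ) (x : G), γ • x = x → γ = 1 := by
    intro γ x h
    have : (γ : G) * x = x := h
    exact Subtype.ext (by simpa using this)
  apply le_antisymm
  · refine iSup_le fun S => iSup_le fun hS => iSup_le fun hinj => ?_
    refine Measure.le_iff.2 fun B hB => ?_
    have hB' := measurable_toQuot Γ hB
    rw [Measure.map_apply (measurable_toQuot Γ) hB, Measure.map_apply (measurable_toQuot Γ) hB,
      Measure.restrict_apply hB', Measure.restrict_apply hB', h𝓕.measure_eq_tsum,
      ← measure_iUnion₀]
    · refine measure_mono (Set.iUnion_subset fun γ => ?_)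
      rintro _ ⟨⟨x, ⟨hx, -⟩, rfl⟩, hxF⟩
      refine ⟨?_, hxF⟩
      have : toQuot Γ (γ • x) = toQuot Γ x := (toQuot_eq_iff Γ _ _).2 ⟨γ, rfl⟩
      simpa [Set.mem_preimage, this] using hx
    · intro γ₁ γ₂ hne
      refine Disjoint.aedisjoint ?_
      rw [Set.disjoint_left]
      rintro _ ⟨⟨x, ⟨-, hx⟩, rfl⟩, -⟩ ⟨⟨y, ⟨-, hy⟩, hxy⟩, -⟩
      have hxy : γ₂ • y = γ₁ • x := hxy
      have h1 : (γ₁⁻¹ * γ₂) • y = x := by rw [mul_smul, hxy, inv_smul_smul]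
      have h2 : x = y := hinj hx hy ((toQuot_eq_iff Γ _ _).2 ⟨_, h1⟩)
      subst h2
      exact hne (inv_mul_eq_one.1 (hfree _ _ h1))
    · intro γ
      exact ((hB'.inter hS).nullMeasurableSet.smul γ).inter h𝓕.nullMeasurableSet
  · obtain ⟨T, hTF, hT, hTe⟩ := h𝓕.nullMeasurableSet.exists_measurable_subset_ae_eq
    set N : Set G := ⋃ γ : {γ : Γ // γ ≠ 1}, T ∩ (γ : Γ) • T with hN
    have hNm : MeasurableSet N :=
      MeasurableSet.iUnion fun γ => hT.inter (hT.const_smul (γ : Γ))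
    have hN0 : μ N = 0 := by
      rw [hN, measure_iUnion_null_iff]
      rintro ⟨γ, hγ⟩
      have h := h𝓕.aedisjoint hγ.symm
      refine measure_mono_null ?_ h
      change T ∩ γ • T ⊆ (1 : Γ) • 𝓕 ∩ γ • 𝓕
      rw [one_smul]
      exact Set.inter_subset_inter hTF (Set.smul_set_mono hTF)
    have hinj : Set.InjOn (toQuot Γ) (T \ N) := by
      intro x hx y hy hxy
      obtain ⟨γ, rfl⟩ := (toQuot_eq_iff Γ _ _).1 hxy
      by_cases hγ : γ = 1
      · simp [hγ]
      · have hmem : γ • y ∈ T ∩ γ • T := ⟨hx.1, Set.smul_mem_smul_set hy.1⟩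
        exact absurd (Set.mem_iUnion.2 ⟨(⟨γ, hγ⟩ : {γ : Γ // γ ≠ 1}), hmem⟩) hx.2
    have he : (T \ N : Set G) =ᵐ[μ] 𝓕 := by
      refine Filter.EventuallyEq.trans ?_ hTe
      exact sdiff_null_ae_eq_self hN0
    rw [← Measure.restrict_congr_set he]
    exact le_iSup_of_le (T \ N) (le_iSup_of_le (hT.diff hNm) (le_iSup_of_le hinj le_rfl))

/-- The integral `∫_{Γ \ G} f`, for a left `Γ`-invariant function `f` on `G`: such an `f` is
evaluated at any representative of a point of the quotient. -/
def quotientIntegral {G : Type*} [Group G] [MeasurableSpace G] (Γ : Subgroup G) (μ : Measure G)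
    (f : G → ℂ) : ℂ :=
  ∫ x, f x.out ∂(quotientMeasure Γ μ)

/-- Absolute convergence of `∫_{Γ \ G} f`, for a left `Γ`-invariant function `f` on `G`. -/
def QuotientIntegrable {G : Type*} [Group G] [MeasurableSpace G] (Γ : Subgroup G) (μ : Measure G)
    (f : G → ℂ) : Prop :=
  Integrable (fun x : MulAction.orbitRel.Quotient Γ G => f x.out) (quotientMeasure Γ μ)

/-! ### Adeles, ideles and `GL_m(𝔸)` -/

/-- The adele ring of a number field. -/
abbrev 𝔸 (F : Type*) [Field F] [NumberField F] : Type _ := AdeleRing (𝓞 F) F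

/-- `GL_m(R)`. -/
abbrev GLm (m : ℕ) (R : Type*) [CommRing R] : Type _ := Matrix.GeneralLinearGroup (Fin m) R

variable {F : Type*} [Field F] [NumberField F]

attribute [local instance] LieRing.ofAssociativeRing

instance (m : ℕ) : MeasurableSpace (GLm m (𝔸 F)) := borel _
instance (m : ℕ) : BorelSpace (GLm m (𝔸 F)) := ⟨rfl⟩
instance : MeasurableSpace (𝔸 F)ˣ := borel _
instance : BorelSpace (𝔸 F)ˣ := ⟨rfl⟩

/-- The subgroup `GL_m(F)` of `GL_m(𝔸)`. -/
def rationalGL (F : Type*) [Field F] [NumberField F] (m : ℕ) : Subgroup (GLm m (𝔸 F)) :=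
  (Matrix.GeneralLinearGroup.map (algebraMap F (𝔸 F))).range

/-- The subgroup `Fˣ` of `𝔸ˣ`. -/
def rationalIdeles (F : Type*) [Field F] [NumberField F] : Subgroup (𝔸 F)ˣ :=
  (Units.map (algebraMap F (𝔸 F)).toMonoidHom).range

/-- The adelic norm `|x| = ∏_v |x_v|_v` of an idele, with the normalized absolute values. -/
def idelicNorm (x : (𝔸 F)ˣ) : ℝ :=
  (∏ v : InfinitePlace F, ‖(x : 𝔸 F).1 v‖ ^ v.mult) *
    ∏ᶠ v : IsDedekindDomain.HeightOneSpectrum (𝓞 F), ‖(x : 𝔸 F).2 v‖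

/-- The height `‖g‖ = ∏_v max_{i,j} (|g_{ij}|_v, |(g⁻¹)_{ij}|_v)` on `GL_m(𝔸)`. -/
def height {m : ℕ} (g : GLm m (𝔸 F)) : ℝ :=
  (∏ v : InfinitePlace F,
      (⨆ p : Fin m × Fin m,
        max ‖((g : Matrix (Fin m) (Fin m) (𝔸 F)) p.1 p.2).1 v‖
          ‖((g⁻¹ : GLm m (𝔸 F)) p.1 p.2).1 v‖) ^ v.mult) *
    ∏ᶠ v : IsDedekindDomain.HeightOneSpectrum (𝓞 F),
      ⨆ p : Fin m × Fin m,
        max ‖((g : Matrix (Fin m) (Fin m) (𝔸 F)) p.1 p.2).2 v‖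
          ‖((g⁻¹ : GLm m (𝔸 F)) p.1 p.2).2 v‖

/-! ### Derivatives at the archimedean places -/

/-- The real Lie algebra `𝔤𝔩_m(F ⊗ ℝ)`, where `F ⊗ ℝ = F_∞ = ℝ^{r₁} × ℂ^{r₂}`. -/
abbrev LieGL (F : Type*) [Field F] [NumberField F] (m : ℕ) : Type _ :=
  Matrix (Fin m) (Fin m) (mixedEmbedding.mixedSpace F)

/-- The element of `𝔸` with archimedean component `x` and finite component `0`. -/
def archAdele (x : mixedEmbedding.mixedSpace F) : 𝔸 F :=
  ((InfiniteAdeleRing.ringEquiv_mixedSpace F).symm x, 0)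

open scoped Classical in
/-- The element of `GL_m(𝔸)` with archimedean component `1 + X` and finite component `1`
(and `1` when `1 + X` is not invertible, which does not happen for `X` near `0`). -/
def archOneAdd {m : ℕ} (X : Fin m → Fin m → mixedEmbedding.mixedSpace F) : GLm m (𝔸 F) :=
  if h : IsUnit (1 + (Matrix.of X).map archAdele) then h.unit else 1

open scoped Classical in
/-- `f` is smooth in the archimedean variable: `X ↦ g (1 + X)` is a chart of `g GL_m(F_∞)`
around `g`, for every `g`. -/
def IsArchSmooth {m : ℕ} (f : GLm m (𝔸 F) → ℂ) : Prop :=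
  ∀ g, ContDiffAt ℝ ∞
    (fun X : Fin m → Fin m → mixedEmbedding.mixedSpace F => f (g * archOneAdd X)) 0

/-- The action of `X ∈ 𝔤𝔩_m(F_∞)` by right differentiation,
`(X f)(g) = d/dt f(g exp(tX)) |_{t=0} = d/dt f(g (1 + tX)) |_{t=0}`. -/
def lieDeriv {m : ℕ} (X : LieGL F m) (f : GLm m (𝔸 F) → ℂ) : GLm m (𝔸 F) → ℂ :=
  fun g => deriv (fun t : ℝ => f (g * archOneAdd (t • X))) 0

/-- The action `X₁ (X₂ (⋯ (X_k f)))` of a word `X₁ X₂ ⋯ X_k`. -/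
def wordDeriv {m : ℕ} (w : List (LieGL F m)) (f : GLm m (𝔸 F) → ℂ) : GLm m (𝔸 F) → ℂ :=
  w.foldr lieDeriv f

/-- A real linear combination of words as an element of the universal enveloping algebra. -/
def toEnveloping {m : ℕ} (a : List (LieGL F m) →₀ ℝ) :
    UniversalEnvelopingAlgebra ℝ (LieGL F m) :=
  a.sum fun w c => c • (w.map (UniversalEnvelopingAlgebra.ι ℝ)).prod

/-- The action of a real linear combination of words on a function. -/
def combDeriv {m : ℕ} (a : List (LieGL F m) →₀ ℝ) (f : GLm m (𝔸 F) → ℂ) : GLm m (𝔸 F) → ℂ :=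
  a.sum fun w c => (c : ℂ) • wordDeriv w f

/-! ### Automorphic forms and cusp forms -/

/-- Smooth automorphic forms on `GL_m(𝔸)`. -/
structure IsAutomorphicForm {m : ℕ} (f : GLm m (𝔸 F) → ℂ) : Prop where
  /-- left invariance under `GL_m(F)` -/
  left_invariant : ∀ γ ∈ rationalGL F m, ∀ g, f (γ * g) = f g
  /-- smoothness at the archimedean places -/
  arch_smooth : IsArchSmooth f
  /-- right invariance under an open subgroup of `GL_m(𝔸_fin)`, i.e. under all elements with
  trivial archimedean component in some neighbourhood of `1` -/
  finite_smooth : ∃ U ∈ 𝓝 (1 : GLm m (𝔸 F)), ∀ k ∈ U,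
    (∀ i j, ((k : Matrix (Fin m) (Fin m) (𝔸 F)) i j).1 =
      ((1 : Matrix (Fin m) (Fin m) (𝔸 F)) i j).1) → ∀ g, f (g * k) = f g
  /-- the translates of `f` under the centre of the universal enveloping algebra span a
  finite-dimensional space -/
  center_finite : FiniteDimensional ℂ (Submodule.span ℂ
    {h : GLm m (𝔸 F) → ℂ | ∃ a : List (LieGL F m) →₀ ℝ,
      toEnveloping a ∈ Subalgebra.center ℝ (UniversalEnvelopingAlgebra ℝ (LieGL F m)) ∧
        h = combDeriv a f})
  /-- uniform moderate growth -/
  moderate_growth : ∃ r : ℕ, ∀ w : List (LieGL F m), ∃ C : ℝ, ∀ g,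
    ‖wordDeriv w f g‖ ≤ C * height g ^ r

/-- Invariance under the centre `Z_m(𝔸)`, i.e. trivial central character. -/
def IsCentralInvariant {m : ℕ} (f : GLm m (𝔸 F) → ℂ) : Prop :=
  ∀ (z : (𝔸 F)ˣ) (g : GLm m (𝔸 F)), f (Matrix.GeneralLinearGroup.scalar (Fin m) z * g) = f g

/-- The unipotent radical of the standard maximal parabolic subgroup of type `(k, m - k)`:
the block matrices `(1 X; 0 1)` with `X` of size `k × (m - k)`. -/
def unipotentRadical (m k : ℕ) (R : Type*) [CommRing R] : Subgroup (GLm m R) where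
  carrier := {g | ∀ i j : Fin m, ¬ ((i : ℕ) < k ∧ k ≤ (j : ℕ)) →
    (g : Matrix (Fin m) (Fin m) R) i j = (1 : Matrix (Fin m) (Fin m) R) i j}
  one_mem' := fun _ _ _ => rfl
  mul_mem' := by
    intro a b ha hb i j hij
    rw [Units.val_mul, Matrix.mul_apply]
    by_cases hi : (i : ℕ) < k
    · rw [← ha i j hij]
      trans ∑ l, (a : Matrix (Fin m) (Fin m) R) i l * (1 : Matrix (Fin m) (Fin m) R) l j
      · exact Finset.sum_congr rfl fun l _ => by rw [hb l j fun h => hij ⟨hi, h.2⟩]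
      · rw [← Matrix.mul_apply, Matrix.mul_one]
    · rw [← hb i j hij]
      trans ∑ l, (1 : Matrix (Fin m) (Fin m) R) i l * (b : Matrix (Fin m) (Fin m) R) l j
      · exact Finset.sum_congr rfl fun l _ => by rw [ha i l fun h => hi h.1]
      · rw [← Matrix.mul_apply, Matrix.one_mul]
  inv_mem' := by
    intro a ha i j hij
    by_cases hi : (i : ℕ) < k
    · have h : ((a⁻¹ * a : GLm m R) : Matrix (Fin m) (Fin m) R) i j =
          (1 : Matrix (Fin m) (Fin m) R) i j := by rw [inv_mul_cancel, Units.val_one]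
      rw [← h, Units.val_mul, Matrix.mul_apply]
      trans ∑ l, ((a⁻¹ : GLm m R) : Matrix (Fin m) (Fin m) R) i l *
        (1 : Matrix (Fin m) (Fin m) R) l j
      · rw [← Matrix.mul_apply, Matrix.mul_one]
      · exact Finset.sum_congr rfl fun l _ => by rw [ha l j fun h => hij ⟨hi, h.2⟩]
    · have h : ((a * a⁻¹ : GLm m R) : Matrix (Fin m) (Fin m) R) i j =
          (1 : Matrix (Fin m) (Fin m) R) i j := by rw [mul_inv_cancel, Units.val_one]
      rw [← h, Units.val_mul, Matrix.mul_apply]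
      trans ∑ l, (1 : Matrix (Fin m) (Fin m) R) i l *
        ((a⁻¹ : GLm m R) : Matrix (Fin m) (Fin m) R) l j
      · rw [← Matrix.mul_apply, Matrix.one_mul]
      · exact Finset.sum_congr rfl fun l _ => by rw [ha i l fun h => hi h.1]

/-- The rational points `U(F)` of the unipotent radical `U`, as a subgroup of `U(𝔸)`. -/
def rationalUnipotent (F : Type*) [Field F] [NumberField F] (m k : ℕ) :
    Subgroup (unipotentRadical m k (𝔸 F)) :=
  (rationalGL F m).subgroupOf (unipotentRadical m k (𝔸 F))

/-- Cusp forms on `GL_m(𝔸)`: automorphic forms `f` with `∫_{U(F) \ U(𝔸)} f(u g) du = 0` for all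
`g` and the unipotent radical `U` of every proper standard maximal parabolic subgroup (hence for
that of every proper parabolic subgroup). -/
structure IsCuspForm {m : ℕ} (f : GLm m (𝔸 F) → ℂ) : Prop extends IsAutomorphicForm f where
  cuspidal : ∀ k : ℕ, 0 < k → k < m →
    ∀ (du : Measure (unipotentRadical m k (𝔸 F))) [du.IsHaarMeasure] (g : GLm m (𝔸 F)),
      quotientIntegral (rationalUnipotent F m k) du (fun u => f (u * g)) = 0

/-! ### The central average and the period -/

/-- The embedding `h ↦ (h 0; 0 1)` of `GL_m` into `GL_{m+1}`. -/
def corner {m : ℕ} {R : Type*} [CommRing R] (h : GLm m R) : GLm (m + 1) R where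
  val := Matrix.reindex finSumFinEquiv finSumFinEquiv
    (Matrix.fromBlocks (h : Matrix (Fin m) (Fin m) R) 0 0 (1 : Matrix (Fin 1) (Fin 1) R))
  inv := Matrix.reindex finSumFinEquiv finSumFinEquiv
    (Matrix.fromBlocks ((h⁻¹ : GLm m R) : Matrix (Fin m) (Fin m) R) 0 0
      (1 : Matrix (Fin 1) (Fin 1) R))
  val_inv := by
    simp [Matrix.submatrix_mul_equiv, Matrix.fromBlocks_multiply]
  inv_val := by
    simp [Matrix.submatrix_mul_equiv, Matrix.fromBlocks_multiply]

/-- The Weyl element `w₁₂ ∈ GL_{m+2}` exchanging the last two coordinates. -/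
def weylSwap (m : ℕ) (R : Type*) [CommRing R] : GLm (m + 2) R where
  val := (Equiv.swap (Fin.last m).castSucc (Fin.last (m + 1))).permMatrix R
  inv := (Equiv.swap (Fin.last m).castSucc (Fin.last (m + 1))).permMatrix R
  val_inv := by rw [← Matrix.permMatrix_mul]; simp
  inv_val := by rw [← Matrix.permMatrix_mul]; simp

/-- The translate `Φ̌(g) = Φ(g w₁₂)` on `GL_{m+2}(𝔸)`. -/
def check {m : ℕ} (Φ : GLm (m + 2) (𝔸 F) → ℂ) : GLm (m + 2) (𝔸 F) → ℂ :=
  fun g => Φ (g * weylSwap m (𝔸 F))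

/-- The integrand `u ↦ Φ(z_n(u) h, 1) |u|^{n(s - 1/2)}` of the central average. -/
def averageIntegrand {n : ℕ} (s : ℂ) (Φ : GLm (n + 1) (𝔸 F) → ℂ) (h : GLm n (𝔸 F)) :
    (𝔸 F)ˣ → ℂ :=
  fun u => Φ (corner (Matrix.GeneralLinearGroup.scalar (Fin n) u * h)) *
    (idelicNorm u : ℂ) ^ ((n : ℂ) * (s - 1 / 2))

/-- The central average
`𝒜_s Φ(h) = |det h|^{s - 1/2} ∫_{Fˣ \ 𝔸ˣ} Φ(z_n(u) h, 1) |u|^{n(s - 1/2)} dˣu` on `GL_n(𝔸)`. -/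
def centralAverage {n : ℕ} (du : Measure (𝔸 F)ˣ) (s : ℂ) (Φ : GLm (n + 1) (𝔸 F) → ℂ) :
    GLm n (𝔸 F) → ℂ :=
  fun h => (idelicNorm (Matrix.GeneralLinearGroup.det h) : ℂ) ^ (s - 1 / 2) *
    quotientIntegral (rationalIdeles F) du (averageIntegrand s Φ h)

/-- The integrand `h ↦ ϕ(h, 1) φ(h) |det h|^{w - 1/2}` of the period. -/
def periodIntegrand {m : ℕ} (w : ℂ) (ϕ : GLm (m + 1) (𝔸 F) → ℂ) (φ : GLm m (𝔸 F) → ℂ) :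
    GLm m (𝔸 F) → ℂ :=
  fun h => ϕ (corner h) * φ h *
    (idelicNorm (Matrix.GeneralLinearGroup.det h) : ℂ) ^ (w - 1 / 2)

/-- The period
`I(w, ϕ, φ) = ∫_{GL_m(F) \ GL_m(𝔸)} ϕ(h, 1) φ(h) |det h|^{w - 1/2} dh`. -/
def period {m : ℕ} (dh : Measure (GLm m (𝔸 F))) (w : ℂ) (ϕ : GLm (m + 1) (𝔸 F) → ℂ)
    (φ : GLm m (𝔸 F) → ℂ) : ℂ :=
  quotientIntegral (rationalGL F m) dh (periodIntegrand w ϕ φ)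

end AdelicPeriods

end

/-!
Both sides of the identity are one and the same double integral. Inserting the definition of the
central average, the period of `centralAverage du s Ψ` against `φ` is the integral of
`K(h, u) = Ψ(diag(u h, u, 1)) φ(h) |det h| ^ a |u| ^ b` (`periodKernel`) over
`GL_m(F) \ GL_m(𝔸)` and `Fˣ \ 𝔸ˣ`, with `a = s + w - 1` and `b = (m + 1) (s - 1 / 2)`; this is
`period_centralAverage`. The parameters `s'`, `w'` are the ones with `s' + w' - 1 = a` and
`(m + 1) (s' - 1 / 2) = m a - b`. The Weyl element is rational and commutes past `diag(u h, u, 1)`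
up to exchanging the last two entries, so that invariance under the rational points and under the
centre gives `Φ(diag(u h, u, 1) w₁₂) = Φ(diag(u h, 1, u)) = Φ(diag(h, u⁻¹, 1))`. Since `φ` is
invariant under the centre, the kernel of `check Φ` with exponents `a`, `m a - b` at `(h, u)` is
the kernel of `Φ` with exponents `a`, `b` at `(u h, u⁻¹)` (`periodKernel_check`). Fubini's theorem
and the invariance of the Haar measures under translation and inversion finish the proof
(`integral_periodKernel_check`).

All analytic content is in the absolute convergence, `integrable_periodKernel`. It combines
reduction theory with the rapid decay of cusp forms.

Reduction theory, in the crude form sufficient here, says that `GL_m(𝔸)` is covered by the sets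
`GL_m(F) t C`, where `C` is compact and `t` runs through archimedean diagonal matrices with entries
powers of two, in no particular order (`exists_reduction`, `exists_reduction_ideles`). At the
finite places, strong approximation and the finiteness of the class number bound the denominators
(`exists_fin_reduction_matrix`). At the archimedean places, Hermite's theorem on positive definite
quadratic forms gives a `ℤ`-basis of the lattice `𝓞ᵐ g` whose lengths have product bounded by the
covolume, and one extracts an `F`-basis from it (`exists_arch_reduction`). As the `t` are
parametrized by `ℤᵐ`, the integrability over the quotient becomes the convergence of a series.

For the decay, let `Φ` be a cusp form, and `U` the unipotent radical of a maximal parabolic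
subgroup. The mean value of `Φ` over `U(F) \ U(𝔸)` vanishes, so that `Φ` is bounded by its
oscillation on a compact set of representatives (`IsCuspForm.norm_le_of_oscillation`). In each
archimedean coordinate of `U` the form is periodic, and the oscillation of a periodic function is
bounded by its derivatives of any order (`norm_sub_le_of_periodic`). At the point `t κ` with
`κ ∈ C`, each derivative along the root `t_i / t_j` gains a factor `t_j / t_i`, whereas uniform
moderate growth bounds all derivatives by a fixed power of the height
(`IsAutomorphicForm.exists_oscillation`, `IsCuspForm.exists_decay_of_ratio`). After a permutation
of the entries of `t`, by a rational permutation matrix, the entries are decreasing, and the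
parabolic subgroup of the largest simple root gives decay in every ratio of entries of `t`
(`IsCuspForm.exists_decay`). Applied to `diag(u h, u, 1)`, this beats the moderate growth of `φ`
and of the powers of `|det h|` and `|u|` (`exists_bound_periodKernel`).
-/

noncomputable section

namespace AdelicPeriods

variable {F : Type*} [Field F] [NumberField F]

open IsDedekindDomain HeightOneSpectrum

set_option linter.unusedSectionVars false

section

/-! ### Completions at the finite places -/

theorem numberField_countable (F : Type*) [Field F] [NumberField F] : Countable F :=
  (Module.finBasis ℚ F).equivFun.toEquiv.injective.countable

instance countable_heightOneSpectrum : Countable (HeightOneSpectrum (𝓞 F)) := by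
  have := numberField_countable F
  have h1 : Countable (𝓞 F) := RingOfIntegers.coe_injective.countable
  have h2 : Function.Surjective (fun s : Finset (𝓞 F) => Ideal.span (s : Set (𝓞 F))) := fun I =>
    (IsNoetherian.noetherian I)
  have h3 : Countable (Ideal (𝓞 F)) := h2.countable
  exact Function.Injective.countable (f := fun v : HeightOneSpectrum (𝓞 F) => v.asIdeal)
    fun v w h => HeightOneSpectrum.ext h

section Local

variable (v : HeightOneSpectrum (𝓞 F))

theorem mem_integers_iff_norm_le_one (x : v.adicCompletion F) :
    x ∈ v.adicCompletionIntegers F ↔ ‖x‖ ≤ 1 :=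
  (mem_adicCompletionIntegers _ _ _).trans Valued.toNormedField.norm_le_one_iff.symm

theorem exists_coe_norm_sub_lt (x : v.adicCompletion F) {ε : ℝ} (hε : 0 < ε) :
    ∃ a : F, ‖x - (a : v.adicCompletion F)‖ < ε := by
  have hd := denseRange_algebraMap (R := 𝓞 F) F v
  obtain ⟨a, ha⟩ := hd.exists_dist_lt x hε
  exact ⟨a, by rw [← dist_eq_norm]; exact ha⟩

theorem norm_coe_int_le_one (a : 𝓞 F) : ‖((a : F) : v.adicCompletion F)‖ ≤ 1 :=
  FinitePlace.norm_le_one F v a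

theorem norm_coe_int_lt_one_iff (a : 𝓞 F) :
    ‖((a : F) : v.adicCompletion F)‖ < 1 ↔ a ∈ v.asIdeal :=
  FinitePlace.norm_lt_one_iff_mem F v a

theorem norm_coe_le_iff (a b : F) : ‖(a : v.adicCompletion F)‖ ≤ ‖(b : v.adicCompletion F)‖ ↔
    v.valuation F a ≤ v.valuation F b := by
  rw [← adicCompletion.valued_coe, ← adicCompletion.valued_coe]
  exact Valued.toNormedField.norm_le_iff

theorem norm_coe_lt_iff (a b : F) : ‖(a : v.adicCompletion F)‖ < ‖(b : v.adicCompletion F)‖ ↔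
    v.valuation F a < v.valuation F b := by
  rw [← adicCompletion.valued_coe, ← adicCompletion.valued_coe]
  exact Valued.toNormedField.norm_lt_iff

theorem coe_adic_eq_zero_iff {a : F} : (a : v.adicCompletion F) = 0 ↔ a = 0 :=
  map_eq_zero (FinitePlace.embedding v)

theorem norm_sub_le_max_of_ultra (x y : v.adicCompletion F) : ‖x - y‖ ≤ max ‖x‖ ‖y‖ := by
  have h := IsUltrametricDist.norm_add_le_max x (-y)
  rwa [norm_neg, ← sub_eq_add_neg] at h

theorem exists_int_norm_sub_lt {x : v.adicCompletion F} (hx : ‖x‖ ≤ 1) {ε : ℝ} (hε : 0 < ε) :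
    ∃ a : 𝓞 F, ‖x - ((a : F) : v.adicCompletion F)‖ < ε := by
  -- a nonzero element of small norm
  obtain ⟨c, hc0, hc⟩ : ∃ c : F, c ≠ 0 ∧ ‖(c : v.adicCompletion F)‖ < ε := by
    obtain ⟨p, hpv, hp0⟩ := Submodule.exists_mem_ne_zero_of_ne_bot v.ne_bot
    have hp1 := (norm_coe_int_lt_one_iff v p).2 hpv
    obtain ⟨k, hk⟩ := exists_pow_lt_of_lt_one hε hp1
    refine ⟨(p : F) ^ k, pow_ne_zero _ (by simpa using hp0), ?_⟩
    have : (((p : F) ^ k : F) : v.adicCompletion F) = ((p : F) : v.adicCompletion F) ^ k :=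
      map_pow (FinitePlace.embedding v) _ _
    rwa [this, norm_pow]
  have hcn : 0 < ‖(c : v.adicCompletion F)‖ := norm_pos_iff.2 fun h => hc0 ((coe_adic_eq_zero_iff v).1 h)
  obtain ⟨d, hd⟩ := exists_coe_norm_sub_lt v x (lt_min hcn one_pos)
  have hd1 : ‖(d : v.adicCompletion F)‖ ≤ 1 := by
    have h := norm_sub_le_max_of_ultra v x (x - (d : v.adicCompletion F))
    rw [sub_sub_cancel] at h
    exact h.trans (max_le hx (hd.trans_le (min_le_right _ _)).le)
  have hd2 : v.valuation F d ≤ 1 := by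
    rw [← adicCompletion.valued_coe]
    exact Valued.toNormedField.norm_le_one_iff.1 hd1
  have hcu : v.valuation F c ≠ 0 := (Valuation.ne_zero_iff _).2 hc0
  obtain ⟨a, ha⟩ := exists_valuation_sub_lt_of_integer v hd2 (Units.mk0 _ hcu)
  refine ⟨a, ?_⟩
  have h1 : ‖(((a : F) - d : F) : v.adicCompletion F)‖ < ε :=
    ((norm_coe_lt_iff v _ _).2 ha).trans hc
  have h2 : x - ((a : F) : v.adicCompletion F) =
      (x - (d : v.adicCompletion F)) - (((a : F) - d : F) : v.adicCompletion F) := by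
    have : (((a : F) - d : F) : v.adicCompletion F) = ((a : F) : v.adicCompletion F) - d :=
      map_sub (FinitePlace.embedding v) _ _
    rw [this]; ring
  rw [h2]
  exact (norm_sub_le_max_of_ultra v _ _).trans_lt
    (max_lt ((hd.trans_le (min_le_left _ _)).trans hc) h1)

instance compactSpace_adicCompletionIntegers : CompactSpace (v.adicCompletionIntegers F) := by
  have hfin : Finite (Valued.ResidueField (v.adicCompletion F)) := by
    have hf : Finite (𝓞 F ⧸ v.asIdeal) := v.asIdeal.finiteQuotientOfFreeOfNeBot v.ne_bot
    let g : 𝓞 F →+* Valued.ResidueField (v.adicCompletion F) :=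
      (IsLocalRing.residue (Valued.integer (v.adicCompletion F))).comp
        (algebraMap (𝓞 F) (v.adicCompletionIntegers F))
    have hg : ∀ a ∈ v.asIdeal, g a = 0 := by
      intro a ha
      refine (IsLocalRing.residue_eq_zero_iff _).2 ?_
      refine (Valuation.mem_maximalIdeal_iff _ _).2 ?_
      exact Valued.toNormedField.norm_lt_one_iff.1 ((norm_coe_int_lt_one_iff v a).2 ha)
    refine Finite.of_surjective (Ideal.Quotient.lift v.asIdeal g hg) fun y => ?_
    obtain ⟨x, rfl⟩ := IsLocalRing.residue_surjective y
    obtain ⟨a, ha⟩ := exists_int_norm_sub_lt v (x := x)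
      ((mem_integers_iff_norm_le_one v _).1 x.2) one_pos
    refine ⟨Ideal.Quotient.mk _ a, ?_⟩
    rw [Ideal.Quotient.lift_mk]
    symm
    rw [← sub_eq_zero]
    change IsLocalRing.residue _ x - IsLocalRing.residue _ _ = 0
    rw [← map_sub]
    refine (IsLocalRing.residue_eq_zero_iff _).2 ?_
    refine (Valuation.mem_maximalIdeal_iff _ _).2 ?_
    exact Valued.toNormedField.norm_lt_one_iff.1 ha
  have hdvr : IsDiscreteValuationRing (Valued.integer (v.adicCompletion F)) :=
    inferInstanceAs (IsDiscreteValuationRing (v.adicCompletionIntegers F))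
  have hcomp : CompleteSpace (Valued.integer (v.adicCompletion F)) :=
    (Valued.isClosed_integer _).completeSpace_coe
  exact Valued.integer.compactSpace_iff_completeSpace_and_isDiscreteValuationRing_and_finite_residueField.2
    ⟨hcomp, hdvr, hfin⟩

end Local

end

section

/-! ### The ring of finite adeles -/

/-- The ring of finite adeles of `F`. -/
abbrev Af (F : Type*) [Field F] [NumberField F] : Type _ := FiniteAdeleRing (𝓞 F) F

/-- The component of a finite adele at a place, as a ring homomorphism. -/
def finEval (v : HeightOneSpectrum (𝓞 F)) : Af F →+* v.adicCompletion F where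
  toFun x := x v
  map_one' := rfl
  map_mul' _ _ := rfl
  map_zero' := rfl
  map_add' _ _ := rfl

theorem Af.mul_apply (x y : Af F) (v : HeightOneSpectrum (𝓞 F)) : (x * y) v = x v * y v := rfl
theorem Af.add_apply (x y : Af F) (v : HeightOneSpectrum (𝓞 F)) : (x + y) v = x v + y v := rfl
theorem Af.sub_apply (x y : Af F) (v : HeightOneSpectrum (𝓞 F)) : (x - y) v = x v - y v := rfl
theorem Af.neg_apply (x : Af F) (v : HeightOneSpectrum (𝓞 F)) : (-x) v = -x v := rfl
theorem Af.one_apply (v : HeightOneSpectrum (𝓞 F)) : (1 : Af F) v = 1 := rfl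
theorem Af.zero_apply (v : HeightOneSpectrum (𝓞 F)) : (0 : Af F) v = 0 := rfl

theorem finite_not_integral (x : Af F) : {v | ¬ ‖x v‖ ≤ 1}.Finite := by
  have h := x.2
  rw [Filter.eventually_cofinite] at h
  refine h.subset fun v hv hv' => hv ((mem_integers_iff_norm_le_one v _).1 hv')

/-- A family of local elements, almost all integral, as a finite adele. -/
def Af.mk (x : ∀ v : HeightOneSpectrum (𝓞 F), v.adicCompletion F)
    (hx : {v | ¬ ‖x v‖ ≤ 1}.Finite) : Af F :=
  ⟨x, by
    rw [Filter.eventually_cofinite]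
    exact hx.subset fun v hv hv' => hv ((mem_integers_iff_norm_le_one v _).2 hv')⟩

/-- The subring of everywhere integral finite adeles. -/
def intAdeles (F : Type*) [Field F] [NumberField F] : Subring (Af F) where
  carrier := {x | ∀ v, ‖x v‖ ≤ 1}
  mul_mem' := fun {x y} hx hy v => by
    rw [Af.mul_apply, norm_mul]; exact mul_le_one₀ (hx v) (norm_nonneg _) (hy v)
  one_mem' := fun v => by rw [Af.one_apply, norm_one]
  add_mem' := fun {x y} hx hy v => by
    rw [Af.add_apply]; exact (IsUltrametricDist.norm_add_le_max _ _).trans (max_le (hx v) (hy v))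
  zero_mem' := fun v => by rw [Af.zero_apply, norm_zero]; exact zero_le_one
  neg_mem' := fun {x} hx v => by rw [Af.neg_apply, norm_neg]; exact hx v

theorem isOpen_localIntegers (v : HeightOneSpectrum (𝓞 F)) :
    IsOpen (v.adicCompletionIntegers F : Set (v.adicCompletion F)) :=
  Valued.isOpen_valuationSubring _

theorem isOpenEmbedding_structureMap_fin :
    IsOpenEmbedding (RestrictedProduct.structureMap
      (fun v : HeightOneSpectrum (𝓞 F) => v.adicCompletion F)
      (fun v => (v.adicCompletionIntegers F : Set (v.adicCompletion F))) Filter.cofinite) :=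
  RestrictedProduct.isOpenEmbedding_structureMap isOpen_localIntegers

theorem range_structureMap_fin : Set.range (RestrictedProduct.structureMap
      (fun v : HeightOneSpectrum (𝓞 F) => v.adicCompletion F)
      (fun v => (v.adicCompletionIntegers F : Set (v.adicCompletion F))) Filter.cofinite) =
      (intAdeles F : Set (Af F)) := by
  rw [RestrictedProduct.range_structureMap]
  ext x
  exact forall_congr' fun v => mem_integers_iff_norm_le_one v _

theorem isOpen_intAdeles : IsOpen (intAdeles F : Set (Af F)) := by
  rw [← range_structureMap_fin]
  exact isOpenEmbedding_structureMap_fin.isOpen_range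

theorem isCompact_intAdeles : IsCompact (intAdeles F : Set (Af F)) := by
  rw [← range_structureMap_fin]
  have : ∀ v : HeightOneSpectrum (𝓞 F),
      CompactSpace (v.adicCompletionIntegers F : Set (v.adicCompletion F)) :=
    fun v => compactSpace_adicCompletionIntegers v
  exact isCompact_range isOpenEmbedding_structureMap_fin.continuous

instance : T2Space (Af F) := inferInstanceAs (T2Space (RestrictedProduct _ _ _))

instance : LocallyCompactSpace (Af F) :=
  isCompact_intAdeles.locallyCompactSpace_of_mem_nhds_of_addGroup
    (isOpen_intAdeles.mem_nhds (zero_mem (intAdeles F)))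

theorem algebraMap_finite_apply (a : F) (v : HeightOneSpectrum (𝓞 F)) :
    algebraMap F (Af F) a v = (a : v.adicCompletion F) := rfl

theorem algebraMap_int_mem (a : 𝓞 F) : algebraMap F (Af F) a ∈ intAdeles F :=
  fun v => norm_coe_int_le_one v a

theorem exists_int_of_mem_intAdeles {a : F} (ha : algebraMap F (Af F) a ∈ intAdeles F) :
    ∃ b : 𝓞 F, (b : F) = a := by
  have h := mem_integers_of_valuation_le_one (R := 𝓞 F) F a fun v => by
    rw [← adicCompletion.valued_coe]
    exact Valued.toNormedField.norm_le_one_iff.1 (ha v)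
  exact h

theorem finite_norm_int_lt_one {a : 𝓞 F} (ha : a ≠ 0) :
    {v : HeightOneSpectrum (𝓞 F) | ‖((a : F) : v.adicCompletion F)‖ < 1}.Finite := by
  simp only [norm_coe_int_lt_one_iff]
  simp only [← Ideal.dvd_span_singleton]
  exact Ideal.finite_factors (by simpa using ha)

theorem norm_coe_mul_fin (v : HeightOneSpectrum (𝓞 F)) (a b : F) :
    ‖((a * b : F) : v.adicCompletion F)‖ = ‖(a : v.adicCompletion F)‖ * ‖(b : v.adicCompletion F)‖ := by
  rw [show ((a * b : F) : v.adicCompletion F) = a * b from map_mul (FinitePlace.embedding v) _ _,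
    norm_mul]

/-- Neighbourhoods of `0` contain the multiples of some nonzero integer. -/
theorem exists_int_mul_mem_of_nhds {U : Set (Af F)} (hU : U ∈ 𝓝 (0 : Af F)) :
    ∃ M : 𝓞 F, M ≠ 0 ∧ ∀ x ∈ intAdeles F, algebraMap F (Af F) M * x ∈ U := by
  classical
  set e := RestrictedProduct.structureMap
      (fun v : HeightOneSpectrum (𝓞 F) => v.adicCompletion F)
      (fun v => (v.adicCompletionIntegers F : Set (v.adicCompletion F))) Filter.cofinite with he
  have hcont := (isOpenEmbedding_structureMap_fin (F := F)).continuous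
  have h0 : e (fun v => ⟨0, zero_mem (v.adicCompletionIntegers F)⟩) = (0 : Af F) := rfl
  have hpre : e ⁻¹' U ∈ 𝓝 (fun v : HeightOneSpectrum (𝓞 F) =>
      (⟨0, zero_mem (v.adicCompletionIntegers F)⟩ :
        (v.adicCompletionIntegers F : Set (v.adicCompletion F)))) :=
    hcont.continuousAt.preimage_mem_nhds (by rw [← he, h0]; exact hU)
  rw [nhds_pi, Filter.mem_pi] at hpre
  obtain ⟨S, hS, t, ht, hsub⟩ := hpre
  have hloc : ∀ v : HeightOneSpectrum (𝓞 F), ∃ M : 𝓞 F, M ≠ 0 ∧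
      ∀ y : v.adicCompletionIntegers F, ‖(y : v.adicCompletion F)‖ ≤
        ‖((M : F) : v.adicCompletion F)‖ → y ∈ t v := by
    intro v
    obtain ⟨W, hW, hWt⟩ := mem_nhds_induced _ _ _ |>.1 (ht v)
    obtain ⟨ε, hε, hball⟩ := Metric.mem_nhds_iff.1 hW
    obtain ⟨p, hpv, hp0⟩ := Submodule.exists_mem_ne_zero_of_ne_bot v.ne_bot
    have hp1 := (norm_coe_int_lt_one_iff v p).2 hpv
    obtain ⟨k, hk⟩ := exists_pow_lt_of_lt_one hε hp1
    refine ⟨p ^ k, pow_ne_zero _ hp0, fun y hy => hWt (hball ?_)⟩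
    have : (((p ^ k : 𝓞 F) : F) : v.adicCompletion F) = ((p : F) : v.adicCompletion F) ^ k := by
      push_cast
      exact map_pow (FinitePlace.embedding v) _ _
    rw [this, norm_pow] at hy
    simpa using hy.trans_lt hk
  choose M hM0 hM using hloc
  refine ⟨∏ v ∈ hS.toFinset, M v, Finset.prod_ne_zero_iff.2 fun v _ => hM0 v, fun x hx => ?_⟩
  have hMx : ∀ v, ‖(algebraMap F (Af F) ((∏ v ∈ hS.toFinset, M v : 𝓞 F) : F) * x) v‖ ≤ 1 :=
    mul_mem (algebraMap_int_mem _) hx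
  have hmem : (fun v : HeightOneSpectrum (𝓞 F) =>
      (⟨_, (mem_integers_iff_norm_le_one v _).2 (hMx v)⟩ :
        (v.adicCompletionIntegers F : Set (v.adicCompletion F)))) ∈ e ⁻¹' U := by
    refine hsub fun v hv => hM v _ ?_
    change ‖(algebraMap F (Af F) ((∏ v ∈ hS.toFinset, M v : 𝓞 F) : F) * x : Af F) v‖ ≤ _
    rw [Af.mul_apply, norm_mul]
    refine (mul_le_of_le_one_right (norm_nonneg _) (hx v)).trans ?_
    rw [algebraMap_finite_apply, ← Finset.mul_prod_erase _ _ (hS.mem_toFinset.2 hv)]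
    push_cast
    rw [norm_coe_mul_fin]
    refine mul_le_of_le_one_right (norm_nonneg _) ?_
    exact_mod_cast norm_coe_int_le_one v (∏ w ∈ hS.toFinset.erase v, M w)
  exact hmem

/-- Strong approximation: a finite adele is a rational number up to an integral adele. -/
theorem exists_sub_mem_intAdeles (x : Af F) :
    ∃ a : F, x - algebraMap F (Af F) a ∈ intAdeles F := by
  classical
  have hfin := finite_not_integral x
  -- a common denominator
  have hloc : ∀ v : HeightOneSpectrum (𝓞 F), ∃ b : 𝓞 F, b ≠ 0 ∧
      ‖x v * ((b : F) : v.adicCompletion F)‖ ≤ 1 := by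
    intro v
    obtain ⟨b, hb, hb'⟩ :=
      adicCompletion.mul_nonZeroDivisor_mem_adicCompletionIntegers (K := F) v (x v)
    exact ⟨b, nonZeroDivisors.ne_zero hb, (mem_integers_iff_norm_le_one v _).1 hb'⟩
  choose b hb0 hb using hloc
  set N : 𝓞 F := ∏ v ∈ hfin.toFinset, b v with hN
  have hN0 : N ≠ 0 := Finset.prod_ne_zero_iff.2 fun v _ => hb0 v
  have hNF : (N : F) ≠ 0 := by simpa using hN0
  have hNx : ∀ v, ‖x v * ((N : F) : v.adicCompletion F)‖ ≤ 1 := by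
    intro v
    by_cases hv : v ∈ hfin.toFinset
    · rw [hN, ← Finset.mul_prod_erase _ _ hv]
      push_cast
      rw [norm_mul, norm_coe_mul_fin, ← mul_assoc, ← norm_mul]
      refine mul_le_one₀ (hb v) (norm_nonneg _) ?_
      exact_mod_cast norm_coe_int_le_one v (∏ w ∈ hfin.toFinset.erase v, b w)
    · have : ‖x v‖ ≤ 1 := by simpa using hv
      rw [norm_mul]
      exact mul_le_one₀ this (norm_nonneg _) (norm_coe_int_le_one v N)
  have hT := finite_norm_int_lt_one hN0
  have hNv : ∀ v : HeightOneSpectrum (𝓞 F), 0 < ‖((N : F) : v.adicCompletion F)‖ := fun v =>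
    norm_pos_iff.2 fun h => hNF ((coe_adic_eq_zero_iff v).1 h)
  have ha : ∀ v : HeightOneSpectrum (𝓞 F), ∃ a : 𝓞 F,
      ‖x v * ((N : F) : v.adicCompletion F) - ((a : F) : v.adicCompletion F)‖ <
        ‖((N : F) : v.adicCompletion F)‖ := fun v => exists_int_norm_sub_lt v (hNx v) (hNv v)
  choose a ha using ha
  have he : ∀ v : HeightOneSpectrum (𝓞 F), ∃ e : ℕ, ∀ z ∈ v.asIdeal ^ e,
      ‖((z : F) : v.adicCompletion F)‖ ≤ ‖((N : F) : v.adicCompletion F)‖ := by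
    intro v
    refine ⟨(Associates.mk v.asIdeal).count (Associates.mk (Ideal.span {N} : Ideal (𝓞 F))).factors,
      fun z hz => (norm_coe_le_iff v _ _).2 ?_⟩
    · have h1 := (v.intValuation_le_pow_iff_mem z _).2 hz
      rw [show v.valuation F (z : F) = v.intValuation z from valuation_of_algebraMap v z,
        show v.valuation F (N : F) = v.intValuation N from valuation_of_algebraMap v N]
      refine h1.trans_eq (v.intValuation_if_neg hN0).symm
  choose e he using he
  obtain ⟨y, hy⟩ := IsDedekindDomain.exists_forall_sub_mem_ideal (s := hT.toFinset)
    (fun v : HeightOneSpectrum (𝓞 F) => v.asIdeal) e (fun v _ => v.prime)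
    (fun v _ w _ h h' => h (HeightOneSpectrum.ext h')) (fun v => a v)
  refine ⟨(y : F) / N, fun v => ?_⟩
  have key : ‖x v * ((N : F) : v.adicCompletion F) - ((y : F) : v.adicCompletion F)‖ ≤
      ‖((N : F) : v.adicCompletion F)‖ := by
    by_cases hv : v ∈ hT.toFinset
    · have h1 := he v _ (hy v hv)
      have h2 : x v * ((N : F) : v.adicCompletion F) - ((y : F) : v.adicCompletion F) =
          (x v * ((N : F) : v.adicCompletion F) - ((a v : F) : v.adicCompletion F)) -
          (((y - a v : 𝓞 F) : F) : v.adicCompletion F) := by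
        have : (((y - a v : 𝓞 F) : F) : v.adicCompletion F) =
            ((y : F) : v.adicCompletion F) - ((a v : F) : v.adicCompletion F) := by
          push_cast
          exact map_sub (FinitePlace.embedding v) _ _
        rw [this]; ring
      rw [h2]
      exact (norm_sub_le_max_of_ultra v _ _).trans (max_le (ha v).le h1)
    · have h1 : ‖((N : F) : v.adicCompletion F)‖ = 1 := by
        refine le_antisymm (norm_coe_int_le_one v N) ?_
        simpa using hv
      rw [h1]
      exact (norm_sub_le_max_of_ultra v _ _).trans (max_le (hNx v) (norm_coe_int_le_one v y))
  rw [Af.sub_apply, algebraMap_finite_apply]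
  have h3 : x v - (((y : F) / N : F) : v.adicCompletion F) =
      (x v * ((N : F) : v.adicCompletion F) - ((y : F) : v.adicCompletion F)) /
        ((N : F) : v.adicCompletion F) := by
    rw [show (((y : F) / N : F) : v.adicCompletion F) = ((y : F) : v.adicCompletion F) /
      ((N : F) : v.adicCompletion F) from map_div₀ (FinitePlace.embedding v) _ _]
    have : ((N : F) : v.adicCompletion F) ≠ 0 := norm_pos_iff.1 (hNv v)
    field_simp
  rw [h3, norm_div]
  exact div_le_one_of_le₀ key (norm_nonneg _)

/-- Every invertible finite adele `c` has a nonzero integral multiple of the form `c * b` with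
`M = c * b` a rational integer of `F`. -/
theorem exists_int_mul_inv_mem (c : (Af F)ˣ) :
    ∃ M : 𝓞 F, M ≠ 0 ∧ (↑c⁻¹ : Af F) * algebraMap F (Af F) M ∈ intAdeles F := by
  have hU : {y : Af F | (↑c⁻¹ : Af F) * y ∈ intAdeles F} ∈ 𝓝 (0 : Af F) := by
    refine (isOpen_intAdeles.preimage (continuous_const_mul (↑c⁻¹ : Af F))).mem_nhds ?_
    simp [zero_mem]
  obtain ⟨M, hM, h⟩ := exists_int_mul_mem_of_nhds hU
  exact ⟨M, hM, by simpa using h 1 (one_mem _)⟩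

theorem isUnit_algebraMap_fin {a : F} (ha : a ≠ 0) : IsUnit (algebraMap F (Af F) a) :=
  (IsUnit.mk0 a ha).map _

theorem exists_sub_mem_mul_intAdeles (x : Af F) (c : (Af F)ˣ) :
    ∃ a : F, (↑c⁻¹ : Af F) * (x - algebraMap F (Af F) a) ∈ intAdeles F := by
  obtain ⟨M, hM, hcM⟩ := exists_int_mul_inv_mem c
  have hMF : (M : F) ≠ 0 := by simpa using hM
  obtain ⟨a, ha⟩ := exists_sub_mem_intAdeles (algebraMap F (Af F) (M : F)⁻¹ * x)
  refine ⟨M * a, ?_⟩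
  have h : (↑c⁻¹ : Af F) * (x - algebraMap F (Af F) (M * a)) =
      ((↑c⁻¹ : Af F) * algebraMap F (Af F) M) *
        (algebraMap F (Af F) (M : F)⁻¹ * x - algebraMap F (Af F) a) := by
    have h1 : algebraMap F (Af F) (M : F) * algebraMap F (Af F) (M : F)⁻¹ = 1 := by
      rw [← map_mul, mul_inv_cancel₀ hMF, map_one]
    rw [map_mul]
    linear_combination (-(↑c⁻¹ : Af F) * x) * h1
  rw [h]
  exact mul_mem hcM ha

instance : SecondCountableTopology (Af F) := by
  have := numberField_countable F
  have h1 : ∀ v : HeightOneSpectrum (𝓞 F), SecondCountableTopology (v.adicCompletion F) := by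
    intro v
    have : TopologicalSpace.SeparableSpace (v.adicCompletion F) :=
      ⟨⟨_, Set.countable_range _, denseRange_algebraMap (R := 𝓞 F) F v⟩⟩
    exact UniformSpace.secondCountable_of_separable _
  have h2 : SecondCountableTopology (intAdeles F : Set (Af F)) := by
    rw [← range_structureMap_fin]
    exact (isOpenEmbedding_structureMap_fin (F := F)).isEmbedding.toHomeomorph.symm.secondCountableTopology
  let U : F → Set (Af F) := fun a => (fun x => x - algebraMap F (Af F) a) ⁻¹' (intAdeles F)
  have hU : ∀ a, IsOpen (U a) := fun a => isOpen_intAdeles.preimage (by fun_prop)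
  have : ∀ a, SecondCountableTopology (U a) := by
    intro a
    let g : U a → (intAdeles F : Set (Af F)) := fun x => ⟨x.1 - algebraMap F (Af F) a, x.2⟩
    have hg : IsEmbedding g := by
      refine IsEmbedding.of_comp (by fun_prop) continuous_subtype_val ?_
      exact (Homeomorph.subRight (algebraMap F (Af F) a)).isEmbedding.comp IsEmbedding.subtypeVal
    exact hg.secondCountableTopology
  refine TopologicalSpace.secondCountableTopology_of_countable_cover hU ?_
  refine Set.eq_univ_of_forall fun x => Set.mem_iUnion.2 ?_
  exact exists_sub_mem_intAdeles x

end

section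

/-! ### Finiteness of the class number in terms of finite ideles -/

theorem algebraMap_fin_mul_inv {a : F} (ha : a ≠ 0) :
    algebraMap F (Af F) a * algebraMap F (Af F) a⁻¹ = 1 := by
  rw [← map_mul, mul_inv_cancel₀ ha, map_one]

/-- An integral invertible finite adele generates, locally at every place, the same module as some
element of `F` that it divides. -/
theorem exists_int_generator_at (a : (Af F)ˣ) (ha : (a : Af F) ∈ intAdeles F)
    (v : HeightOneSpectrum (𝓞 F)) :
    ∃ α : 𝓞 F, (↑a⁻¹ : Af F) * algebraMap F (Af F) α ∈ intAdeles F ∧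
      ‖((↑a⁻¹ : Af F) * algebraMap F (Af F) α) v‖ = 1 := by
  obtain ⟨p, hpv, hp0⟩ := Submodule.exists_mem_ne_zero_of_ne_bot v.ne_bot
  have hpF : (p : F) ≠ 0 := by simpa using hp0
  have hp1 := (norm_coe_int_lt_one_iff v p).2 hpv
  set P : (Af F)ˣ := (isUnit_algebraMap_fin hpF).unit with hP
  have hPv : (P : Af F) = algebraMap F (Af F) (p : F) := rfl
  obtain ⟨α, hα⟩ := exists_sub_mem_mul_intAdeles (a : Af F) (a * P)
  set z : Af F := (↑(a * P)⁻¹ : Af F) * (a - algebraMap F (Af F) α) with hz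
  have h1 : (↑a⁻¹ : Af F) * algebraMap F (Af F) α = 1 - algebraMap F (Af F) (p : F) * z := by
    have e1 : (↑a⁻¹ : Af F) * a = 1 := a.inv_mul
    have e2 : algebraMap F (Af F) (p : F) * (↑P⁻¹ : Af F) = 1 := by rw [← hPv]; exact P.mul_inv
    rw [hz, mul_inv, Units.val_mul]
    linear_combination ((↑a⁻¹ : Af F) * (a - algebraMap F (Af F) α)) * e2 + e1
  have h2 : (↑a⁻¹ : Af F) * algebraMap F (Af F) α ∈ intAdeles F := by
    rw [h1]
    exact sub_mem (one_mem _) (mul_mem (algebraMap_int_mem p) hα)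
  obtain ⟨β, hβ⟩ : ∃ b : 𝓞 F, (b : F) = α := by
    refine exists_int_of_mem_intAdeles ?_
    have := mul_mem ha h2
    rwa [← mul_assoc, a.mul_inv, one_mul] at this
  refine ⟨β, by rwa [hβ], ?_⟩
  rw [hβ, h1, Af.sub_apply, Af.one_apply, Af.mul_apply, algebraMap_finite_apply]
  have h3 : ‖((p : F) : v.adicCompletion F) * z v‖ < 1 := by
    rw [norm_mul]
    exact mul_lt_one_of_nonneg_of_lt_one_left (norm_nonneg _) hp1 (hα v)
  refine le_antisymm ?_ ?_
  · refine (norm_sub_le_max_of_ultra v _ _).trans (max_le norm_one.le h3.le)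
  · by_contra hlt
    push Not at hlt
    have h4 := IsUltrametricDist.norm_add_le_max (1 - ((p : F) : v.adicCompletion F) * z v)
      (((p : F) : v.adicCompletion F) * z v)
    rw [sub_add_cancel, norm_one] at h4
    exact absurd h4 (not_le.2 (max_lt hlt h3))

theorem exists_mul_mem_of_integral : ∃ M : 𝓞 F, M ≠ 0 ∧ ∀ a : (Af F)ˣ,
    (a : Af F) ∈ intAdeles F → ∃ β : F, β ≠ 0 ∧
      (↑a⁻¹ : Af F) * algebraMap F (Af F) β ∈ intAdeles F ∧
      (a : Af F) * algebraMap F (Af F) (β⁻¹ * M) ∈ intAdeles F := by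
  classical
  have hJ : ∀ c : ClassGroup (𝓞 F), ∃ J : nonZeroDivisors (Ideal (𝓞 F)), ClassGroup.mk0 J = c :=
    fun c => ClassGroup.mk0_surjective c
  choose J hJ using hJ
  have hM : ∀ c : ClassGroup (𝓞 F), ∃ M ∈ (J c : Ideal (𝓞 F)), M ≠ 0 := fun c =>
    Submodule.exists_mem_ne_zero_of_ne_bot (nonZeroDivisors.ne_zero (J c).2)
  choose M hMJ hM0 using hM
  refine ⟨∏ c, M c, Finset.prod_ne_zero_iff.2 fun c _ => hM0 c, fun a ha => ?_⟩
  let I : Ideal (𝓞 F) :=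
    { carrier := {x | (↑a⁻¹ : Af F) * algebraMap F (Af F) x ∈ intAdeles F}
      add_mem' := fun {x y} hx hy => by
        have := (intAdeles F).add_mem hx hy
        rw [← mul_add, ← map_add] at this
        exact this
      zero_mem' := by simp [zero_mem]
      smul_mem' := fun c x hx => by
        have := (intAdeles F).mul_mem (algebraMap_int_mem c) hx
        rw [mul_left_comm, ← map_mul] at this
        exact this }
  have hI : I ≠ ⊥ := by
    obtain ⟨N, hN, hN'⟩ := exists_int_mul_inv_mem a
    intro h
    have : N ∈ I := hN'
    rw [h] at this
    exact hN (by simpa using this)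
  set c := ClassGroup.mk0 (⟨I, mem_nonZeroDivisors_iff_ne_zero.2 hI⟩ : nonZeroDivisors (Ideal (𝓞 F)))
  obtain ⟨x, y, hx, hy, hxy⟩ := ClassGroup.mk0_eq_mk0_iff.1 (hJ c).symm
  simp only at hxy
  have hxF : (x : F) ≠ 0 := by simpa using hx
  have hyF : (y : F) ≠ 0 := by simpa using hy
  have hMF : ((∏ c, M c : 𝓞 F) : F) ≠ 0 := by
    exact RingOfIntegers.coe_ne_zero_iff.2 (Finset.prod_ne_zero_iff.2 fun c _ => hM0 c)
  refine ⟨((∏ c, M c : 𝓞 F) : F) * y / x, div_ne_zero (mul_ne_zero hMF hyF) hxF, ?_, ?_⟩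
  · have h1 : y * M c ∈ Ideal.span {x} * I := by
      rw [hxy]
      exact Ideal.mul_mem_mul (Ideal.mem_span_singleton_self y) (hMJ c)
    obtain ⟨i, hi, hi'⟩ := Ideal.mem_span_singleton_mul.1 h1
    have h2 : (∏ c ∈ Finset.univ.erase c, M c) * i ∈ I := Ideal.mul_mem_left _ _ hi
    have h3 : (((∏ c ∈ Finset.univ.erase c, M c) * i : 𝓞 F) : F) =
        ((∏ c, M c : 𝓞 F) : F) * y / x := by
      rw [← Finset.mul_prod_erase _ _ (Finset.mem_univ c), eq_div_iff hxF]
      have h4 : (x : F) * i = y * M c := by exact_mod_cast congrArg (fun t : 𝓞 F => (t : F)) hi'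
      push_cast
      linear_combination (∏ c ∈ Finset.univ.erase c, (M c : F)) * h4
    rw [← h3]
    exact h2
  · intro v
    obtain ⟨α, hα, hαv⟩ := exists_int_generator_at a ha v
    have h1 : x * α ∈ Ideal.span {y} * (J c : Ideal (𝓞 F)) := by
      rw [← hxy]
      exact Ideal.mul_mem_mul (Ideal.mem_span_singleton_self x) hα
    obtain ⟨j, -, hj⟩ := Ideal.mem_span_singleton_mul.1 h1
    have h4 : (x : F) * α = y * j := by exact_mod_cast congrArg (fun t : 𝓞 F => (t : F)) hj.symm
    have h5 : ((a : Af F) * algebraMap F (Af F) ((((∏ c, M c : 𝓞 F) : F) * y / x)⁻¹ *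
        ((∏ c, M c : 𝓞 F) : F))) * ((↑a⁻¹ : Af F) * algebraMap F (Af F) α) =
        algebraMap F (Af F) j := by
      rw [mul_mul_mul_comm, a.mul_inv, one_mul, ← map_mul]
      congr 1
      field_simp
      linear_combination h4
    have h6 : ‖(((a : Af F) * algebraMap F (Af F) ((((∏ c, M c : 𝓞 F) : F) * y / x)⁻¹ *
        ((∏ c, M c : 𝓞 F) : F))) * ((↑a⁻¹ : Af F) * algebraMap F (Af F) α)) v‖ =
        ‖(algebraMap F (Af F) j : Af F) v‖ := by rw [h5]
    rw [Af.mul_apply, norm_mul, hαv, mul_one] at h6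
    rw [h6]
    exact norm_coe_int_le_one v j

/-- Finiteness of the class number, adelically: every invertible finite adele `a` is a rational
number times an element of a fixed compact set. -/
theorem exists_mul_mem_intAdeles : ∃ M : 𝓞 F, M ≠ 0 ∧ ∀ a : (Af F)ˣ,
    ∃ β : F, β ≠ 0 ∧ (↑a⁻¹ : Af F) * algebraMap F (Af F) β ∈ intAdeles F ∧
      (a : Af F) * algebraMap F (Af F) (β⁻¹ * M) ∈ intAdeles F := by
  obtain ⟨M, hM, h⟩ := exists_mul_mem_of_integral (F := F)
  refine ⟨M, hM, fun a => ?_⟩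
  obtain ⟨N, hN, hN'⟩ := exists_int_mul_inv_mem a⁻¹
  rw [inv_inv] at hN'
  have hNF : (N : F) ≠ 0 := by simpa using hN
  obtain ⟨β, hβ, h1, h2⟩ := h (a * (isUnit_algebraMap_fin hNF).unit) hN'
  refine ⟨β / N, div_ne_zero hβ hNF, ?_, ?_⟩
  · have e : (↑(a * (isUnit_algebraMap_fin hNF).unit)⁻¹ : Af F) =
        (↑a⁻¹ : Af F) * algebraMap F (Af F) (N : F)⁻¹ := by
      rw [mul_inv, Units.val_mul]
      congr 1
      refine Units.inv_eq_of_mul_eq_one_right ?_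
      exact algebraMap_fin_mul_inv hNF
    rw [e, mul_assoc, ← map_mul] at h1
    rwa [div_eq_inv_mul]
  · have e : ((a * (isUnit_algebraMap_fin hNF).unit : (Af F)ˣ) : Af F) =
        (a : Af F) * algebraMap F (Af F) (N : F) := rfl
    rw [e, mul_assoc, ← map_mul] at h2
    convert! h2 using 3
    field_simp

end

section

open scoped Classical

/-! ### The adele ring as a product -/

/-- The algebra `F ⊗ ℝ = ℝ^{r₁} × ℂ^{r₂}`. -/
abbrev E (F : Type*) [Field F] [NumberField F] : Type _ := mixedEmbedding.mixedSpace F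

theorem normAtPlace_ringEquiv (y : InfiniteAdeleRing F) (v : InfinitePlace F) :
    mixedEmbedding.normAtPlace v (InfiniteAdeleRing.ringEquiv_mixedSpace F y) = ‖y v‖ := by
  rw [InfiniteAdeleRing.ringEquiv_mixedSpace_apply]
  by_cases hv : v.IsReal
  · rw [mixedEmbedding.normAtPlace_apply_of_isReal hv]
    exact (InfinitePlace.Completion.isometry_extensionEmbeddingOfIsReal hv).norm_map_of_map_zero
      (map_zero _) _
  · rw [mixedEmbedding.normAtPlace_apply_of_isComplex (InfinitePlace.not_isReal_iff_isComplex.1 hv)]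
    exact (InfinitePlace.Completion.isometry_extensionEmbedding v).norm_map_of_map_zero
      (map_zero _) _

theorem normAtPlace_le_norm (x : E F) (v : InfinitePlace F) :
    mixedEmbedding.normAtPlace v x ≤ ‖x‖ := by
  classical
  by_cases hv : v.IsReal
  · rw [mixedEmbedding.normAtPlace_apply_of_isReal hv]
    exact (norm_le_pi_norm x.1 ⟨v, hv⟩).trans (norm_fst_le x)
  · rw [mixedEmbedding.normAtPlace_apply_of_isComplex (InfinitePlace.not_isReal_iff_isComplex.1 hv)]
    exact (norm_le_pi_norm x.2 ⟨v, InfinitePlace.not_isReal_iff_isComplex.1 hv⟩).trans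
      (norm_snd_le x)

theorem norm_ringEquiv_symm_apply (x : E F) (v : InfinitePlace F) :
    ‖(InfiniteAdeleRing.ringEquiv_mixedSpace F).symm x v‖ = mixedEmbedding.normAtPlace v x := by
  rw [← normAtPlace_ringEquiv, RingEquiv.apply_symm_apply]

theorem continuous_ringEquiv_mixedSpace :
    Continuous (InfiniteAdeleRing.ringEquiv_mixedSpace F) := by
  have h : (InfiniteAdeleRing.ringEquiv_mixedSpace F : InfiniteAdeleRing F → E F) = fun x =>
      (fun v : {w : InfinitePlace F // w.IsReal} =>
        InfinitePlace.Completion.extensionEmbeddingOfIsReal v.2 (x v),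
       fun v : {w : InfinitePlace F // w.IsComplex} =>
        InfinitePlace.Completion.extensionEmbedding v.1 (x v)) := rfl
  rw [h]
  refine Continuous.prodMk (continuous_pi fun v => ?_) (continuous_pi fun v => ?_)
  · exact (InfinitePlace.Completion.isometry_extensionEmbeddingOfIsReal v.2).continuous.comp
      (continuous_apply (A := fun v : InfinitePlace F => v.Completion) v.1)
  · exact (InfinitePlace.Completion.isometry_extensionEmbedding v.1).continuous.comp
      (continuous_apply (A := fun v : InfinitePlace F => v.Completion) v.1)

theorem continuous_ringEquiv_mixedSpace_symm :
    Continuous (InfiniteAdeleRing.ringEquiv_mixedSpace F).symm := by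
  refine continuous_pi fun v => ?_
  let f : E F →+ v.Completion :=
    { toFun := fun x => (InfiniteAdeleRing.ringEquiv_mixedSpace F).symm x v
      map_zero' := by rw [map_zero]; rfl
      map_add' := fun x y => by rw [map_add]; rfl }
  refine AddMonoidHomClass.continuous_of_bound f 1 fun x => ?_
  rw [one_mul]
  exact (norm_ringEquiv_symm_apply x v).trans_le (normAtPlace_le_norm x v)

/-- The adele ring is the product of `F ⊗ ℝ` and the ring of finite adeles. -/
def adeleEquiv (F : Type*) [Field F] [NumberField F] : E F × Af F ≃+* 𝔸 F :=
  RingEquiv.prodCongr (InfiniteAdeleRing.ringEquiv_mixedSpace F).symm (RingEquiv.refl (Af F))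

/-- The archimedean component of an adele. -/
def archProj (F : Type*) [Field F] [NumberField F] : 𝔸 F →+* E F :=
  (RingHom.fst (E F) (Af F)).comp (adeleEquiv F).symm.toRingHom

/-- The finite component of an adele. -/
def finProj (F : Type*) [Field F] [NumberField F] : 𝔸 F →+* Af F :=
  (RingHom.snd (E F) (Af F)).comp (adeleEquiv F).symm.toRingHom

theorem archProj_apply (x : 𝔸 F) :
    archProj F x = InfiniteAdeleRing.ringEquiv_mixedSpace F x.1 := rfl

@[simp] theorem archProj_adeleEquiv (x : E F × Af F) : archProj F (adeleEquiv F x) = x.1 := by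
  simp [archProj]
@[simp] theorem finProj_adeleEquiv (x : E F × Af F) : finProj F (adeleEquiv F x) = x.2 := by
  simp [finProj]
theorem adeleEquiv_proj (x : 𝔸 F) : adeleEquiv F (archProj F x, finProj F x) = x :=
  (adeleEquiv F).apply_symm_apply x

theorem adele_ext {x y : 𝔸 F} (h₁ : archProj F x = archProj F y) (h₂ : finProj F x = finProj F y) :
    x = y := by
  rw [← adeleEquiv_proj x, ← adeleEquiv_proj y, h₁, h₂]

theorem continuous_adeleEquiv : Continuous (adeleEquiv F) :=
  Continuous.prodMk (continuous_ringEquiv_mixedSpace_symm.comp continuous_fst) continuous_snd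

theorem continuous_archProj : Continuous (archProj F) :=
  continuous_ringEquiv_mixedSpace.comp (continuous_fst (X := InfiniteAdeleRing F) (Y := Af F))

theorem continuous_finProj : Continuous (finProj F) :=
  continuous_snd (X := InfiniteAdeleRing F) (Y := Af F)

/-- `adeleEquiv` as a homeomorphism. -/
def adeleHomeo (F : Type*) [Field F] [NumberField F] : E F × Af F ≃ₜ 𝔸 F where
  toEquiv := (adeleEquiv F).toEquiv
  continuous_toFun := continuous_adeleEquiv
  continuous_invFun := continuous_archProj.prodMk continuous_finProj

instance : T2Space (𝔸 F) := (adeleHomeo F).t2Space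
instance : SecondCountableTopology (𝔸 F) := (adeleHomeo F).symm.secondCountableTopology
instance : LocallyCompactSpace (𝔸 F) :=
  (adeleHomeo F).symm.isClosedEmbedding.locallyCompactSpace

@[simp] theorem archProj_algebraMap (a : F) :
    archProj F (algebraMap F (𝔸 F) a) = mixedEmbedding F a := by
  rw [archProj_apply, InfiniteAdeleRing.mixedEmbedding_eq_algebraMap_comp]; rfl

@[simp] theorem finProj_algebraMap (a : F) :
    finProj F (algebraMap F (𝔸 F) a) = algebraMap F (Af F) a := rfl

theorem archProj_archAdele (x : E F) : archProj F (archAdele x) = x :=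
  (InfiniteAdeleRing.ringEquiv_mixedSpace F).apply_symm_apply x

theorem finProj_archAdele (x : E F) : finProj F (archAdele x) = 0 := rfl

/-! ### Topology of the adelic linear groups -/

section GLTop

variable {m : ℕ} {R S : Type*} [CommRing R] [TopologicalSpace R] [IsTopologicalRing R]
  [CommRing S] [TopologicalSpace S] [IsTopologicalRing S]

theorem continuous_glMap (f : R →+* S) (hf : Continuous f) :
    Continuous (Matrix.GeneralLinearGroup.map (n := Fin m) f) := by
  refine Units.continuous_iff.2 ⟨?_, ?_⟩
  · exact (Continuous.matrix_map Units.continuous_val hf)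
  · have : (fun g : GLm m R => ((Matrix.GeneralLinearGroup.map f g)⁻¹ : GLm m S).val) =
        fun g => ((g⁻¹ : GLm m R) : Matrix _ _ R).map f := by
      funext g
      rw [← map_inv]; rfl
    exact this ▸ (Continuous.matrix_map (Units.continuous_val.comp continuous_inv) hf)

instance [LocallyCompactSpace R] [T2Space R] : LocallyCompactSpace (GLm m R) := by
  have : LocallyCompactSpace (Matrix (Fin m) (Fin m) R) :=
    inferInstanceAs (LocallyCompactSpace (Fin m → Fin m → R))
  infer_instance

theorem secondCountable_units (M : Type*) [Monoid M] [TopologicalSpace M]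
    [SecondCountableTopology M] : SecondCountableTopology Mˣ := by
  have : SecondCountableTopology Mᵐᵒᵖ :=
    MulOpposite.opHomeomorph.symm.isEmbedding.secondCountableTopology
  exact Units.isEmbedding_embedProduct.secondCountableTopology

instance [SecondCountableTopology R] : SecondCountableTopology (GLm m R) := by
  have : SecondCountableTopology (Matrix (Fin m) (Fin m) R) :=
    inferInstanceAs (SecondCountableTopology (Fin m → Fin m → R))
  exact secondCountable_units _

instance : SecondCountableTopology (𝔸 F)ˣ := secondCountable_units _

theorem isCompact_gl [T2Space R] {K K' : Set R} (hK : IsCompact K) (hK' : IsCompact K') :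
    IsCompact {g : GLm m R | (∀ i j, (g : Matrix (Fin m) (Fin m) R) i j ∈ K) ∧
      ∀ i j, ((g⁻¹ : GLm m R) : Matrix (Fin m) (Fin m) R) i j ∈ K'} := by
  have h1 : IsCompact {A : Matrix (Fin m) (Fin m) R | ∀ i j, A i j ∈ K} := by
    have := isCompact_univ_pi (fun _ : Fin m => isCompact_univ_pi (fun _ : Fin m => hK))
    convert! this using 1
    ext A
    change (∀ i j, A i j ∈ _) ↔ ∀ i, _ → ∀ j, _ → A i j ∈ _
    simp
  have h2 : IsCompact {A : Matrix (Fin m) (Fin m) R | ∀ i j, A i j ∈ K'} := by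
    have := isCompact_univ_pi (fun _ : Fin m => isCompact_univ_pi (fun _ : Fin m => hK'))
    convert! this using 1
    ext A
    change (∀ i j, A i j ∈ _) ↔ ∀ i, _ → ∀ j, _ → A i j ∈ _
    simp
  have h3 := Units.isClosedEmbedding_embedProduct (α := Matrix (Fin m) (Fin m) R) |>.isCompact_preimage
    (h1.prod (h2.image MulOpposite.continuous_op))
  convert! h3 using 1
  ext g
  refine and_congr Iff.rfl ⟨fun h => ⟨_, h, rfl⟩, ?_⟩
  rintro ⟨A, hA, h⟩
  have : A = ((g⁻¹ : GLm m R) : Matrix (Fin m) (Fin m) R) := MulOpposite.op_injective h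
  rwa [← this]

end GLTop

end

section

open scoped Classical

/-! ### Archimedean and finite components of adelic matrices -/

section Components

variable {m : ℕ}

/-- The adelic matrix with given archimedean and finite components. -/
def matMk (A : Matrix (Fin m) (Fin m) (E F)) (B : Matrix (Fin m) (Fin m) (Af F)) :
    Matrix (Fin m) (Fin m) (𝔸 F) :=
  Matrix.of fun i j => adeleEquiv F (A i j, B i j)

theorem mat_ext {A B : Matrix (Fin m) (Fin m) (𝔸 F)} (h₁ : A.map (archProj F) = B.map (archProj F))
    (h₂ : A.map (finProj F) = B.map (finProj F)) : A = B := by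
  ext i j
  exact adele_ext (congrFun (congrFun h₁ i) j) (congrFun (congrFun h₂ i) j)

@[simp] theorem matMk_map_archProj (A : Matrix (Fin m) (Fin m) (E F))
    (B : Matrix (Fin m) (Fin m) (Af F)) : (matMk A B).map (archProj F) = A := by
  refine Matrix.ext fun i j => ?_
  exact archProj_adeleEquiv (A i j, B i j)

@[simp] theorem matMk_map_finProj (A : Matrix (Fin m) (Fin m) (E F))
    (B : Matrix (Fin m) (Fin m) (Af F)) : (matMk A B).map (finProj F) = B := by
  refine Matrix.ext fun i j => ?_
  exact finProj_adeleEquiv (A i j, B i j)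

theorem matMk_mul (A A' : Matrix (Fin m) (Fin m) (E F)) (B B' : Matrix (Fin m) (Fin m) (Af F)) :
    matMk A B * matMk A' B' = matMk (A * A') (B * B') := by
  apply mat_ext <;> simp [Matrix.map_mul]

theorem matMk_one : matMk (1 : Matrix (Fin m) (Fin m) (E F)) 1 = 1 := by
  apply mat_ext <;> simp [Matrix.map_one]

/-- The element of `GL_m(𝔸)` with given archimedean and finite components. -/
def glMk (a : GLm m (E F)) (b : GLm m (Af F)) : GLm m (𝔸 F) where
  val := matMk a b
  inv := matMk (a⁻¹ : GLm m (E F)) (b⁻¹ : GLm m (Af F))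
  val_inv := by simp [matMk_mul, matMk_one]
  inv_val := by simp [matMk_mul, matMk_one]

/-- The archimedean component of an adelic matrix. -/
def archPart : GLm m (𝔸 F) →* GLm m (E F) := Matrix.GeneralLinearGroup.map (archProj F)

/-- The finite component of an adelic matrix. -/
def finPart : GLm m (𝔸 F) →* GLm m (Af F) := Matrix.GeneralLinearGroup.map (finProj F)

theorem gl_ext {g h : GLm m (𝔸 F)} (h₁ : archPart g = archPart h) (h₂ : finPart g = finPart h) :
    g = h :=
  Units.ext (mat_ext (congrArg Units.val h₁) (congrArg Units.val h₂))

@[simp] theorem archPart_glMk (a : GLm m (E F)) (b : GLm m (Af F)) : archPart (glMk a b) = a :=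
  Units.ext (matMk_map_archProj _ _)
@[simp] theorem finPart_glMk (a : GLm m (E F)) (b : GLm m (Af F)) : finPart (glMk a b) = b :=
  Units.ext (matMk_map_finProj _ _)

/-- `GL_m(F ⊗ ℝ)` inside `GL_m(𝔸)`. -/
def archGL : GLm m (E F) →* GLm m (𝔸 F) where
  toFun a := glMk a 1
  map_one' := by apply gl_ext <;> simp
  map_mul' a b := by apply gl_ext <;> simp

/-- `GL_m(𝔸_fin)` inside `GL_m(𝔸)`. -/
def finGL : GLm m (Af F) →* GLm m (𝔸 F) where
  toFun b := glMk 1 b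
  map_one' := by apply gl_ext <;> simp
  map_mul' a b := by apply gl_ext <;> simp

@[simp] theorem archPart_archGL (a : GLm m (E F)) : archPart (archGL a) = a := archPart_glMk _ _
@[simp] theorem finPart_archGL (a : GLm m (E F)) : finPart (archGL a) = 1 := finPart_glMk _ _
@[simp] theorem archPart_finGL (a : GLm m (Af F)) : archPart (finGL a) = 1 := archPart_glMk _ _
@[simp] theorem finPart_finGL (a : GLm m (Af F)) : finPart (finGL a) = a := finPart_glMk _ _

theorem commute_archGL_finGL (a : GLm m (E F)) (b : GLm m (Af F)) :
    archGL a * finGL b = finGL b * archGL a := by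
  apply gl_ext <;> simp

theorem arch_mul_fin (g : GLm m (𝔸 F)) : archGL (archPart g) * finGL (finPart g) = g := by
  apply gl_ext <;> simp

theorem continuous_archPart : Continuous (archPart (F := F) (m := m)) :=
  continuous_glMap _ continuous_archProj
theorem continuous_finPart : Continuous (finPart (F := F) (m := m)) :=
  continuous_glMap _ continuous_finProj

theorem continuous_matMk : Continuous fun p : Matrix (Fin m) (Fin m) (E F) ×
    Matrix (Fin m) (Fin m) (Af F) => matMk p.1 p.2 := by
  refine continuous_matrix fun i j => ?_
  exact continuous_adeleEquiv.comp ((continuous_fst.matrix_elem i j).prodMk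
    (continuous_snd.matrix_elem i j))

theorem continuous_glMk : Continuous fun p : GLm m (E F) × GLm m (Af F) => glMk p.1 p.2 := by
  refine Units.continuous_iff.2 ⟨?_, ?_⟩
  · exact continuous_matMk.comp ((Units.continuous_val.comp continuous_fst).prodMk
      (Units.continuous_val.comp continuous_snd))
  · exact continuous_matMk.comp ((Units.continuous_val.comp (continuous_inv.comp continuous_fst)).prodMk
      (Units.continuous_val.comp (continuous_inv.comp continuous_snd)))

theorem continuous_archGL : Continuous (archGL (F := F) (m := m)) :=
  continuous_glMk.comp (continuous_id.prodMk continuous_const)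
theorem continuous_finGL : Continuous (finGL (F := F) (m := m)) :=
  continuous_glMk.comp (continuous_const.prodMk continuous_id)

/-- `GL_m(F)` inside `GL_m(𝔸)`. -/
def ratGL : GLm m F →* GLm m (𝔸 F) := Matrix.GeneralLinearGroup.map (algebraMap F (𝔸 F))

theorem ratGL_mem (γ : GLm m F) : ratGL γ ∈ rationalGL F m := ⟨γ, rfl⟩

theorem archPart_ratGL (γ : GLm m F) :
    archPart (ratGL γ) = Matrix.GeneralLinearGroup.map (mixedEmbedding F) γ := by
  refine Units.ext (Matrix.ext fun i j => ?_)
  exact archProj_algebraMap _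

theorem finPart_ratGL (γ : GLm m F) :
    finPart (ratGL γ) = Matrix.GeneralLinearGroup.map (algebraMap F (Af F)) γ := rfl

theorem archOneAdd_eq {X : Fin m → Fin m → E F} {a : GLm m (E F)}
    (h : (a : Matrix (Fin m) (Fin m) (E F)) = 1 + Matrix.of X) :
    archOneAdd X = archGL a := by
  have h1 : (archGL a : Matrix (Fin m) (Fin m) (𝔸 F)) = 1 + (Matrix.of X).map archAdele := by
    apply mat_ext
    · change (archPart (archGL a) : Matrix (Fin m) (Fin m) (E F)) = _
      rw [archPart_archGL, h]
      refine Matrix.ext fun i j => ?_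
      simp only [Matrix.map_apply, Matrix.add_apply, map_add, archProj_archAdele]
      congr 1
      by_cases hij : i = j
      · subst hij; simp
      · simp [hij]
    · change (finPart (archGL a) : Matrix (Fin m) (Fin m) (Af F)) = _
      rw [finPart_archGL]
      refine Matrix.ext fun i j => ?_
      simp only [Matrix.map_apply, Matrix.add_apply, map_add, finProj_archAdele, add_zero, Units.val_one]
      by_cases hij : i = j
      · subst hij; simp
      · simp [hij]
  have hu : IsUnit (1 + (Matrix.of X).map (archAdele (F := F))) := h1 ▸ (archGL a).isUnit
  unfold archOneAdd
  rw [dif_pos hu]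
  exact Units.ext h1.symm

end Components

/-! ### Discreteness of the rational points -/

theorem norm_le_norm_pow (x : E F) :
    mixedEmbedding.norm x ≤ ‖x‖ ^ Module.finrank ℚ F := by
  rw [mixedEmbedding.norm_apply, ← InfinitePlace.sum_mult_eq, ← Finset.prod_pow_eq_pow_sum]
  exact Finset.prod_le_prod (fun v _ => pow_nonneg (mixedEmbedding.normAtPlace_nonneg _ _) _)
    fun v _ => pow_le_pow_left₀ (mixedEmbedding.normAtPlace_nonneg _ _) (normAtPlace_le_norm x v) _

/-- `F` is discrete in `𝔸`: a non-zero integer has norm at least one. -/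
theorem exists_nhds_rational_eq_zero : ∃ U ∈ 𝓝 (0 : 𝔸 F), ∀ a : F, algebraMap F (𝔸 F) a ∈ U → a = 0 := by
  refine ⟨{x | ‖archProj F x‖ < 1} ∩ {x | finProj F x ∈ intAdeles F}, Filter.inter_mem ?_ ?_, ?_⟩
  · refine (isOpen_lt (continuous_archProj.norm) continuous_const).mem_nhds ?_
    simp
  · refine (isOpen_intAdeles.preimage continuous_finProj).mem_nhds ?_
    simp [zero_mem]
  · rintro a ⟨h1, h2⟩
    simp only [Set.mem_ofPred_eq, archProj_algebraMap, finProj_algebraMap] at h1 h2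
    obtain ⟨b, rfl⟩ := exists_int_of_mem_intAdeles h2
    by_contra hb
    have hb0 : b ≠ 0 := by simpa using hb
    have h3 := mixedEmbedding.norm_eq_norm (K := F) b
    have h4 : mixedEmbedding.norm (mixedEmbedding F b) < 1 := by
      exact (norm_le_norm_pow _).trans_lt (pow_lt_one₀ (norm_nonneg _) h1 Module.finrank_pos.ne')
    rw [h3] at h4
    have h5 : (1 : ℚ) ≤ |Algebra.norm ℚ (b : F)| := by
      have h6 : Algebra.norm ℤ b ≠ 0 := Algebra.norm_ne_zero_iff.2 hb0
      rw [← Algebra.coe_norm_int]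
      exact_mod_cast Int.one_le_abs h6
    have : (1 : ℝ) ≤ ((|Algebra.norm ℚ (b : F)| : ℚ) : ℝ) := by exact_mod_cast h5
    linarith

theorem exists_nhds_rationalGL (m : ℕ) :
    ∃ U ∈ 𝓝 (1 : GLm m (𝔸 F)), ∀ γ ∈ rationalGL F m, γ ∈ U → γ = 1 := by
  obtain ⟨U, hU, h⟩ := exists_nhds_rational_eq_zero (F := F)
  refine ⟨{g | ∀ i j, (g : Matrix (Fin m) (Fin m) (𝔸 F)) i j - (1 : Matrix (Fin m) (Fin m) (𝔸 F)) i j ∈ U}, ?_, ?_⟩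
  · have : ∀ i j, ∀ᶠ g : GLm m (𝔸 F) in 𝓝 1,
        (g : Matrix (Fin m) (Fin m) (𝔸 F)) i j - (1 : Matrix (Fin m) (Fin m) (𝔸 F)) i j ∈ U := by
      intro i j
      have hc : Continuous fun g : GLm m (𝔸 F) =>
        (g : Matrix (Fin m) (Fin m) (𝔸 F)) i j - (1 : Matrix (Fin m) (Fin m) (𝔸 F)) i j :=
        (Units.continuous_val.matrix_elem i j).sub continuous_const
      exact hc.continuousAt.eventually_mem (by simpa using hU)
    exact Filter.eventually_all.2 fun i => Filter.eventually_all.2 fun j => this i j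
  · rintro _ ⟨γ, rfl⟩ hγ
    have : γ = 1 := by
      ext i j
      have h1 := hγ i j
      have h2 : (1 : Matrix (Fin m) (Fin m) (𝔸 F)) i j =
          algebraMap F (𝔸 F) ((1 : Matrix (Fin m) (Fin m) F) i j) := by
        by_cases hij : i = j
        · subst hij; simp
        · simp [hij]
      rw [h2] at h1
      change algebraMap F (𝔸 F) (γ i j) - _ ∈ U at h1
      rw [← map_sub] at h1
      exact sub_eq_zero.1 (h _ h1)
    rw [this, map_one]

theorem exists_nhds_rationalIdeles :
    ∃ U ∈ 𝓝 (1 : (𝔸 F)ˣ), ∀ γ ∈ rationalIdeles F, γ ∈ U → γ = 1 := by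
  obtain ⟨U, hU, h⟩ := exists_nhds_rational_eq_zero (F := F)
  refine ⟨{g | (g : 𝔸 F) - 1 ∈ U}, ?_, ?_⟩
  · have hc : Continuous fun g : (𝔸 F)ˣ => (g : 𝔸 F) - 1 := Units.continuous_val.sub continuous_const
    exact hc.continuousAt.eventually_mem (by simpa using hU)
  · rintro _ ⟨γ, rfl⟩ hγ
    have : γ = 1 := by
      ext
      have h1 : algebraMap F (𝔸 F) γ - 1 ∈ U := hγ
      rw [← map_one (algebraMap F (𝔸 F)), ← map_sub] at h1
      exact sub_eq_zero.1 (h _ h1)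
    rw [this, map_one]

instance (m : ℕ) : Countable (rationalGL F m) := by
  have := numberField_countable F
  have : Countable (Matrix (Fin m) (Fin m) F) := inferInstanceAs (Countable (Fin m → Fin m → F))
  have : Countable (GLm m F) := Units.val_injective.countable
  exact (Set.countable_range _).to_subtype

instance : Countable (rationalIdeles F) := by
  have := numberField_countable F
  have : Countable Fˣ := Units.val_injective.countable
  exact (Set.countable_range _).to_subtype

end

section

open scoped Classical

/-! ### The idelic norm -/

theorem finite_norm_ne_one {x : Af F} {y : Af F} (h : x * y = 1) : {v | ‖x v‖ ≠ 1}.Finite := by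
  refine ((finite_not_integral x).union (finite_not_integral y)).subset fun v hv => ?_
  by_contra hcon
  simp only [Set.mem_union, Set.mem_ofPred_eq, not_or, not_not] at hcon
  have h1 : ‖x v‖ * ‖y v‖ = 1 := by rw [← norm_mul, ← Af.mul_apply, h, Af.one_apply, norm_one]
  refine hv (le_antisymm hcon.1 ?_)
  rw [← h1]
  exact mul_le_of_le_one_right (norm_nonneg _) hcon.2

/-- The finite part of the idelic norm. -/
def finNorm (x : (𝔸 F)ˣ) : ℝ :=
  ∏ᶠ v : HeightOneSpectrum (𝓞 F), ‖(finProj F (x : 𝔸 F)) v‖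

theorem idelicNorm_eq (x : (𝔸 F)ˣ) :
    idelicNorm x = mixedEmbedding.norm (archProj F x) * finNorm x := by
  unfold idelicNorm finNorm
  rw [mixedEmbedding.norm_apply]
  simp only [archProj_apply, normAtPlace_ringEquiv]
  rfl

theorem finite_mulSupport_finNorm (x : (𝔸 F)ˣ) :
    (Function.mulSupport fun v : HeightOneSpectrum (𝓞 F) => ‖(finProj F (x : 𝔸 F)) v‖).Finite :=
  finite_norm_ne_one (y := finProj F (↑x⁻¹ : 𝔸 F)) (by rw [← map_mul, x.mul_inv, map_one])

theorem finNorm_mul (x y : (𝔸 F)ˣ) : finNorm (x * y) = finNorm x * finNorm y := by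
  unfold finNorm
  rw [← finprod_mul_distrib (finite_mulSupport_finNorm x) (finite_mulSupport_finNorm y)]
  refine finprod_congr fun v => ?_
  rw [Units.val_mul, map_mul, Af.mul_apply, norm_mul]

theorem idelicNorm_mul (x y : (𝔸 F)ˣ) : idelicNorm (x * y) = idelicNorm x * idelicNorm y := by
  simp only [idelicNorm_eq, finNorm_mul, Units.val_mul, map_mul]
  ring

theorem idelicNorm_one : idelicNorm (1 : (𝔸 F)ˣ) = 1 := by
  rw [idelicNorm_eq]
  simp [finNorm, Af.one_apply]

theorem finNorm_pos (x : (𝔸 F)ˣ) : 0 < finNorm x := by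
  refine finprod_induction (fun r : ℝ => 0 < r) one_pos (fun _ _ => mul_pos)
    fun v => norm_pos_iff.2 fun h => ?_
  have h1 : (finProj F (x : 𝔸 F)) v * (finProj F (↑x⁻¹ : 𝔸 F)) v = 1 := by
    rw [← Af.mul_apply, ← map_mul, x.mul_inv, map_one, Af.one_apply]
  rw [h, zero_mul] at h1
  exact zero_ne_one h1

theorem idelicNorm_pos (x : (𝔸 F)ˣ) : 0 < idelicNorm x := by
  rw [idelicNorm_eq]
  refine mul_pos (lt_of_le_of_ne (mixedEmbedding.norm_nonneg _) fun h => ?_) (finNorm_pos x)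
  have h1 : mixedEmbedding.norm (archProj F x) * mixedEmbedding.norm (archProj F (↑x⁻¹ : 𝔸 F)) = 1 := by
    rw [← map_mul, ← map_mul, x.mul_inv, map_one, map_one]
  rw [← h, zero_mul] at h1
  exact zero_ne_one h1

theorem idelicNorm_inv (x : (𝔸 F)ˣ) : idelicNorm x⁻¹ = (idelicNorm x)⁻¹ := by
  refine eq_inv_of_mul_eq_one_left ?_
  rw [← idelicNorm_mul, inv_mul_cancel, idelicNorm_one]

theorem idelicNorm_pow (x : (𝔸 F)ˣ) (k : ℕ) : idelicNorm (x ^ k) = idelicNorm x ^ k := by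
  induction k with
  | zero => simp [idelicNorm_one]
  | succ k ih => rw [pow_succ, pow_succ, idelicNorm_mul, ih]

theorem finNorm_eq_one {x : (𝔸 F)ˣ} (h : finProj F (x : 𝔸 F) ∈ intAdeles F)
    (h' : finProj F (↑x⁻¹ : 𝔸 F) ∈ intAdeles F) : finNorm x = 1 := by
  refine finprod_eq_one_of_forall_eq_one fun v => le_antisymm (h v) ?_
  have h1 : ‖(finProj F (x : 𝔸 F)) v‖ * ‖(finProj F (↑x⁻¹ : 𝔸 F)) v‖ = 1 := by
    rw [← norm_mul, ← Af.mul_apply, ← map_mul, x.mul_inv, map_one, Af.one_apply, norm_one]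
  rw [← h1]
  exact mul_le_of_le_one_right (norm_nonneg _) (h' v)

theorem continuous_finNorm : Continuous (finNorm (F := F)) := by
  refine continuous_iff_continuousAt.2 fun x => ?_
  have hU : {y : (𝔸 F)ˣ | finProj F (y : 𝔸 F) ∈ intAdeles F ∧
      finProj F (↑y⁻¹ : 𝔸 F) ∈ intAdeles F} ∈ 𝓝 (1 : (𝔸 F)ˣ) := by
    refine Filter.inter_mem ?_ ?_
    · refine (isOpen_intAdeles.preimage (continuous_finProj.comp Units.continuous_val)).mem_nhds ?_
      simp [one_mem]
    · refine (isOpen_intAdeles.preimage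
        (continuous_finProj.comp (Units.continuous_val.comp continuous_inv))).mem_nhds ?_
      simp [one_mem]
  have hc : Filter.Tendsto (fun y => x⁻¹ * y) (𝓝 x) (𝓝 1) := by
    have : Continuous fun y => x⁻¹ * y := by fun_prop
    simpa using this.tendsto x
  refine (continuousAt_const (y := finNorm x)).congr ?_
  filter_upwards [hc hU] with y hy
  have : y = x * (x⁻¹ * y) := by group
  rw [this, finNorm_mul, finNorm_eq_one hy.1 hy.2, mul_one]

theorem continuous_mixedNorm : Continuous (mixedEmbedding.norm (K := F)) := by
  exact mixedEmbedding.continuous_norm F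

theorem continuous_idelicNorm : Continuous (idelicNorm (F := F)) := by
  have : (idelicNorm : (𝔸 F)ˣ → ℝ) = fun x : (𝔸 F)ˣ =>
      mixedEmbedding.norm (archProj F (x : 𝔸 F)) * finNorm x :=
    funext idelicNorm_eq
  rw [this]
  exact (continuous_mixedNorm.comp (continuous_archProj.comp Units.continuous_val)).mul
    continuous_finNorm

/-- The product formula. -/
theorem idelicNorm_rational {x : (𝔸 F)ˣ} (hx : x ∈ rationalIdeles F) : idelicNorm x = 1 := by
  obtain ⟨a, rfl⟩ := hx
  have h := prod_abs_eq_one (K := F) (x := a) a.ne_zero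
  rw [← h]
  unfold idelicNorm
  congr 1
  · refine Finset.prod_congr rfl fun v _ => ?_
    congr 1
    have := normAtPlace_ringEquiv (F := F) (algebraMap F _ (a : F)) v
    rw [← InfiniteAdeleRing.mixedEmbedding_eq_algebraMap_comp,
      mixedEmbedding.normAtPlace_apply] at this
    exact this.symm
  · rw [← finprod_comp_equiv FinitePlace.equivHeightOneSpectrum.symm]
    refine finprod_congr fun v => ?_
    rw [FinitePlace.equivHeightOneSpectrum_symm_apply]
    rfl

/-! ### The height -/

section Height

variable {m : ℕ}

/-- The local height of a matrix over the finite adeles. -/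
def localHeight (b : GLm m (Af F)) (v : HeightOneSpectrum (𝓞 F)) : ℝ :=
  ⨆ p : Fin m × Fin m, max ‖(b : Matrix (Fin m) (Fin m) (Af F)) p.1 p.2 v‖
    ‖((b⁻¹ : GLm m (Af F)) : Matrix (Fin m) (Fin m) (Af F)) p.1 p.2 v‖

/-- The finite part of the height. -/
def finHeight (b : GLm m (Af F)) : ℝ := ∏ᶠ v, localHeight b v

theorem localHeight_nonneg (b : GLm m (Af F)) (v : HeightOneSpectrum (𝓞 F)) :
    0 ≤ localHeight b v :=
  Real.iSup_nonneg fun _ => le_max_of_le_left (norm_nonneg _)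

theorem finHeight_nonneg (b : GLm m (Af F)) : 0 ≤ finHeight b :=
  finprod_nonneg fun v => localHeight_nonneg b v

theorem norm_le_localHeight (b : GLm m (Af F)) (v : HeightOneSpectrum (𝓞 F)) (i j : Fin m) :
    ‖(b : Matrix (Fin m) (Fin m) (Af F)) i j v‖ ≤ localHeight b v ∧
    ‖((b⁻¹ : GLm m (Af F)) : Matrix (Fin m) (Fin m) (Af F)) i j v‖ ≤ localHeight b v := by
  have h := le_ciSup (Set.finite_range (fun p : Fin m × Fin m =>
    max ‖(b : Matrix (Fin m) (Fin m) (Af F)) p.1 p.2 v‖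
    ‖((b⁻¹ : GLm m (Af F)) : Matrix (Fin m) (Fin m) (Af F)) p.1 p.2 v‖)).bddAbove (i, j)
  exact ⟨(le_max_left _ _).trans h, (le_max_right _ _).trans h⟩

/-- The maximal compact subgroup `GL_m` of the integral finite adeles. -/
def intGL (F : Type*) [Field F] [NumberField F] (m : ℕ) : Set (GLm m (Af F)) :=
  {g | (∀ i j, (g : Matrix (Fin m) (Fin m) (Af F)) i j ∈ intAdeles F) ∧
    ∀ i j, ((g⁻¹ : GLm m (Af F)) : Matrix (Fin m) (Fin m) (Af F)) i j ∈ intAdeles F}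

theorem intGL_mem_nhds_one : intGL F m ∈ 𝓝 (1 : GLm m (Af F)) := by
  have hmem : ∀ i j, (1 : Matrix (Fin m) (Fin m) (Af F)) i j ∈ intAdeles F := fun i j => by
    by_cases h : i = j
    · subst h; simp [one_mem]
    · simp [h, zero_mem]
  refine Filter.inter_mem ?_ ?_
  · refine Filter.eventually_all.2 fun i => Filter.eventually_all.2 fun j => ?_
    exact (isOpen_intAdeles.preimage (Units.continuous_val.matrix_elem i j)).mem_nhds (hmem i j)
  · refine Filter.eventually_all.2 fun i => Filter.eventually_all.2 fun j => ?_
    exact (isOpen_intAdeles.preimage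
      ((Units.continuous_val.comp continuous_inv).matrix_elem i j)).mem_nhds
        (by simpa using hmem i j)

theorem Af.sum_apply {ι : Type*} (s : Finset ι) (f : ι → Af F) (v : HeightOneSpectrum (𝓞 F)) :
    (∑ i ∈ s, f i) v = ∑ i ∈ s, f i v := map_sum (finEval v) f s

theorem localHeight_mul_le (b k : GLm m (Af F)) (hk : k ∈ intGL F m)
    (v : HeightOneSpectrum (𝓞 F)) : localHeight (b * k) v ≤ localHeight b v := by
  refine Real.iSup_le (fun p => max_le ?_ ?_) (localHeight_nonneg b v)
  · rw [Units.val_mul, Matrix.mul_apply, Af.sum_apply]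
    refine IsUltrametricDist.norm_sum_le_of_forall_le_of_nonneg (localHeight_nonneg b v)
      fun l _ => ?_
    rw [Af.mul_apply, norm_mul]
    exact (mul_le_of_le_one_right (norm_nonneg _) (hk.1 _ _ v)).trans (norm_le_localHeight b v _ _).1
  · rw [mul_inv_rev, Units.val_mul, Matrix.mul_apply, Af.sum_apply]
    refine IsUltrametricDist.norm_sum_le_of_forall_le_of_nonneg (localHeight_nonneg b v)
      fun l _ => ?_
    rw [Af.mul_apply, norm_mul]
    exact (mul_le_of_le_one_left (norm_nonneg _) (hk.2 _ _ v)).trans (norm_le_localHeight b v _ _).2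

theorem finHeight_mul (b k : GLm m (Af F)) (hk : k ∈ intGL F m) :
    finHeight (b * k) = finHeight b := by
  refine finprod_congr fun v => le_antisymm (localHeight_mul_le b k hk v) ?_
  have hk' : k⁻¹ ∈ intGL F m := ⟨hk.2, by simpa using hk.1⟩
  simpa using localHeight_mul_le (b * k) k⁻¹ hk' v

theorem continuous_finHeight : Continuous (finHeight (F := F) (m := m)) := by
  refine continuous_iff_continuousAt.2 fun x => ?_
  have hc : Filter.Tendsto (fun y => x⁻¹ * y) (𝓝 x) (𝓝 1) := by
    have : Continuous fun y => x⁻¹ * y := by fun_prop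
    simpa using this.tendsto x
  refine (continuousAt_const (y := finHeight x)).congr ?_
  filter_upwards [hc intGL_mem_nhds_one] with y hy
  have : y = x * (x⁻¹ * y) := by group
  rw [this, finHeight_mul _ _ hy]

/-- The height is at most the `[F : ℚ]`-th power of a common bound `S` for the archimedean entries,
times the finite part of the height. -/
theorem height_le {g : GLm m (𝔸 F)} {S : ℝ} (hS : 0 ≤ S)
    (h₁ : ∀ i j, ‖(archPart g : Matrix (Fin m) (Fin m) (E F)) i j‖ ≤ S)
    (h₂ : ∀ i j, ‖(archPart g⁻¹ : Matrix (Fin m) (Fin m) (E F)) i j‖ ≤ S) :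
    height g ≤ S ^ Module.finrank ℚ F * finHeight (finPart g) := by
  unfold height
  refine mul_le_mul_of_nonneg_right ?_ (finHeight_nonneg (finPart g))
  rw [← InfinitePlace.sum_mult_eq, ← Finset.prod_pow_eq_pow_sum]
  have hn : ∀ (x : 𝔸 F) (v : InfinitePlace F), ‖x.1 v‖ ≤ ‖archProj F x‖ := fun x v => by
    rw [← normAtPlace_ringEquiv]
    exact normAtPlace_le_norm _ v
  refine Finset.prod_le_prod (fun v _ => pow_nonneg
    (Real.iSup_nonneg fun _ => le_max_of_le_left (norm_nonneg _)) _) fun v _ => ?_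
  refine pow_le_pow_left₀ (Real.iSup_nonneg fun _ => le_max_of_le_left (norm_nonneg _)) ?_ _
  refine Real.iSup_le (fun p => max_le ?_ ?_) hS
  · exact (hn _ v).trans (h₁ p.1 p.2)
  · exact (hn _ v).trans (h₂ p.1 p.2)

end Height

end

section

/-! ### Fundamental domains of discrete subgroups -/

section FundamentalDomain

variable {G : Type*} [Group G] [MeasurableSpace G] (Γ : Subgroup G)

/-- A discrete countable subgroup of a second countable group has a Borel set of representatives:
translates `W i` of a small open set embed in the quotient, and one takes the points of each `W i`
whose orbit does not meet an earlier `W j`. -/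
theorem exists_fundamentalSet [TopologicalSpace G] [IsTopologicalGroup G]
    [SecondCountableTopology G] [BorelSpace G] [Countable Γ]
    (hΓ : ∃ U ∈ 𝓝 (1 : G), ∀ γ ∈ Γ, γ ∈ U → γ = 1) :
    ∃ 𝓕 : Set G, MeasurableSet 𝓕 ∧ ∀ g, ∃! γ : Γ, γ • g ∈ 𝓕 := by
  classical
  obtain ⟨U, hU, hUΓ⟩ := hΓ
  obtain ⟨V, hV, hV1, hVU⟩ : ∃ V : Set G, IsOpen V ∧ (1 : G) ∈ V ∧ V / V ⊆ U := by
    obtain ⟨V, h1, h2, h3⟩ := exists_open_nhds_one_mul_subset hU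
    refine ⟨V ∩ V⁻¹, h1.inter h1.inv, ⟨h2, by simpa using h2⟩, fun x hx => ?_⟩
    obtain ⟨a, ha, b, hb, rfl⟩ := hx
    exact h3 ⟨a, ha.1, b⁻¹, hb.2, (div_eq_mul_inv a b).symm⟩
  obtain ⟨s, hs, hcov⟩ := TopologicalSpace.countable_cover_nhds
    (f := fun x : G => {y | y * x⁻¹ ∈ V}) fun x =>
      (hV.preimage (continuous_mul_const x⁻¹)).mem_nhds (by simpa using hV1)
  have hne : s.Nonempty := by
    by_contra h
    rw [Set.not_nonempty_iff_eq_empty] at h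
    simp only [h, Set.mem_empty_iff_false, Set.iUnion_of_empty, Set.iUnion_empty] at hcov
    exact absurd (Set.mem_univ (1 : G)) (by rw [← hcov]; simp)
  obtain ⟨x, rfl⟩ := hs.exists_eq_range hne
  set W : ℕ → Set G := fun i => {y | y * (x i)⁻¹ ∈ V} with hW
  have hWo : ∀ i, IsOpen (W i) := fun i => hV.preimage (continuous_mul_const _)
  set O : ℕ → Set G := fun i => ⋃ γ : Γ, {y | (γ : G) * y ∈ W i} with hO
  have hOo : ∀ i, IsOpen (O i) := fun i => isOpen_iUnion fun γ =>
    (hWo i).preimage (continuous_const_mul (γ : G))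
  have hOinv : ∀ i (γ : Γ) y, (γ : G) * y ∈ O i → y ∈ O i := by
    intro i γ y hy
    obtain ⟨δ, hδ⟩ := Set.mem_iUnion.1 hy
    refine Set.mem_iUnion.2 ⟨δ * γ, ?_⟩
    simpa [mul_assoc] using hδ
  have hWO : ∀ i, W i ⊆ O i := fun i y hy => Set.mem_iUnion.2 ⟨1, by simpa using hy⟩
  have huniq : ∀ i (y : G) (γ δ : Γ), (γ : G) * y ∈ W i → (δ : G) * y ∈ W i → γ = δ := by
    intro i y γ δ h1 h2
    have h3 : ((γ : G) * y * (x i)⁻¹) / ((δ : G) * y * (x i)⁻¹) ∈ U :=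
      hVU (Set.div_mem_div h1 h2)
    have h4 : ((γ : G) * y * (x i)⁻¹) / ((δ : G) * y * (x i)⁻¹) = γ * (δ : G)⁻¹ := by
      rw [div_eq_mul_inv]
      group
    rw [h4] at h3
    have h5 := hUΓ _ (Γ.mul_mem γ.2 (Γ.inv_mem δ.2)) h3
    exact Subtype.ext (mul_inv_eq_one.1 h5)
  refine ⟨⋃ i, W i \ ⋃ j ∈ Set.Iio i, O j, ?_, fun g => ?_⟩
  · exact MeasurableSet.iUnion fun i => (hWo i).measurableSet.diff
      (isOpen_biUnion fun j _ => hOo j).measurableSet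
  · have hg : ∃ i, g ∈ O i := by
      have h := Set.mem_univ g
      rw [← hcov] at h
      simp only [Set.mem_iUnion, Set.mem_range, exists_prop, exists_exists_eq_and] at h
      obtain ⟨i, hi⟩ := h
      exact ⟨i, hWO i hi⟩
    obtain ⟨γ, hγ⟩ := Set.mem_iUnion.1 (Nat.find_spec hg)
    refine ⟨γ, Set.mem_iUnion.2 ⟨Nat.find hg, hγ, fun h => ?_⟩, fun δ hδ => ?_⟩
    · obtain ⟨j, hj, hj'⟩ := Set.mem_iUnion₂.1 h
      exact Nat.find_min hg hj (hOinv j γ g hj')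
    · obtain ⟨i, hi, hi'⟩ := Set.mem_iUnion.1 hδ
      have hmin : i = Nat.find hg := by
        refine le_antisymm ?_ (Nat.find_min' hg (hOinv i δ g (hWO i hi)))
        by_contra hlt
        refine hi' (Set.mem_iUnion₂.2 ⟨Nat.find hg, not_le.1 hlt, ?_⟩)
        refine Set.mem_iUnion.2 ⟨γ * δ⁻¹, ?_⟩
        have : (((γ * δ⁻¹ : Γ) : G) * (δ • g)) = γ * g := by
          change ((γ : G) * (δ : G)⁻¹) * ((δ : G) * g) = γ * g
          group
        simpa only [Set.mem_ofPred_eq, this] using hγ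
      rw [hmin] at hi
      exact huniq _ g δ γ hi hγ

variable {Γ} [MeasurableMul G] [Countable Γ] {μ : Measure G} {𝓕 : Set G}

theorem isFundamentalDomain_of_existsUnique (h : MeasurableSet 𝓕)
    (h' : ∀ g, ∃! γ : Γ, γ • g ∈ 𝓕) : IsFundamentalDomain Γ 𝓕 μ :=
  IsFundamentalDomain.mk' h.nullMeasurableSet h'

theorem apply_out_toQuot {α : Type*} {f : G → α} (hf : ∀ γ ∈ Γ, ∀ g, f (γ * g) = f g) (g : G) :
    f (toQuot Γ g).out = f g := by
  have h : toQuot Γ (toQuot Γ g).out = toQuot Γ g := Quotient.out_eq' _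
  obtain ⟨γ, hγ⟩ := (toQuot_eq_iff Γ _ _).1 h
  rw [← hγ]
  exact hf γ γ.2 g

theorem measurable_apply_out {f : G → ℂ} (hf : ∀ γ ∈ Γ, ∀ g, f (γ * g) = f g)
    (hm : Measurable f) : Measurable fun x : MulAction.orbitRel.Quotient Γ G => f x.out := by
  refine measurable_from_quotient.2 ?_
  have : (fun x : MulAction.orbitRel.Quotient Γ G => f x.out) ∘ Quotient.mk'' = f :=
    funext fun g => apply_out_toQuot hf g
  rw [this]
  exact hm

variable [μ.IsMulLeftInvariant]

theorem quotientIntegral_eq (h𝓕 : IsFundamentalDomain Γ 𝓕 μ) {f : G → ℂ}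
    (hf : ∀ γ ∈ Γ, ∀ g, f (γ * g) = f g) (hm : Measurable f) :
    quotientIntegral Γ μ f = ∫ x in 𝓕, f x ∂μ := by
  rw [quotientIntegral, quotientMeasure_eq_map_restrict Γ μ 𝓕 h𝓕,
    integral_map (measurable_toQuot Γ).aemeasurable
      (measurable_apply_out hf hm).aestronglyMeasurable]
  exact integral_congr_ae (Filter.Eventually.of_forall fun g => apply_out_toQuot hf g)

theorem quotientIntegrable_iff (h𝓕 : IsFundamentalDomain Γ 𝓕 μ) {f : G → ℂ}
    (hf : ∀ γ ∈ Γ, ∀ g, f (γ * g) = f g) (hm : Measurable f) :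
    QuotientIntegrable Γ μ f ↔ IntegrableOn f 𝓕 μ := by
  rw [QuotientIntegrable, quotientMeasure_eq_map_restrict Γ μ 𝓕 h𝓕,
    integrable_map_measure (measurable_apply_out hf hm).aestronglyMeasurable
      (measurable_toQuot Γ).aemeasurable]
  refine integrable_congr (Filter.Eventually.of_forall fun g => apply_out_toQuot hf g)

/-- If the translates of the sets `S i` cover the group, then an integral over a fundamental domain
is at most the sum of the integrals over the `S i`. -/
theorem lintegral_fundamentalDomain_le {ι : Type*} [Countable ι]
    (h𝓕 : IsFundamentalDomain Γ 𝓕 μ) {S : ι → Set G}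
    (hS : ∀ i, MeasurableSet (S i)) (hcov : ∀ g, ∃ i, ∃ γ ∈ Γ, γ * g ∈ S i)
    {f : G → ENNReal} (hf : ∀ γ ∈ Γ, ∀ g, f (γ * g) = f g) (hm : Measurable f) :
    ∫⁻ x in 𝓕, f x ∂μ ≤ ∑' i, ∫⁻ x in S i, f x ∂μ := by
  have h1 : ∑' i, ∫⁻ x in S i, f x ∂μ = ∫⁻ x, ∑' i, (S i).indicator f x ∂μ := by
    rw [lintegral_tsum fun i => (hm.indicator (hS i)).aemeasurable]
    exact tsum_congr fun i => (lintegral_indicator (hS i) f).symm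
  rw [h1, h𝓕.lintegral_eq_tsum'']
  rw [← lintegral_tsum]
  · refine lintegral_mono fun x => ?_
    obtain ⟨i, γ, hγ, hi⟩ := hcov x
    refine le_trans ?_ (ENNReal.le_tsum (⟨γ, hγ⟩ : Γ))
    refine le_trans ?_ (ENNReal.le_tsum i)
    have : (⟨γ, hγ⟩ : Γ) • x ∈ S i := hi
    rw [Set.indicator_of_mem this]
    exact (hf γ hγ x).ge
  · intro γ
    refine Measurable.aemeasurable ?_
    exact (Measurable.tsum fun i => hm.indicator (hS i)).comp (measurable_const_mul (γ : G))

end FundamentalDomain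

/-- An integrability criterion on a product of quotients: if the translates of the measurable sets
`S i` and `T j` cover the two groups and `∑ c i * μ (S i)`, `∑ d j * ν (T j)` are finite, where
`‖f‖ ≤ c i * d j` on `S i ×ˢ T j`, then `f` is integrable on the product of fundamental domains. -/
theorem integrable_prod_of_cover {G H ι κ : Type*} [Group G] [Group H] [MeasurableSpace G]
    [MeasurableSpace H] [MeasurableMul G] [MeasurableMul H] {Γ : Subgroup G} {Δ : Subgroup H}
    [Countable Γ] [Countable Δ] [Countable ι] [Countable κ]
    {μ : Measure G} {ν : Measure H} [SFinite μ] [SFinite ν] [μ.IsMulLeftInvariant]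
    [ν.IsMulLeftInvariant]
    {𝓕 : Set G} {𝓓 : Set H} (h𝓕 : IsFundamentalDomain Γ 𝓕 μ) (h𝓓 : IsFundamentalDomain Δ 𝓓 ν)
    {S : ι → Set G} {T : κ → Set H} (hS : ∀ i, MeasurableSet (S i)) (hT : ∀ j, MeasurableSet (T j))
    (hScov : ∀ g, ∃ i, ∃ γ ∈ Γ, γ * g ∈ S i) (hTcov : ∀ g, ∃ j, ∃ γ ∈ Δ, γ * g ∈ T j)
    {f : G × H → ℂ} (hm : Measurable f) (hf₁ : ∀ γ ∈ Γ, ∀ g h, f (γ * g, h) = f (g, h))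
    (hf₂ : ∀ γ ∈ Δ, ∀ g h, f (g, γ * h) = f (g, h))
    {c : ι → ENNReal} {d : κ → ENNReal}
    (hcd : ∀ i j, ∀ g ∈ S i, ∀ h ∈ T j, ‖f (g, h)‖ₑ ≤ c i * d j)
    (hc : ∑' i, c i * μ (S i) ≠ ⊤) (hd : ∑' j, d j * ν (T j) ≠ ⊤) :
    Integrable f ((μ.restrict 𝓕).prod (ν.restrict 𝓓)) := by
  refine ⟨hm.aestronglyMeasurable, ?_⟩
  have hm' : Measurable fun p : G × H => ‖f p‖ₑ := hm.enorm
  rw [HasFiniteIntegral, lintegral_prod _ hm'.aemeasurable]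
  have hin : ∀ i, ∀ g ∈ S i, ∫⁻ h in 𝓓, ‖f (g, h)‖ₑ ∂ν ≤ c i * ∑' j, d j * ν (T j) := by
    intro i g hg
    refine (lintegral_fundamentalDomain_le h𝓓 hT hTcov (f := fun h => ‖f (g, h)‖ₑ)
      (fun γ hγ h => by rw [hf₂ γ hγ]) (hm'.comp measurable_prodMk_left)).trans ?_
    rw [← ENNReal.tsum_mul_left]
    refine ENNReal.tsum_le_tsum fun j => ?_
    rw [← mul_assoc, ← setLIntegral_const]
    exact setLIntegral_mono' (hT j) fun h hh => hcd i j g hg h hh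
  refine lt_of_le_of_lt (lintegral_fundamentalDomain_le h𝓕 hS hScov
    (f := fun g => ∫⁻ h in 𝓓, ‖f (g, h)‖ₑ ∂ν)
    (fun γ hγ g => by simp only [hf₁ γ hγ]) hm'.lintegral_prod_right') ?_
  calc ∑' i, ∫⁻ g in S i, ∫⁻ h in 𝓓, ‖f (g, h)‖ₑ ∂ν ∂μ
      ≤ ∑' i, (c i * ∑' j, d j * ν (T j)) * μ (S i) := by
        refine ENNReal.tsum_le_tsum fun i => ?_
        rw [← setLIntegral_const]
        exact setLIntegral_mono' (hS i) fun g hg => hin i g hg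
    _ = (∑' j, d j * ν (T j)) * ∑' i, c i * μ (S i) := by
        rw [← ENNReal.tsum_mul_left]
        exact tsum_congr fun i => by ring
    _ < ⊤ := ENNReal.mul_lt_top hd.lt_top hc.lt_top

/-- Integrability on a fundamental domain follows from bounds on sets whose translates cover the
group. -/
theorem integrableOn_of_cover {G ι : Type*} [Group G] [MeasurableSpace G]
    [MeasurableMul G] {Γ : Subgroup G} [Countable Γ] [Countable ι]
    {μ : Measure G} [μ.IsMulLeftInvariant] {𝓕 : Set G} (h𝓕 : IsFundamentalDomain Γ 𝓕 μ)
    {S : ι → Set G} (hS : ∀ i, MeasurableSet (S i))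
    (hScov : ∀ g, ∃ i, ∃ γ ∈ Γ, γ * g ∈ S i)
    {f : G → ℂ} (hm : Measurable f) (hf : ∀ γ ∈ Γ, ∀ g, f (γ * g) = f g)
    {c : ι → ENNReal} (hcd : ∀ i, ∀ g ∈ S i, ‖f g‖ₑ ≤ c i)
    (hc : ∑' i, c i * μ (S i) ≠ ⊤) : IntegrableOn f 𝓕 μ := by
  refine ⟨hm.aestronglyMeasurable, ?_⟩
  refine lt_of_le_of_lt (lintegral_fundamentalDomain_le h𝓕 hS hScov
    (f := fun g => ‖f g‖ₑ) (fun γ hγ g => by rw [hf γ hγ]) hm.enorm) ?_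
  refine lt_of_le_of_lt (ENNReal.tsum_le_tsum fun i => ?_) hc.lt_top
  rw [← setLIntegral_const]
  exact setLIntegral_mono' (hS i) fun g hg => hcd i g hg

end

section

/-! ### Hermite reduction of positive definite quadratic forms -/

/-- The value `∑ xᵢ Sᵢⱼ xⱼ` of the quadratic form with matrix `S`. -/
def quadVal {D : ℕ} (S : Matrix (Fin D) (Fin D) ℝ) (x : Fin D → ℝ) : ℝ :=
  ∑ i, ∑ j, x i * S i j * x j

theorem quadVal_eq {D : ℕ} (S : Matrix (Fin D) (Fin D) ℝ) (x : Fin D → ℝ) :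
    quadVal S x = x ⬝ᵥ (S.mulVec x) := by
  simp only [quadVal, dotProduct, Matrix.mulVec, Finset.mul_sum, mul_assoc]

theorem quadVal_conj {D : ℕ} (S A : Matrix (Fin D) (Fin D) ℝ) (x : Fin D → ℝ) :
    quadVal (A * S * A.transpose) x = quadVal S (Matrix.vecMul x A) := by
  rw [quadVal_eq, quadVal_eq, ← Matrix.mulVec_mulVec, ← Matrix.mulVec_mulVec,
    Matrix.dotProduct_mulVec, Matrix.mulVec_transpose]

theorem quadVal_smul {D : ℕ} (S : Matrix (Fin D) (Fin D) ℝ) (c : ℝ) (x : Fin D → ℝ) :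
    quadVal S (c • x) = c ^ 2 * quadVal S x := by
  simp only [quadVal, Finset.mul_sum, Pi.smul_apply, smul_eq_mul]
  exact Finset.sum_congr rfl fun i _ => Finset.sum_congr rfl fun j _ => by ring

/-- A positive definite form is bounded below on the non-zero integral vectors. -/
theorem exists_quadVal_lower_bound {D : ℕ} {S : Matrix (Fin D) (Fin D) ℝ}
    (hpos : ∀ x, x ≠ 0 → 0 < quadVal S x) :
    ∃ c, 0 < c ∧ ∀ x : Fin D → ℤ, x ≠ 0 → c ≤ quadVal S fun i => (x i : ℝ) := by
  have hcont : Continuous (quadVal S) := by unfold quadVal; fun_prop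
  rcases (Metric.sphere (0 : Fin D → ℝ) 1).eq_empty_or_nonempty with he | hne
  · refine ⟨1, one_pos, fun x hx => ?_⟩
    exfalso
    have hx' : (fun i => (x i : ℝ)) ≠ 0 := fun h => hx <| funext fun i => by
      simpa using congrFun h i
    have : ‖(fun i => (x i : ℝ))‖⁻¹ • (fun i => (x i : ℝ)) ∈ Metric.sphere (0 : Fin D → ℝ) 1 := by
      rw [mem_sphere_zero_iff_norm, norm_smul, norm_inv, norm_norm,
        inv_mul_cancel₀ (norm_ne_zero_iff.2 hx')]
    rw [he] at this
    exact this
  obtain ⟨y, hy, hmin⟩ := (isCompact_sphere (0 : Fin D → ℝ) 1).exists_isMinOn hne hcont.continuousOn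
  have hy0 : y ≠ 0 := by
    rintro rfl
    simp at hy
  refine ⟨quadVal S y, hpos y hy0, fun x hx => ?_⟩
  set x' : Fin D → ℝ := fun i => (x i : ℝ) with hx'
  obtain ⟨i, hi⟩ := Function.ne_iff.1 hx
  have h1 : (1 : ℝ) ≤ ‖x'‖ := by
    refine le_trans ?_ (norm_le_pi_norm x' i)
    rw [hx', Real.norm_eq_abs, ← Int.cast_abs]
    exact_mod_cast Int.one_le_abs hi
  have h0 : ‖x'‖ ≠ 0 := by linarith
  have hs : ‖x'‖⁻¹ • x' ∈ Metric.sphere (0 : Fin D → ℝ) 1 := by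
    rw [mem_sphere_zero_iff_norm, norm_smul, norm_inv, norm_norm, inv_mul_cancel₀ h0]
  have h2 : quadVal S y ≤ quadVal S (‖x'‖⁻¹ • x') := hmin hs
  have h3 : x' = ‖x'‖ • (‖x'‖⁻¹ • x') := by rw [smul_smul, mul_inv_cancel₀ h0, one_smul]
  rw [h3, quadVal_smul]
  have h4 := hpos y hy0
  nlinarith [h1, h2, h4, one_le_pow₀ (n := 2) h1]

/-- The Schur complement of the corner entry. -/
theorem det_eq_mul_schur {D : ℕ} {S : Matrix (Fin (D + 1)) (Fin (D + 1)) ℝ} (ha : S 0 0 ≠ 0) :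
    S.det = S 0 0 * (Matrix.of fun i j : Fin D =>
      S i.succ j.succ - S i.succ 0 / S 0 0 * S 0 j.succ).det := by
  set B : Matrix (Fin (D + 1)) (Fin (D + 1)) ℝ :=
    Matrix.of (Fin.cons (S 0) fun i j => S i.succ j - S i.succ 0 / S 0 0 * S 0 j) with hB
  have h1 : S.det = B.det := by
    refine Matrix.det_eq_of_forall_row_eq_smul_add_const
      (Fin.cons 0 fun i : Fin D => S i.succ 0 / S 0 0) 0 rfl fun i j => ?_
    refine Fin.cases ?_ (fun i => ?_) i
    · simp [hB]
    · simp [hB]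
  rw [h1, Matrix.det_succ_column_zero, Fin.sum_univ_succ, Finset.sum_eq_zero]
  · simp only [hB, Fin.val_zero, pow_zero, one_mul, add_zero, Matrix.of_apply, Fin.cons_zero]
    congr 2
  · intro i _
    have : B i.succ 0 = 0 := by
      simp [hB, ha]
    rw [this]
    ring

/-- Completing the square in the first variable. -/
theorem quadVal_cons {D : ℕ} {S : Matrix (Fin (D + 1)) (Fin (D + 1)) ℝ} (ha : S 0 0 ≠ 0)
    (hsym : ∀ i j, S i j = S j i) (z : ℝ) (y : Fin D → ℝ) :
    quadVal S (Fin.cons z y) = S 0 0 * (z + (∑ j, S 0 j.succ * y j) / S 0 0) ^ 2 +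
      quadVal (Matrix.of fun i j : Fin D =>
        S i.succ j.succ - S i.succ 0 / S 0 0 * S 0 j.succ) y := by
  have h1 : quadVal S (Fin.cons z y) = z * S 0 0 * z + z * (∑ j, S 0 j.succ * y j) +
      ((∑ j, S 0 j.succ * y j) * z + quadVal (Matrix.of fun i j : Fin D => S i.succ j.succ) y) := by
    have e₁ : ∑ j, y j * S j.succ 0 * z = (∑ j, S 0 j.succ * y j) * z := by
      rw [Finset.sum_mul]
      exact Finset.sum_congr rfl fun j _ => by rw [hsym j.succ 0]; ring
    have e₂ : ∑ j, z * S 0 j.succ * y j = z * ∑ j, S 0 j.succ * y j := by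
      rw [Finset.mul_sum]
      exact Finset.sum_congr rfl fun j _ => by ring
    simp only [quadVal, Fin.sum_univ_succ, Fin.cons_zero, Fin.cons_succ, Finset.sum_add_distrib,
      Matrix.of_apply]
    rw [e₁, e₂]
    ring
  have h2 : quadVal (Matrix.of fun i j : Fin D =>
        S i.succ j.succ - S i.succ 0 / S 0 0 * S 0 j.succ) y =
      quadVal (Matrix.of fun i j : Fin D => S i.succ j.succ) y -
        (∑ j, S 0 j.succ * y j) * (∑ j, S 0 j.succ * y j) / S 0 0 := by
    rw [Finset.sum_mul_sum, Finset.sum_div]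
    simp only [quadVal, ← Finset.sum_sub_distrib, Finset.sum_div, Matrix.of_apply]
    exact Finset.sum_congr rfl fun i _ => Finset.sum_congr rfl fun j _ => by
      rw [hsym i.succ 0]; ring
  rw [h1, h2]
  field_simp
  ring

/-- Hermite's theorem: a positive definite quadratic form has an integral basis for which the
product of the diagonal entries is at most a constant times the discriminant. -/
theorem exists_hermite_reduced (D : ℕ) : ∃ C : ℝ, 0 < C ∧ ∀ S : Matrix (Fin D) (Fin D) ℝ,
    (∀ i j, S i j = S j i) → (∀ x, x ≠ 0 → 0 < quadVal S x) →
    ∃ γ : Matrix (Fin D) (Fin D) ℤ, IsUnit γ.det ∧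
      ∏ i, quadVal S (fun j => (γ i j : ℝ)) ≤ C * S.det := by
  induction D with
  | zero => exact ⟨1, one_pos, fun S _ _ => ⟨1, by simp, by simp⟩⟩
  | succ D ih =>
    obtain ⟨C, hC, ih⟩ := ih
    refine ⟨2 ^ D * C, by positivity, fun S₀ hsym₀ hpos₀ => ?_⟩
    obtain ⟨c, hc, hcS⟩ := exists_quadVal_lower_bound hpos₀
    have hrow : ∀ γ : Matrix (Fin (D + 1)) (Fin (D + 1)) ℤ, IsUnit γ.det → ∀ i, γ i ≠ 0 := by
      intro γ hγ i h
      rw [Matrix.det_eq_zero_of_row_eq_zero i (fun j => congrFun h j)] at hγ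
      exact not_isUnit_zero hγ
    -- a basis whose first vector is, up to a factor two, the shortest possible one
    obtain ⟨γ₁, hγ₁, hmin⟩ : ∃ γ₁ : Matrix (Fin (D + 1)) (Fin (D + 1)) ℤ, IsUnit γ₁.det ∧
        ∀ γ : Matrix (Fin (D + 1)) (Fin (D + 1)) ℤ, IsUnit γ.det →
          quadVal S₀ (fun j => (γ₁ 0 j : ℝ)) ≤ 2 * quadVal S₀ (fun j => (γ 0 j : ℝ)) := by
      set s : Set ℝ := {r | ∃ γ : Matrix (Fin (D + 1)) (Fin (D + 1)) ℤ, IsUnit γ.det ∧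
        quadVal S₀ (fun j => (γ 0 j : ℝ)) = r} with hs
      have hbdd : ∀ r ∈ s, c ≤ r := by
        rintro _ ⟨γ, hγ, rfl⟩
        exact hcS _ (hrow γ hγ 0)
      have hne : s.Nonempty := ⟨_, 1, by simp, rfl⟩
      have hinf : c ≤ sInf s := le_csInf hne hbdd
      obtain ⟨_, ⟨γ₁, hγ₁, rfl⟩, hlt⟩ := exists_lt_of_csInf_lt hne
        (show sInf s < 2 * sInf s by linarith)
      refine ⟨γ₁, hγ₁, fun γ hγ => hlt.le.trans ?_⟩
      have := csInf_le ⟨c, hbdd⟩ (show _ ∈ s from ⟨γ, hγ, rfl⟩)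
      linarith
    set A : Matrix (Fin (D + 1)) (Fin (D + 1)) ℝ := γ₁.map (Int.cast : ℤ → ℝ) with hA
    have hAdet : A.det = (γ₁.det : ℝ) := by
      have := (Int.castRingHom ℝ).map_det γ₁
      simpa [hA] using this.symm
    have hAu : IsUnit A.det := by rw [hAdet]; exact hγ₁.map (Int.castRingHom ℝ)
    have hA2 : A.det * A.det = 1 := by
      rw [hAdet]
      rcases Int.isUnit_iff.1 hγ₁ with h | h <;> simp [h]
    set S := A * S₀ * A.transpose with hS
    have hdet : S.det = S₀.det := by
      rw [hS, Matrix.det_mul, Matrix.det_mul, Matrix.det_transpose, mul_right_comm, hA2, one_mul]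
    have hsymS₀ : S₀.transpose = S₀ := Matrix.ext fun i j => hsym₀ j i
    have hsym : ∀ i j, S i j = S j i := by
      have : S.transpose = S := by
        rw [hS, Matrix.transpose_mul, Matrix.transpose_mul, Matrix.transpose_transpose, hsymS₀,
          Matrix.mul_assoc]
      exact fun i j => by rw [← Matrix.transpose_apply S, this]
    have hq : ∀ x : Fin (D + 1) → ℤ, quadVal S (fun j => (x j : ℝ)) =
        quadVal S₀ (fun j => ((Matrix.vecMul x γ₁ j : ℤ) : ℝ)) := by
      intro x
      rw [hS, quadVal_conj]
      congr 1
      funext j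
      simp [Matrix.vecMul, dotProduct, hA]
    have hpos : ∀ x, x ≠ 0 → 0 < quadVal S x := by
      intro x hx
      rw [hS, quadVal_conj]
      refine hpos₀ _ fun h => hx ?_
      have h1 : Matrix.vecMul (Matrix.vecMul x A) A⁻¹ = 0 := by rw [h, Matrix.zero_vecMul]
      rwa [Matrix.vecMul_vecMul, Matrix.mul_nonsing_inv _ hAu, Matrix.vecMul_one] at h1
    set a := S 0 0 with ha
    have haval : quadVal S (fun j => ((Pi.single 0 1 : Fin (D + 1) → ℤ) j : ℝ)) = a := by
      have h1 : (fun j => ((Pi.single 0 1 : Fin (D + 1) → ℤ) j : ℝ)) = Pi.single 0 1 := by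
        funext j
        by_cases h : j = 0 <;> simp [h]
      rw [h1, quadVal_eq]
      simp [ha]
    have hmin' : ∀ γ : Matrix (Fin (D + 1)) (Fin (D + 1)) ℤ, IsUnit γ.det → ∀ i,
        a ≤ 2 * quadVal S (fun j => (γ i j : ℝ)) := by
      intro γ hγ i
      have hu : IsUnit ((γ * γ₁).submatrix (Equiv.swap 0 i) id).det := by
        rw [Matrix.det_permute]
        refine IsUnit.mul ?_ (by rw [Matrix.det_mul]; exact hγ.mul hγ₁)
        exact Int.isUnit_iff.2 (by rcases Int.units_eq_one_or (Equiv.Perm.sign (Equiv.swap 0 i)) with h | h <;> simp [h])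
      have := hmin _ hu
      rw [← haval, hq, hq]
      simpa [Matrix.single_one_vecMul, Matrix.mul_apply_eq_vecMul] using this
    have hapos : 0 < a := by
      rw [← haval, hq]
      refine hc.trans_le (hcS _ ?_)
      rw [Matrix.single_one_vecMul]
      exact hrow γ₁ hγ₁ 0
    set S' : Matrix (Fin D) (Fin D) ℝ :=
      Matrix.of fun i j => S i.succ j.succ - S i.succ 0 / S 0 0 * S 0 j.succ with hS'
    have hsym' : ∀ i j, S' i j = S' j i := by
      intro i j
      simp only [hS', Matrix.of_apply]
      rw [hsym i.succ j.succ, hsym 0 j.succ, hsym i.succ 0]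
      ring
    have hpos' : ∀ y, y ≠ 0 → 0 < quadVal S' y := by
      intro y hy
      have h1 := quadVal_cons hapos.ne' hsym (-((∑ j, S 0 j.succ * y j) / S 0 0)) y
      rw [neg_add_cancel, zero_pow two_ne_zero, mul_zero, zero_add] at h1
      rw [← h1]
      refine hpos _ fun h => hy (funext fun j => ?_)
      simpa using congrFun h j.succ
    obtain ⟨γ', hγ', hprod⟩ := ih S' hsym' hpos'
    -- lift the reduced basis of the quotient form, with rounded first coordinates
    set z : Fin D → ℤ := fun i => -round ((∑ j, S 0 j.succ * (γ' i j : ℝ)) / S 0 0) with hz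
    set γ₂ : Matrix (Fin (D + 1)) (Fin (D + 1)) ℤ :=
      Matrix.of (Fin.cons (Pi.single 0 1) fun i => Fin.cons (z i) (γ' i)) with hγ₂
    have hγ₂det : γ₂.det = γ'.det := by
      rw [Matrix.det_succ_row_zero, Fin.sum_univ_succ, Finset.sum_eq_zero]
      · simp only [hγ₂, Fin.val_zero, pow_zero, one_mul, add_zero, Matrix.of_apply, Fin.cons_zero,
          Pi.single_eq_same]
        congr 1
      · intro i _
        simp [hγ₂]
    have hγ₂u : IsUnit γ₂.det := hγ₂det ▸ hγ'
    have hval : ∀ i : Fin D, quadVal S (fun j => (γ₂ i.succ j : ℝ)) ≤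
        2 * quadVal S' (fun j => (γ' i j : ℝ)) := by
      intro i
      have h1 : (fun j => (γ₂ i.succ j : ℝ)) =
          Fin.cons (z i : ℝ) fun j => (γ' i j : ℝ) := by
        funext j
        refine Fin.cases ?_ (fun j => ?_) j <;> simp [hγ₂]
      have h2 := hmin' γ₂ hγ₂u i.succ
      rw [h1] at h2 ⊢
      rw [quadVal_cons hapos.ne' hsym] at h2 ⊢
      have h3 : ((z i : ℝ) + (∑ j, S 0 j.succ * (γ' i j : ℝ)) / S 0 0) ^ 2 ≤ 1 / 4 := by
        have := abs_sub_round ((∑ j, S 0 j.succ * (γ' i j : ℝ)) / S 0 0)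
        rw [← sq_abs]
        have e : (z i : ℝ) + (∑ j, S 0 j.succ * (γ' i j : ℝ)) / S 0 0 =
          (∑ j, S 0 j.succ * (γ' i j : ℝ)) / S 0 0 -
            round ((∑ j, S 0 j.succ * (γ' i j : ℝ)) / S 0 0) := by
          simp only [hz]; push_cast; ring
        rw [e]
        nlinarith [abs_nonneg ((∑ j, S 0 j.succ * (γ' i j : ℝ)) / S 0 0 -
            round ((∑ j, S 0 j.succ * (γ' i j : ℝ)) / S 0 0))]
      nlinarith [h2, h3, hapos]
    refine ⟨γ₂ * γ₁, by rw [Matrix.det_mul]; exact hγ₂u.mul hγ₁, ?_⟩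
    have h5 : ∀ i, quadVal S₀ (fun j => ((γ₂ * γ₁) i j : ℝ)) =
        quadVal S (fun j => (γ₂ i j : ℝ)) := fun i => by
      rw [hq, Matrix.mul_apply_eq_vecMul]
    rw [Finset.prod_congr rfl fun i _ => h5 i, Fin.prod_univ_succ]
    have h6 : quadVal S (fun j => (γ₂ 0 j : ℝ)) = a := by
      rw [← haval]
      rfl
    rw [h6, ← hdet, det_eq_mul_schur hapos.ne', ← hS']
    calc a * ∏ i : Fin D, quadVal S (fun j => (γ₂ i.succ j : ℝ))
        ≤ a * ∏ i : Fin D, 2 * quadVal S' (fun j => (γ' i j : ℝ)) := by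
          refine mul_le_mul_of_nonneg_left (Finset.prod_le_prod (fun i _ => ?_) fun i _ => hval i)
            hapos.le
          have := hmin' γ₂ hγ₂u i.succ
          linarith
      _ = 2 ^ D * (a * ∏ i : Fin D, quadVal S' (fun j => (γ' i j : ℝ))) := by
          rw [Finset.prod_mul_distrib]
          simp
          ring
      _ ≤ 2 ^ D * (a * (C * S'.det)) := by gcongr
      _ = _ := by ring

end

section

/-! ### Small vectors forming an `F`-basis -/

/-- From a `ℚ`-basis of an `m`-dimensional `F`-vector space with weights `n` one can choose an
`F`-basis whose product of weights, to the power `[F : ℚ]`, is at most the product of all weights: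
take a basis vector of least weight, and pass to the quotient by the line it spans. -/
theorem exists_linearIndependent_prod_le {F : Type*} [Field F] [NumberField F] (m : ℕ) :
    ∀ {W : Type _} [AddCommGroup W] [Module F W] [Module ℚ W] [IsScalarTower ℚ F W]
      {ι : Type} [Fintype ι] (_ : Module.finrank F W = m) (_ : FiniteDimensional F W)
      (v : Module.Basis ι ℚ W) (n : ι → ℝ) (_ : ∀ i, 0 < n i),
      ∃ w : Fin m → ι, LinearIndependent F (fun j => v (w j)) ∧
        ∏ j, n (w j) ^ Module.finrank ℚ F ≤ ∏ i, n i := by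
  induction m with
  | zero =>
    intro W _ _ _ _ ι _ hW hfd v n hn
    have hsub : Subsingleton W := Module.finrank_zero_iff.1 hW
    have : IsEmpty ι := ⟨fun i => v.ne_zero i (Subsingleton.elim _ _)⟩
    exact ⟨Fin.elim0, linearIndependent_empty_type, by simp⟩
  | succ m ih =>
    intro W _ _ _ _ ι _ hW hfd v n hn
    classical
    have hne : Nonempty ι := by
      by_contra h
      rw [not_nonempty_iff] at h
      have hs : Subsingleton W := v.repr.toEquiv.subsingleton
      have := Module.finrank_zero_of_subsingleton (R := F) (M := W)
      omega
    obtain ⟨i₀, hi₀⟩ := Finite.exists_min n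
    set L : Submodule F W := Submodule.span F {v i₀} with hL
    have hL1 : Module.finrank F L = 1 := finrank_span_singleton (v.ne_zero i₀)
    have hQ : Module.finrank F (W ⧸ L) = m := by
      have := L.finrank_quotient_add_finrank
      omega
    set p : W →ₗ[ℚ] W ⧸ L := L.mkQ.restrictScalars ℚ with hp
    have hpsurj : Function.Surjective p := L.mkQ_surjective
    obtain ⟨κ, a, ha, hspan, hli⟩ := exists_linearIndependent' ℚ (fun i => p (v i))
    have hfκ : Finite κ := Finite.of_injective a ha
    have hfκ' : Fintype κ := Fintype.ofFinite κ
    have htop : Submodule.span ℚ (Set.range fun i => p (v i)) = ⊤ := by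
      have : (Set.range fun i => p (v i)) = p '' Set.range v := by
        rw [← Set.range_comp]; rfl
      rw [this, Submodule.span_image, v.span_eq, Submodule.map_top, LinearMap.range_eq_top.2 hpsurj]
    let u : Module.Basis κ ℚ (W ⧸ L) := Module.Basis.mk hli (by rw [hspan, htop])
    have hu : ∀ k, u k = p (v (a k)) := fun k => Module.Basis.mk_apply _ _ k
    -- transport the index type to `Type`
    let e : κ ≃ Fin (Fintype.card κ) := Fintype.equivFin κ
    obtain ⟨w, hw, hprod⟩ := ih hQ inferInstance (u.reindex e) (fun k => n (a (e.symm k)))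
      fun k => hn _
    have hw' : LinearIndependent F fun j => L.mkQ (v (a (e.symm (w j)))) := by
      simpa [hu, hp] using hw
    refine ⟨Fin.cons i₀ fun j => a (e.symm (w j)), ?_, ?_⟩
    · have h1 : (fun j : Fin (m + 1) => v ((Fin.cons i₀ fun j => a (e.symm (w j)) :
          Fin (m + 1) → ι) j)) = Fin.cons (v i₀) fun j => v (a (e.symm (w j))) := by
        funext j
        refine Fin.cases rfl (fun j => rfl) j
      rw [h1, linearIndependent_finCons]
      refine ⟨LinearIndependent.of_comp L.mkQ hw', fun hmem => ?_⟩
      obtain ⟨c, hc⟩ := (Submodule.mem_span_range_iff_exists_fun F).1 hmem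
      have h2 : ∑ j, c j • L.mkQ (v (a (e.symm (w j)))) = 0 := by
        have := congrArg L.mkQ hc
        rw [map_sum] at this
        simp only [map_smul] at this
        rw [this]
        exact (Submodule.Quotient.mk_eq_zero L).2 (Submodule.mem_span_singleton_self _)
      have h3 := Fintype.linearIndependent_iff.1 hw' c h2
      simp only [h3, zero_smul, Finset.sum_const_zero] at hc
      exact v.ne_zero i₀ hc.symm
    · rw [Fin.prod_univ_succ]
      simp only [Fin.cons_zero, Fin.cons_succ]
      -- the number of discarded basis vectors is `[F : ℚ]`
      have hcard : Fintype.card ι = Module.finrank ℚ F + Fintype.card κ := by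
        have h1 : Module.finrank ℚ W = Fintype.card ι := Module.finrank_eq_card_basis v
        have h2 : Module.finrank ℚ (W ⧸ L) = Fintype.card κ := Module.finrank_eq_card_basis u
        rw [← h1, ← h2, ← Module.finrank_mul_finrank ℚ F W,
          ← Module.finrank_mul_finrank ℚ F (W ⧸ L), hW, hQ]
        ring
      have hsplit : ∏ i, n i = (∏ i ∈ (Finset.univ.image a)ᶜ, n i) * ∏ k, n (a k) := by
        rw [← Finset.prod_compl_mul_prod (Finset.univ.image a),
          Finset.prod_image fun x _ y _ h => ha h]
      have hcc : (Finset.univ.image a)ᶜ.card = Module.finrank ℚ F := by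
        rw [Finset.card_compl, Finset.card_image_of_injective _ ha, Finset.card_univ]
        omega
      rw [hsplit]
      refine mul_le_mul ?_ ?_ (Finset.prod_nonneg fun j _ => pow_nonneg (hn _).le _)
        (Finset.prod_nonneg fun j _ => (hn _).le)
      · rw [← hcc, ← Finset.prod_const]
        exact Finset.prod_le_prod (fun _ _ => (hn _).le) fun i _ => hi₀ i
      · refine hprod.trans_eq ?_
        exact e.symm.prod_comp fun k => n (a k)

end

section

open scoped Classical

/-! ### Real coordinates on matrices over `F ⊗ ℝ` -/

/-- A numbering of the basis of `𝓞 F`. -/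
def basisNumbering (F : Type*) [Field F] [NumberField F] :
    Module.Free.ChooseBasisIndex ℤ (𝓞 F) ≃ Fin (Module.finrank ℚ F) :=
  Fintype.equivFinOfCardEq (by
    rw [← Module.finrank_eq_card_chooseBasisIndex, RingOfIntegers.rank])

/-- A `ℤ`-basis of `𝓞 F`. -/
def intBasis (F : Type*) [Field F] [NumberField F] (a : Fin (Module.finrank ℚ F)) : 𝓞 F :=
  RingOfIntegers.basis F ((basisNumbering F).symm a)

/-- The `ℤ`-basis of `𝓞 F` as an `ℝ`-basis of `F ⊗ ℝ`. -/
def latB (F : Type*) [Field F] [NumberField F] :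
    Module.Basis (Fin (Module.finrank ℚ F)) ℝ (E F) :=
  (mixedEmbedding.latticeBasis F).reindex (basisNumbering F)

theorem latB_apply (a : Fin (Module.finrank ℚ F)) :
    latB F a = mixedEmbedding F (intBasis F a : F) := by
  simp [latB, intBasis, integralBasis_apply]

theorem latB_repr_int (x : 𝓞 F) (a : Fin (Module.finrank ℚ F)) :
    ∃ z : ℤ, (latB F).repr (mixedEmbedding F (x : F)) a = z := by
  refine ⟨(RingOfIntegers.basis F).repr x ((basisNumbering F).symm a), ?_⟩
  rw [latB, Module.Basis.repr_reindex_apply, mixedEmbedding.latticeBasis_repr_apply,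
    integralBasis_repr_apply]
  simp

theorem exists_int_of_repr {x : F}
    (h : ∀ a, ∃ z : ℤ, (latB F).repr (mixedEmbedding F x) a = z) : ∃ y : 𝓞 F, (y : F) = x := by
  choose z hz using h
  refine ⟨∑ a, z a • intBasis F a, mixedEmbedding_injective F ?_⟩
  rw [← (latB F).sum_repr (mixedEmbedding F x)]
  simp only [map_sum, hz, latB_apply]
  refine Finset.sum_congr rfl fun a _ => ?_
  rw [Int.cast_smul_eq_zsmul, map_zsmul, map_zsmul]

theorem linearIndependent_intBasis :
    LinearIndependent ℚ fun a => (intBasis F a : F) := by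
  have := (integralBasis F).linearIndependent.comp _ (basisNumbering F).symm.injective
  convert this using 1
  funext a
  simp [intBasis, integralBasis_apply]

variable {m : ℕ}

/-- The diagonal matrix with real entries `t` in `GL_m(F ⊗ ℝ)`. -/
def archDiag {m : ℕ} : (Fin m → ℝˣ) →* GLm m (E F) where
  toFun t :=
    { val := Matrix.diagonal fun i => algebraMap ℝ (E F) (t i : ℝ)
      inv := Matrix.diagonal fun i => algebraMap ℝ (E F) ((t i)⁻¹ : ℝˣ)
      val_inv := by
        simp only [Matrix.diagonal_mul_diagonal, ← map_mul, Units.mul_inv, map_one,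
          Matrix.diagonal_one]
      inv_val := by
        simp only [Matrix.diagonal_mul_diagonal, ← map_mul, Units.inv_mul, map_one,
          Matrix.diagonal_one] }
  map_one' := Units.ext (by
    simp only [Pi.one_apply, Units.val_one, map_one, Matrix.diagonal_one])
  map_mul' s t := Units.ext (by
    simp only [Pi.mul_apply, Units.val_mul, map_mul, Matrix.diagonal_mul_diagonal])

theorem archDiag_val (t : Fin m → ℝˣ) : (archDiag t : GLm m (E F)).val =
    Matrix.diagonal fun i => algebraMap ℝ (E F) (t i : ℝ) := rfl

/-- The real matrix of `x ↦ x g` on row vectors over `F ⊗ ℝ`, in the coordinates given by the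
basis of `𝓞 F`. -/
def realMat (g : Matrix (Fin m) (Fin m) (E F)) :
    Matrix (Fin m × Fin (Module.finrank ℚ F)) (Fin m × Fin (Module.finrank ℚ F)) ℝ :=
  Matrix.of fun p q => (latB F).repr (latB F p.2 * g p.1 q.1) q.2

theorem realMat_apply (g : Matrix (Fin m) (Fin m) (E F)) (p q) :
    realMat g p q = (latB F).repr (latB F p.2 * g p.1 q.1) q.2 := rfl

theorem vecMul_realMat (g : Matrix (Fin m) (Fin m) (E F))
    (z : Fin m × Fin (Module.finrank ℚ F) → ℝ) (q) :
    Matrix.vecMul z (realMat g) q =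
      (latB F).repr (∑ i, (∑ a, z (i, a) • latB F a) * g i q.1) q.2 := by
  simp only [Matrix.vecMul, dotProduct, Fintype.sum_prod_type, realMat_apply, map_sum,
    Finset.sum_mul, smul_mul_assoc, map_smul, Finsupp.coe_finsetSum, Finset.sum_apply,
    Finsupp.smul_apply, smul_eq_mul]

theorem realMat_mul (g h : Matrix (Fin m) (Fin m) (E F)) :
    realMat (g * h) = realMat g * realMat h := by
  refine Matrix.ext fun p q => ?_
  rw [Matrix.mul_apply_eq_vecMul, vecMul_realMat, realMat_apply, Matrix.mul_apply, Finset.mul_sum]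
  congr 3
  funext i
  rw [← mul_assoc]
  congr 1
  exact ((latB F).sum_repr _).symm

theorem realMat_one : realMat (1 : Matrix (Fin m) (Fin m) (E F)) = 1 := by
  refine Matrix.ext fun p q => ?_
  rw [realMat_apply, Matrix.one_apply, Matrix.one_apply]
  by_cases h : p.1 = q.1
  · rw [if_pos h, mul_one, Module.Basis.repr_self, Finsupp.single_apply]
    simp [Prod.ext_iff, h]
  · rw [if_neg h, mul_zero, if_neg fun h' => h (congrArg Prod.fst h')]
    simp

theorem realMat_diag (t : Fin m → ℝˣ) :
    realMat (archDiag t : GLm m (E F)).val = Matrix.diagonal fun p => ((t p.1 : ℝˣ) : ℝ) := by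
  refine Matrix.ext fun p q => ?_
  rw [realMat_apply, archDiag_val, Matrix.diagonal_apply, Matrix.diagonal_apply]
  by_cases h : p.1 = q.1
  · rw [if_pos h, mul_comm, ← Algebra.smul_def, map_smul, Module.Basis.repr_self,
      Finsupp.smul_apply, Finsupp.single_apply]
    simp [Prod.ext_iff, h]
  · rw [if_neg h, mul_zero, if_neg fun h' => h (congrArg Prod.fst h')]
    simp

theorem det_realMat_diag (t : Fin m → ℝˣ) :
    (realMat (archDiag t : GLm m (E F)).val).det = ∏ j, (t j : ℝ) ^ Module.finrank ℚ F := by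
  rw [realMat_diag, Matrix.det_diagonal, Fintype.prod_prod_type]
  simp

theorem realMat_mul_inv (g : GLm m (E F)) :
    realMat g.val * realMat (g⁻¹ : GLm m (E F)).val = 1 := by
  rw [← realMat_mul, ← Units.val_mul, mul_inv_cancel, Units.val_one, realMat_one]

theorem det_realMat_ne_zero (g : GLm m (E F)) : (realMat g.val).det ≠ 0 := by
  have h := congrArg Matrix.det (realMat_mul_inv g)
  rw [Matrix.det_mul, Matrix.det_one] at h
  exact left_ne_zero_of_mul_eq_one h

theorem realMat_inv (g : GLm m (E F)) :
    (realMat g.val).det • realMat (g⁻¹ : GLm m (E F)).val = (realMat g.val).adjugate := by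
  have h := congrArg (fun A => (realMat g.val).adjugate * A) (realMat_mul_inv g)
  simpa only [← mul_assoc, Matrix.adjugate_mul, Matrix.smul_mul, one_mul, mul_one] using h

theorem sum_realMat (g : Matrix (Fin m) (Fin m) (E F)) (i j : Fin m) (b) :
    (latB F).repr (g i j) b = ∑ a, (latB F).repr 1 a * realMat g (i, a) (j, b) := by
  conv_lhs => rw [← one_mul (g i j), ← (latB F).sum_repr 1, Finset.sum_mul]
  simp only [map_sum, Finsupp.coe_finsetSum, Finset.sum_apply, smul_mul_assoc, map_smul,
    Finsupp.smul_apply, smul_eq_mul, realMat_apply]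

/-- Bounds between the norm on `F ⊗ ℝ` and the coordinates. -/
theorem exists_repr_bound : ∃ c : ℝ, 0 < c ∧ (∀ (x : E F) a, |(latB F).repr x a| ≤ c * ‖x‖) ∧
    ∀ (x : E F) (r : ℝ), (∀ a, |(latB F).repr x a| ≤ r) → ‖x‖ ≤ c * r := by
  let e := (latB F).equivFunL
  have he : ∀ x a, e x a = (latB F).repr x a := fun x a => rfl
  refine ⟨‖(e : E F →L[ℝ] (Fin (Module.finrank ℚ F) → ℝ))‖ + ‖(e.symm : (Fin (Module.finrank ℚ F) → ℝ) →L[ℝ] E F)‖ + 1, by positivity, fun x a => ?_,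
    fun x r hr => ?_⟩
  · rw [← he, ← Real.norm_eq_abs]
    refine (norm_le_pi_norm (e x) a).trans (((e : E F →L[ℝ] (Fin (Module.finrank ℚ F) → ℝ)).le_opNorm x).trans ?_)
    gcongr
    linarith [norm_nonneg (e.symm : (Fin (Module.finrank ℚ F) → ℝ) →L[ℝ] E F)]
  · have h0 : 0 ≤ r := (abs_nonneg _).trans (hr ⟨0, Module.finrank_pos⟩)
    have h1 : ‖e x‖ ≤ r := (pi_norm_le_iff_of_nonneg h0).2 fun a => by
      rw [he, Real.norm_eq_abs]; exact hr a
    calc ‖x‖ = ‖(e.symm : (Fin (Module.finrank ℚ F) → ℝ) →L[ℝ] E F) (e x)‖ := by simp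
      _ ≤ ‖(e.symm : (Fin (Module.finrank ℚ F) → ℝ) →L[ℝ] E F)‖ * ‖e x‖ := ContinuousLinearMap.le_opNorm _ _
      _ ≤ _ := by
        gcongr
        linarith [norm_nonneg (e : E F →L[ℝ] (Fin (Module.finrank ℚ F) → ℝ))]

theorem exists_realMat_bound (r : ℝ) : ∃ B : ℝ, ∀ g : Matrix (Fin m) (Fin m) (E F),
    (∀ i j b, |(latB F).repr (g i j) b| ≤ r) → ∀ p q, |realMat g p q| ≤ B := by
  obtain ⟨c, hc, h1, h2⟩ := exists_repr_bound (F := F)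
  refine ⟨c * ((∑ a, ‖latB F a‖) * (c * r)), fun g hg p q => ?_⟩
  rw [realMat_apply]
  refine (h1 _ _).trans (mul_le_mul_of_nonneg_left ?_ hc.le)
  refine (norm_mul_le _ _).trans ?_
  exact mul_le_mul (Finset.single_le_sum (f := fun a => ‖latB F a‖)
    (fun a _ => norm_nonneg (latB F a)) (Finset.mem_univ p.2)) (h2 _ _ (hg _ _)) (norm_nonneg _)
    (Finset.sum_nonneg fun a _ => norm_nonneg (latB F a))

theorem exists_norm_bound_of_realMat (r : ℝ) : ∃ B : ℝ, 0 < B ∧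
    ∀ g : Matrix (Fin m) (Fin m) (E F),
    (∀ p q, |realMat g p q| ≤ r) → ∀ i j, ‖g i j‖ ≤ B := by
  obtain ⟨c, hc, h1, h2⟩ := exists_repr_bound (F := F)
  refine ⟨|c * ∑ a, |(latB F).repr 1 a| * r| + 1, by positivity, fun g hg i j => ?_⟩
  refine (h2 _ (∑ a, |(latB F).repr 1 a| * r) fun b => ?_).trans
    ((le_abs_self _).trans (by linarith))
  rw [sum_realMat]
  refine (Finset.abs_sum_le_sum_abs _ _).trans (Finset.sum_le_sum fun a _ => ?_)
  rw [abs_mul]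
  gcongr
  exact hg _ _

/-- The entries of the adjugate of a matrix with bounded entries are bounded. -/
theorem exists_adjugate_bound (ι : Type*) [Fintype ι] [DecidableEq ι] (r : ℝ) :
    ∃ B : ℝ, 0 < B ∧ ∀ A : Matrix ι ι ℝ, (∀ p q, |A p q| ≤ r) →
      |A.det| ≤ B ∧ ∀ p q, |A.adjugate p q| ≤ B := by
  have hc : IsCompact (Set.pi Set.univ fun _ : ι => Set.pi Set.univ fun _ : ι =>
    Set.Icc (-r) r) := isCompact_univ_pi fun _ => isCompact_univ_pi fun _ => isCompact_Icc
  have hmem : ∀ A : Matrix ι ι ℝ, (∀ p q, |A p q| ≤ r) → A ∈ Set.pi Set.univ fun _ : ι =>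
      Set.pi Set.univ fun _ : ι => Set.Icc (-r) r :=
    fun A hA p _ q _ => abs_le.1 (hA p q)
  obtain ⟨B₁, hB₁⟩ := hc.exists_bound_of_continuousOn (f := fun A : ι → ι → ℝ => Matrix.det A)
    (Continuous.matrix_det (A := fun A : ι → ι → ℝ => (A : Matrix ι ι ℝ)) continuous_id).continuousOn
  obtain ⟨B₂, hB₂⟩ := hc.exists_bound_of_continuousOn
    (f := fun A : ι → ι → ℝ => ∑ p, ∑ q, |Matrix.adjugate (A : Matrix ι ι ℝ) p q|) (by
      refine Continuous.continuousOn ?_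
      refine continuous_finsetSum _ fun p _ => continuous_finsetSum _ fun q _ => ?_
      exact ((Continuous.matrix_adjugate (A := fun A : ι → ι → ℝ => (A : Matrix ι ι ℝ))
        continuous_id).matrix_elem p q).abs)
  refine ⟨|B₁| + |B₂| + 1, by positivity, fun A hA => ⟨?_, fun p q => ?_⟩⟩
  · have := hB₁ A (hmem A hA)
    rw [Real.norm_eq_abs] at this
    linarith [le_abs_self B₁, abs_nonneg B₂]
  · have h1 := hB₂ A (hmem A hA)
    have h2 : |Matrix.adjugate A p q| ≤ ∑ p, ∑ q, |Matrix.adjugate A p q| :=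
      (Finset.single_le_sum (f := fun q => |Matrix.adjugate A p q|)
        (fun q _ => abs_nonneg _) (Finset.mem_univ q)).trans
      (Finset.single_le_sum (f := fun p => ∑ q, |Matrix.adjugate A p q|)
        (fun p _ => Finset.sum_nonneg fun q _ => abs_nonneg _) (Finset.mem_univ p))
    have h3 := (h2.trans (le_abs_self _)).trans h1
    linarith [le_abs_self B₂, abs_nonneg B₁]

end

section

open scoped Classical

/-! ### Reduction theory for `GL_m(F ⊗ ℝ)` -/

variable {m : ℕ}

/-- The embedding `GL_m(F) → GL_m(F ⊗ ℝ)`. -/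
def embGL {m : ℕ} : GLm m F →* GLm m (E F) := Matrix.GeneralLinearGroup.map (mixedEmbedding F)

theorem embGL_apply (γ : GLm m F) (i j : Fin m) : (embGL γ).val i j = mixedEmbedding F (γ.val i j) :=
  rfl

theorem exists_int_realMat {P : Matrix (Fin m) (Fin m) F} (h : ∀ i j, ∃ a : 𝓞 F, (a : F) = P i j) :
    ∃ Z : Matrix (Fin m × Fin (Module.finrank ℚ F)) (Fin m × Fin (Module.finrank ℚ F)) ℤ,
      realMat (P.map (mixedEmbedding F)) = Z.map (Int.cast : ℤ → ℝ) := by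
  choose a ha using h
  have : ∀ p q : Fin m × Fin (Module.finrank ℚ F), ∃ z : ℤ,
      realMat (P.map (mixedEmbedding F)) p q = z := by
    intro p q
    obtain ⟨z, hz⟩ := latB_repr_int (intBasis F p.2 * a p.1 q.1) q.2
    refine ⟨z, ?_⟩
    rw [← hz, realMat_apply, latB_apply, Matrix.map_apply, ← ha, ← map_mul]
    rfl
  choose Z hZ using this
  exact ⟨Matrix.of Z, Matrix.ext hZ⟩

theorem det_map_intCast {ι : Type*} [Fintype ι] [DecidableEq ι] (Z : Matrix ι ι ℤ) :
    (Z.map (Int.cast : ℤ → ℝ)).det = (Z.det : ℝ) :=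
  ((Int.castRingHom ℝ).map_det Z).symm

theorem adjugate_map_intCast {ι : Type*} [Fintype ι] [DecidableEq ι] (Z : Matrix ι ι ℤ) :
    (Z.map (Int.cast : ℤ → ℝ)).adjugate = Z.adjugate.map (Int.cast : ℤ → ℝ) :=
  ((Int.castRingHom ℝ).map_adjugate Z).symm

/-- If `γ` is integral then `det γ` (as a determinant over `ℤ`) times `γ⁻¹` is integral. -/
theorem exists_int_det_mul_inv (γ : GLm m F)
    (Z : Matrix (Fin m × Fin (Module.finrank ℚ F)) (Fin m × Fin (Module.finrank ℚ F)) ℤ)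
    (hZ : realMat (embGL γ).val = Z.map (Int.cast : ℤ → ℝ)) (i j : Fin m) :
    ∃ y : 𝓞 F, (y : F) = (Z.det : F) * (γ⁻¹ : GLm m F).val i j := by
  refine exists_int_of_repr fun b => ?_
  have h1 : ∀ p q, (Z.det : ℝ) * realMat ((embGL γ)⁻¹ : GLm m (E F)).val p q = (Z.adjugate p q : ℝ) := by
    intro p q
    have h := realMat_inv (embGL γ)
    rw [hZ, det_map_intCast, adjugate_map_intCast] at h
    exact congrFun (congrFun h p) q
  have h2 : ∀ a, ∃ u : ℤ, (latB F).repr 1 a = u := fun a => by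
    simpa using latB_repr_int (1 : 𝓞 F) a
  choose u hu using h2
  refine ⟨∑ a, u a * Z.adjugate (i, a) (j, b), ?_⟩
  have h3 : mixedEmbedding F ((Z.det : F) * (γ⁻¹ : GLm m F).val i j) =
      (Z.det : ℝ) • ((embGL γ)⁻¹ : GLm m (E F)).val i j := by
    rw [map_mul, map_intCast, ← map_inv, embGL_apply, Algebra.smul_def, map_intCast]
  rw [h3, map_smul, Finsupp.smul_apply, sum_realMat, smul_eq_mul, Finset.mul_sum]
  rw [Int.cast_sum]
  refine Finset.sum_congr rfl fun a _ => ?_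
  rw [hu, Int.cast_mul, ← h1]
  ring

theorem quadVal_one {D : ℕ} (x : Fin D → ℝ) : quadVal 1 x = ∑ i, x i ^ 2 := by
  rw [quadVal_eq, Matrix.one_mulVec]
  simp [dotProduct, sq]

/-- The archimedean half of reduction theory: every `g ∈ GL_m(F ⊗ ℝ)` is brought by an integral
matrix `γ` with bounded determinant into the form `t κ`, with `t` diagonal, real and positive, and
`κ` in a bounded set. The rows of `γ` are short vectors, chosen from a Hermite reduced `ℤ`-basis
of the lattice `𝓞ᵐ g`. -/
theorem exists_arch_reduction (F : Type*) [Field F] [NumberField F] (m : ℕ) :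
    ∃ B : ℝ, 0 < B ∧ ∃ M : 𝓞 F, M ≠ 0 ∧
    ∀ g : GLm m (E F), ∃ γ : GLm m F, (∀ i j, ∃ a : 𝓞 F, (a : F) = γ.val i j) ∧
      (∀ i j, ∃ a : 𝓞 F, (a : F) = (M : F) * (γ⁻¹ : GLm m F).val i j) ∧
      ∃ t : Fin m → ℝˣ, (∀ j, 0 < (t j : ℝ)) ∧ ∃ κ : GLm m (E F),
        embGL γ * g = archDiag t * κ ∧
        ∀ i j, ‖κ.val i j‖ ≤ B ∧ ‖(κ⁻¹ : GLm m (E F)).val i j‖ ≤ B := by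
  obtain ⟨C, hC, hherm⟩ := exists_hermite_reduced (m * Module.finrank ℚ F)
  obtain ⟨B₁, hB₁⟩ := exists_realMat_bound (F := F) (m := m) 1
  obtain ⟨B₂, hB₂0, hB₂⟩ := exists_adjugate_bound (Fin m × Fin (Module.finrank ℚ F)) B₁
  obtain ⟨B₃, hB₃0, hB₃⟩ := exists_norm_bound_of_realMat (F := F) (m := m) (B₂ * √C)
  obtain ⟨B₄, hB₄0, hB₄⟩ := exists_norm_bound_of_realMat (F := F) (m := m) B₁
  have hC' : 0 < √C := Real.sqrt_pos.2 hC
  refine ⟨B₃ + B₄, by positivity, ((⌊√C * B₂⌋₊.factorial : ℕ) : 𝓞 F),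
    Nat.cast_ne_zero.2 (Nat.factorial_ne_zero _), fun g => ?_⟩
  set d := Module.finrank ℚ F with hd
  let e : Fin m × Fin d ≃ Fin (m * d) := finProdFinEquiv
  set A : Matrix (Fin (m * d)) (Fin (m * d)) ℝ := (realMat g.val).submatrix e.symm e.symm with hA
  have hdetA : A.det = (realMat g.val).det := Matrix.det_submatrix_equiv_self _ _
  have hA0 : A.det ≠ 0 := hdetA ▸ det_realMat_ne_zero g
  set S := A * 1 * A.transpose with hS
  have hq : ∀ x, quadVal S x = ∑ k, Matrix.vecMul x A k ^ 2 := fun x => by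
    rw [hS, quadVal_conj, quadVal_one]
  have hpos : ∀ x, x ≠ 0 → 0 < quadVal S x := by
    intro x hx
    rw [hq]
    obtain ⟨k, hk⟩ := Function.ne_iff.1
      (fun h => hx (Matrix.eq_zero_of_vecMul_eq_zero hA0 h) : Matrix.vecMul x A ≠ 0)
    refine Finset.sum_pos' (fun i _ => sq_nonneg _) ⟨k, Finset.mem_univ k, ?_⟩
    exact (sq_pos_of_ne_zero hk)
  have hsym : ∀ i j, S i j = S j i := by
    have : S.transpose = S := by
      rw [hS, Matrix.mul_one, Matrix.transpose_mul, Matrix.transpose_transpose]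
    exact fun i j => by rw [← Matrix.transpose_apply S, this]
  obtain ⟨γ₀, hγ₀, hprod⟩ := hherm S hsym hpos
  have hrow : ∀ k, (fun l => (γ₀ k l : ℝ)) ≠ 0 := by
    intro k h
    rw [Matrix.det_eq_zero_of_row_eq_zero k fun j => by simpa using congrFun h j] at hγ₀
    exact not_isUnit_zero hγ₀
  set n : Fin (m * d) → ℝ := fun k => √(quadVal S fun l => (γ₀ k l : ℝ)) with hn
  have hn0 : ∀ k, 0 < n k := fun k => Real.sqrt_pos.2 (hpos _ (hrow k))
  -- the lattice vectors with coordinates `γ₀ k`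
  set ℓ : Fin (m * d) → Fin m → F := fun k i => ∑ a, (γ₀ k (e (i, a)) : ℚ) • (intBasis F a : F)
    with hℓ
  have hli : LinearIndependent ℚ ℓ := by
    rw [Fintype.linearIndependent_iff]
    intro c hc
    have h1 : Matrix.vecMul c (γ₀.map (Int.cast : ℤ → ℚ)) = 0 := by
      funext l
      obtain ⟨⟨i, a⟩, rfl⟩ := e.surjective l
      have h2 := congrFun hc i
      simp only [Finset.sum_apply, Pi.smul_apply, hℓ, Finset.smul_sum, Pi.zero_apply] at h2
      rw [Finset.sum_comm] at h2
      simp only [smul_smul, ← Finset.sum_smul] at h2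
      have h3 := Fintype.linearIndependent_iff.1 (linearIndependent_intBasis (F := F)) _ h2 a
      simpa [Matrix.vecMul, dotProduct] using h3
    have h2 : (γ₀.map (Int.cast : ℤ → ℚ)).det ≠ 0 := by
      have : (γ₀.map (Int.cast : ℤ → ℚ)).det = (γ₀.det : ℚ) :=
        ((Int.castRingHom ℚ).map_det γ₀).symm
      rw [this]
      exact Int.cast_ne_zero.2 hγ₀.ne_zero
    exact fun k => congrFun (Matrix.eq_zero_of_vecMul_eq_zero h2 h1) k
  have hfr : Module.finrank ℚ (Fin m → F) = m * d := by
    rw [← Module.finrank_mul_finrank ℚ F (Fin m → F), Module.finrank_fin_fun, mul_comm]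
  let v : Module.Basis (Fin (m * d)) ℚ (Fin m → F) := Module.Basis.mk hli (by
    rw [hli.span_eq_top_of_card_eq_finrank' (by rw [hfr, Fintype.card_fin])])
  obtain ⟨w, hw, hwprod⟩ := exists_linearIndependent_prod_le (F := F) m (Module.finrank_fin_fun F)
    inferInstance v n hn0
  have hv : ∀ k, v k = ℓ k := fun k => Module.Basis.mk_apply _ _ k
  simp only [hv] at hw
  set P : Matrix (Fin m) (Fin m) F := Matrix.of fun j => ℓ (w j) with hP
  have hPu : IsUnit P := Matrix.linearIndependent_rows_iff_isUnit.1 hw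
  obtain ⟨γ, hγ⟩ := hPu
  have hγint : ∀ i j, ∃ a : 𝓞 F, (a : F) = γ.val i j := by
    intro i j
    refine ⟨∑ a, γ₀ (w i) (e (j, a)) • intBasis F a, ?_⟩
    rw [hγ]
    simp only [hP, hℓ, Matrix.of_apply, map_sum, map_zsmul]
    refine Finset.sum_congr rfl fun a _ => ?_
    rw [Int.cast_smul_eq_zsmul]
  set t : Fin m → ℝˣ := fun j => Units.mk0 (n (w j)) (hn0 _).ne' with ht
  set κ : GLm m (E F) := (archDiag t)⁻¹ * (embGL γ * g) with hκ
  have hκeq : embGL γ * g = archDiag t * κ := by rw [hκ, mul_inv_cancel_left]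
  -- the coordinates of the rows of `γ g`
  have hcoord : ∀ j i b, |(latB F).repr ((embGL γ * g).val j i) b| ≤ n (w j) := by
    intro j i b
    have h1 : (latB F).repr ((embGL γ * g).val j i) b =
        Matrix.vecMul (fun l => (γ₀ (w j) l : ℝ)) A (e (i, b)) := by
      have h2 : Matrix.vecMul (fun l => (γ₀ (w j) l : ℝ)) A (e (i, b)) =
          Matrix.vecMul (fun p => (γ₀ (w j) (e p) : ℝ)) (realMat g.val) (i, b) := by
        simp only [Matrix.vecMul, dotProduct, hA, Matrix.submatrix_apply, Equiv.symm_apply_apply]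
        rw [← e.sum_comp]
        simp
      rw [h2, vecMul_realMat, Units.val_mul, Matrix.mul_apply]
      congr 3
      funext l
      congr 1
      rw [embGL_apply, hγ]
      simp only [hP, hℓ, Matrix.of_apply, map_sum, latB_apply]
      refine Finset.sum_congr rfl fun a _ => ?_
      rw [Int.cast_smul_eq_zsmul, Int.cast_smul_eq_zsmul, map_zsmul]
    rw [h1, hn]
    refine Real.abs_le_sqrt ?_
    rw [hq]
    exact Finset.single_le_sum (f := fun k => Matrix.vecMul (fun l => (γ₀ (w j) l : ℝ)) A k ^ 2)
      (fun k _ => sq_nonneg _) (Finset.mem_univ (e (i, b)))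
  have hκ1 : ∀ j i b, |(latB F).repr (κ.val j i) b| ≤ 1 := by
    intro j i b
    have h1 : κ.val j i = (n (w j))⁻¹ • (embGL γ * g).val j i := by
      rw [hκ, ← map_inv, Units.val_mul, archDiag_val, Matrix.diagonal_mul, Algebra.smul_def]
      simp [ht]
    rw [h1, map_smul, Finsupp.smul_apply, smul_eq_mul, abs_mul, abs_inv, abs_of_pos (hn0 _),
      inv_mul_le_iff₀ (hn0 _), mul_one]
    exact hcoord j i b
  have hκR := hB₁ κ.val hκ1
  obtain ⟨hκdet, hκadj⟩ := hB₂ _ hκR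
  -- determinants
  obtain ⟨Z, hZ⟩ := exists_int_realMat hγint
  have hZ' : realMat (embGL γ).val = Z.map (Int.cast : ℤ → ℝ) := hZ
  have hZdet : (realMat (embGL γ).val).det = (Z.det : ℝ) := by rw [hZ', det_map_intCast]
  have hZ0 : Z.det ≠ 0 := fun h => det_realMat_ne_zero (embGL γ) (by rw [hZdet, h, Int.cast_zero])
  have hZ1 : (1 : ℝ) ≤ |(Z.det : ℝ)| := by
    rw [← Int.cast_abs]
    exact_mod_cast Int.one_le_abs hZ0
  have hprodt : (∏ j, (t j : ℝ) ^ d) ≤ √C * |A.det| := by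
    refine hwprod.trans ?_
    have h1 : (∏ k, n k) ^ 2 ≤ (√C * |A.det|) ^ 2 := by
      rw [← Finset.prod_pow, mul_pow, Real.sq_sqrt hC.le, sq_abs]
      have h2 : S.det = A.det ^ 2 := by
        rw [hS, Matrix.mul_one, Matrix.det_mul, Matrix.det_transpose, sq]
      rw [← h2]
      refine le_trans (le_of_eq ?_) hprod
      exact Finset.prod_congr rfl fun k _ => Real.sq_sqrt (hpos _ (hrow k)).le
    exact (pow_le_pow_iff_left₀ (Finset.prod_nonneg fun k _ => (hn0 k).le) (by positivity)
      two_ne_zero).1 h1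
  have hprodt0 : 0 < ∏ j, (t j : ℝ) ^ d := Finset.prod_pos fun j _ => pow_pos (hn0 _) _
  have hdets : |(Z.det : ℝ)| * |A.det| = (∏ j, (t j : ℝ) ^ d) * |(realMat κ.val).det| := by
    have h1 := congrArg (fun x : GLm m (E F) => |(realMat x.val).det|) hκeq
    simp only [Units.val_mul, realMat_mul, Matrix.det_mul, abs_mul, hZdet, det_realMat_diag,
      ← hdetA] at h1
    rwa [abs_of_pos hprodt0] at h1
  have hA1 : 0 < |A.det| := abs_pos.2 hA0
  have hκlow : 1 ≤ √C * |(realMat κ.val).det| := by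
    have h1 : |A.det| ≤ (√C * |(realMat κ.val).det|) * |A.det| := by
      calc |A.det| ≤ |(Z.det : ℝ)| * |A.det| := le_mul_of_one_le_left hA1.le hZ1
        _ = (∏ j, (t j : ℝ) ^ d) * |(realMat κ.val).det| := hdets
        _ ≤ (√C * |A.det|) * |(realMat κ.val).det| := by gcongr
        _ = _ := by ring
    exact le_of_mul_le_mul_right (by rwa [one_mul]) hA1
  have hZup : |(Z.det : ℝ)| ≤ √C * B₂ := by
    have h1 : |(Z.det : ℝ)| * |A.det| ≤ (√C * B₂) * |A.det| := by
      calc |(Z.det : ℝ)| * |A.det| = (∏ j, (t j : ℝ) ^ d) * |(realMat κ.val).det| := hdets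
        _ ≤ (√C * |A.det|) * B₂ := by gcongr
        _ = _ := by ring
    exact le_of_mul_le_mul_right h1 hA1
  refine ⟨γ, hγint, fun i j => ?_, t, fun j => hn0 _, κ, hκeq, fun i j => ⟨?_, ?_⟩⟩
  · obtain ⟨y, hy⟩ := exists_int_det_mul_inv γ Z hZ' i j
    have hdvd : Z.det ∣ ((⌊√C * B₂⌋₊.factorial : ℕ) : ℤ) := by
      rw [← Int.natAbs_dvd, Int.natCast_dvd_natCast]
      refine Nat.dvd_factorial (Int.natAbs_pos.2 hZ0) (Nat.le_floor ?_)
      rwa [Nat.cast_natAbs, Int.cast_abs]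
    obtain ⟨k', hk'⟩ := hdvd
    refine ⟨(k' : 𝓞 F) * y, ?_⟩
    have h1 : (((⌊√C * B₂⌋₊.factorial : ℕ) : 𝓞 F) : F) = (Z.det : F) * (k' : F) := by
      change algebraMap (𝓞 F) F _ = _
      rw [map_natCast]
      exact_mod_cast congrArg (Int.cast : ℤ → F) hk'
    change algebraMap (𝓞 F) F (k' * y) = _
    rw [h1, map_mul, map_intCast]
    change (k' : F) * (y : F) = _
    rw [hy]
    ring
  · exact (hB₄ κ.val hκR i j).trans (by linarith)
  · refine (hB₃ (κ⁻¹ : GLm m (E F)).val (fun p q => ?_) i j).trans (by linarith)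
    have h1 := congrFun (congrFun (realMat_inv κ) p) q
    rw [Matrix.smul_apply, smul_eq_mul] at h1
    have h2 := hκadj p q
    rw [← h1, abs_mul] at h2
    have h3 := abs_nonneg (realMat (κ⁻¹ : GLm m (E F)).val p q)
    calc |realMat (κ⁻¹ : GLm m (E F)).val p q|
        ≤ (√C * |(realMat κ.val).det|) * |realMat (κ⁻¹ : GLm m (E F)).val p q| :=
          le_mul_of_one_le_left h3 hκlow
      _ = √C * (|(realMat κ.val).det| * |realMat (κ⁻¹ : GLm m (E F)).val p q|) := by ring
      _ ≤ √C * B₂ := by gcongr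
      _ = B₂ * √C := mul_comm _ _

end

section

/-! ### Reduction theory at the finite places -/

/-- Matrices of finite adeles with integral entries. -/
def IntMat {ι κ : Type*} (A : Matrix ι κ (Af F)) : Prop := ∀ i j, A i j ∈ intAdeles F

theorem IntMat.mul {ι κ l : Type*} [Fintype κ] {A : Matrix ι κ (Af F)} {B : Matrix κ l (Af F)}
    (hA : IntMat A) (hB : IntMat B) : IntMat (A * B) := fun i j => by
  rw [Matrix.mul_apply]
  exact sum_mem fun k _ => mul_mem (hA i k) (hB k j)

theorem IntMat.smul {ι κ : Type*} {A : Matrix ι κ (Af F)} {c : Af F} (hc : c ∈ intAdeles F)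
    (hA : IntMat A) : IntMat (c • A) := fun i j => mul_mem hc (hA i j)

theorem IntMat.neg {ι κ : Type*} {A : Matrix ι κ (Af F)} (hA : IntMat A) : IntMat (-A) :=
  fun i j => neg_mem (hA i j)

theorem IntMat.fromBlocks {ι κ ι' κ' : Type*} {A : Matrix ι κ (Af F)} {B : Matrix ι κ' (Af F)}
    {C : Matrix ι' κ (Af F)} {D : Matrix ι' κ' (Af F)} (hA : IntMat A) (hB : IntMat B)
    (hC : IntMat C) (hD : IntMat D) : IntMat (Matrix.fromBlocks A B C D) := by
  rintro (i | i) (j | j)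
  exacts [hA i j, hB i j, hC i j, hD i j]

theorem IntMat.one_smul_one {ι : Type*} [DecidableEq ι] {c : Af F} (hc : c ∈ intAdeles F) :
    IntMat (c • (1 : Matrix ι ι (Af F))) := fun i j => by
  rw [Matrix.smul_apply, Matrix.one_apply]
  split_ifs
  · simpa using hc
  · simp [zero_mem]

theorem IntMat.zero {ι κ : Type*} : IntMat (0 : Matrix ι κ (Af F)) := fun _ _ => zero_mem _

theorem IntMat.submatrix {ι κ ι' κ' : Type*} {A : Matrix ι κ (Af F)} (hA : IntMat A)
    (f : ι' → ι) (g : κ' → κ) : IntMat (A.submatrix f g) := fun i j => hA (f i) (g j)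

/-- Over a non-archimedean local field, a non-zero row vector can be brought into the form
`(0, …, a, …, 0)` by an integral column operation with integral inverse. -/
theorem exists_local_pivot (v : HeightOneSpectrum (𝓞 F)) {J : Type*} [Fintype J] [DecidableEq J]
    (l : J) (r : J → v.adicCompletion F) (hr : r ≠ 0) :
    ∃ k k' : Matrix J J (v.adicCompletion F), (∀ i j, ‖k i j‖ ≤ 1) ∧ (∀ i j, ‖k' i j‖ ≤ 1) ∧
      k * k' = 1 ∧ ∀ i, i ≠ l → Matrix.vecMul r k i = 0 := by
  have hne : Nonempty J := ⟨l⟩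
  obtain ⟨j, hj⟩ := Finite.exists_max fun j => ‖r j‖
  have hj0 : r j ≠ 0 := by
    intro h
    refine hr (funext fun i => ?_)
    have := hj i
    rw [h, norm_zero] at this
    exact norm_le_zero_iff.1 this
  set σ := Equiv.swap j l with hσ
  set y : J → v.adicCompletion F := fun i => if i = l then 0 else r (σ i) / r j with hy
  have hy1 : ∀ i, ‖y i‖ ≤ 1 := by
    intro i
    simp only [hy]
    split_ifs
    · simp
    · rw [norm_div]
      exact div_le_one_of_le₀ (hj _) (norm_nonneg _)
  set N : Matrix J J (v.adicCompletion F) := Matrix.vecMulVec (Pi.single l 1) y with hN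
  have hN2 : N * N = 0 := by
    rw [hN, Matrix.vecMulVec_mul_vecMulVec]
    simp [hy]
  have hN1 : ∀ i j, ‖N i j‖ ≤ 1 := by
    intro i j
    rw [hN, Matrix.vecMulVec_apply, norm_mul]
    refine mul_le_one₀ ?_ (norm_nonneg _) (hy1 j)
    by_cases h : i = l
    · subst h; simp
    · simp [h]
  have h1 : ∀ i j, ‖(1 : Matrix J J (v.adicCompletion F)) i j‖ ≤ 1 := by
    intro i j
    rw [Matrix.one_apply]
    split_ifs <;> simp
  refine ⟨(1 - N).submatrix σ id, (1 + N).submatrix id σ, fun i j => ?_, fun i j => ?_, ?_, ?_⟩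
  · exact (norm_sub_le_max_of_ultra v _ _).trans (max_le (h1 _ _) (hN1 _ _))
  · exact (IsUltrametricDist.norm_add_le_max _ _).trans (max_le (h1 _ _) (hN1 _ _))
  · have h2 : (1 - N) * (1 + N) = 1 := by
      rw [sub_mul, mul_add, mul_add, hN2, one_mul, one_mul, mul_one]; abel
    have h3 := Matrix.submatrix_mul_equiv (1 - N) (1 + N) σ (Equiv.refl J) σ
    rw [h2, Matrix.submatrix_one_equiv] at h3
    exact h3
  · intro i hi
    have h2 : Matrix.vecMul r ((1 - N).submatrix σ id) i =
        Matrix.vecMul (fun i => r (σ i)) (1 - N) i := by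
      simp only [Matrix.vecMul, dotProduct, Matrix.submatrix_apply, id]
      rw [← Equiv.sum_comp σ]
      simp [hσ]
    rw [h2, Matrix.vecMul_sub, Matrix.vecMul_one, hN, Matrix.vecMul_vecMulVec]
    have h3 : (fun i => r (σ i)) ⬝ᵥ Pi.single l 1 = r j := by simp [hσ]
    rw [h3]
    simp only [Pi.sub_apply, Pi.smul_apply, hy, if_neg hi, smul_eq_mul]
    rw [mul_div_cancel₀ _ hj0, sub_self]

theorem Af.ext {x y : Af F} (h : ∀ v, x v = y v) : x = y := RestrictedProduct.ext _ _ h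

/-- The global version of `exists_local_pivot`. -/
theorem exists_pivot {J : Type*} [Fintype J] [DecidableEq J] (l : J) (r s : J → Af F)
    (hr : ∑ j, r j * s j = 1) :
    ∃ k k' : Matrix J J (Af F), IntMat k ∧ IntMat k' ∧ k * k' = 1 ∧
      ∀ i, i ≠ l → Matrix.vecMul r k i = 0 := by
  have hr0 : ∀ v : HeightOneSpectrum (𝓞 F), (fun j => r j v) ≠ 0 := by
    intro v h
    have h1 := congrArg (finEval v) hr
    rw [map_sum, map_one] at h1
    refine one_ne_zero (h1.symm.trans (Finset.sum_eq_zero fun j _ => ?_))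
    rw [map_mul]
    have : finEval v (r j) = 0 := congrFun h j
    rw [this, zero_mul]
  choose k k' hk hk' hkk hkr using fun v => exists_local_pivot v l (fun j => r j v) (hr0 v)
  have hfin : ∀ (A : ∀ v : HeightOneSpectrum (𝓞 F), Matrix J J (v.adicCompletion F))
      (_ : ∀ v i j, ‖A v i j‖ ≤ 1) (i j : J), {v | ¬ ‖A v i j‖ ≤ 1}.Finite := by
    intro A hA i j
    simp [hA]
  set K : Matrix J J (Af F) := Matrix.of fun i j => Af.mk (fun v => k v i j) (hfin k hk i j)
  set K' : Matrix J J (Af F) := Matrix.of fun i j => Af.mk (fun v => k' v i j) (hfin k' hk' i j)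
  refine ⟨K, K', fun i j v => hk v i j, fun i j v => hk' v i j, ?_, fun i hi => ?_⟩
  · refine Matrix.ext fun i j => Af.ext fun v => ?_
    have h1 := congrFun (congrFun (hkk v) i) j
    have h2 : finEval v ((K * K') i j) = (k v * k' v) i j := by
      rw [Matrix.mul_apply, map_sum, Matrix.mul_apply]
      rfl
    have h3 : finEval v ((1 : Matrix J J (Af F)) i j) = (1 : Matrix J J (v.adicCompletion F)) i j := by
      rw [Matrix.one_apply, Matrix.one_apply]
      split_ifs
      · exact map_one _
      · exact map_zero _
    exact h2.trans (h1.trans h3.symm)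
  · refine Af.ext fun v => ?_
    have h1 := hkr v i hi
    have h2 : finEval v (Matrix.vecMul r K i) = Matrix.vecMul (fun j => r j v) (k v) i := by
      simp only [Matrix.vecMul, dotProduct]
      rw [map_sum]
      rfl
    exact h2.trans h1

/-- The embedding of rational matrices in matrices of finite adeles. -/
abbrev finMat {ι κ : Type*} (A : Matrix ι κ F) : Matrix ι κ (Af F) := A.map (algebraMap F (Af F))

set_option maxHeartbeats 1000000 in
/-- Modulo `GL(F)` on the left, invertible matrices of finite adeles and their inverses have bounded
denominators. By integral column operations one may assume that the last row is `(0, …, 0, a)`.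
The remaining diagonal block is treated by induction, `a` by the finiteness of the class number,
and strong approximation makes the off-diagonal block integral. -/
theorem exists_fin_reduction_matrix (F : Type*) [Field F] [NumberField F] (m : ℕ) :
    ∃ N : 𝓞 F, N ≠ 0 ∧ ∀ G H : Matrix (Fin m) (Fin m) (Af F), G * H = 1 →
      ∃ δ δ' : Matrix (Fin m) (Fin m) F, δ * δ' = 1 ∧
        IntMat (algebraMap F (Af F) N • (finMat δ * G)) ∧
        IntMat (algebraMap F (Af F) N • (H * finMat δ')) := by
  induction m with
  | zero =>
    exact ⟨1, one_ne_zero, fun G H _ => ⟨1, 1, by simp, fun i => i.elim0, fun i => i.elim0⟩⟩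
  | succ m ih =>
    obtain ⟨N, hN, ih⟩ := ih
    obtain ⟨M, hM, hclass⟩ := exists_mul_mem_intAdeles (F := F)
    -- the statement for block matrices
    suffices hsuff : ∀ G H : Matrix (Fin m ⊕ Fin 1) (Fin m ⊕ Fin 1) (Af F), G * H = 1 →
        ∃ δ δ' : Matrix (Fin m ⊕ Fin 1) (Fin m ⊕ Fin 1) F, δ * δ' = 1 ∧
          IntMat (algebraMap F (Af F) (N * M : 𝓞 F) • (finMat δ * G)) ∧
          IntMat (algebraMap F (Af F) (N * M : 𝓞 F) • (H * finMat δ')) by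
      refine ⟨N * M, mul_ne_zero hN hM, fun G H hGH => ?_⟩
      let e : Fin m ⊕ Fin 1 ≃ Fin (m + 1) := finSumFinEquiv
      obtain ⟨δ, δ', h1, h2, h3⟩ := hsuff (G.submatrix e e) (H.submatrix e e) (by
        rw [Matrix.submatrix_mul_equiv, hGH, Matrix.submatrix_one_equiv])
      refine ⟨δ.submatrix e.symm e.symm, δ'.submatrix e.symm e.symm, ?_, ?_, ?_⟩
      · rw [Matrix.submatrix_mul_equiv, h1, Matrix.submatrix_one_equiv]
      · have h4 : finMat (δ.submatrix e.symm e.symm) * G =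
            (finMat δ * G.submatrix e e).submatrix e.symm e.symm := by
          rw [← Matrix.submatrix_mul_equiv _ _ _ e.symm, Matrix.submatrix_submatrix]
          simp [finMat, Matrix.submatrix_map]
        rw [h4]
        exact h2.submatrix e.symm e.symm
      · have h4 : H * finMat (δ'.submatrix e.symm e.symm) =
            (H.submatrix e e * finMat δ').submatrix e.symm e.symm := by
          rw [← Matrix.submatrix_mul_equiv _ _ _ e.symm, Matrix.submatrix_submatrix]
          simp [finMat, Matrix.submatrix_map]
        rw [h4]
        exact h3.submatrix e.symm e.symm
    intro G H hGH
    obtain ⟨K, K', hK, hK', hKK, hrow⟩ := exists_pivot (Sum.inr 0) (G (Sum.inr 0))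
      (fun j => H j (Sum.inr 0)) (by
        have := congrFun (congrFun hGH (Sum.inr 0)) (Sum.inr 0)
        simpa only [Matrix.mul_apply, Matrix.one_apply_eq] using this)
    have hAB : (G * K) * (K' * H) = 1 := by
      rw [Matrix.mul_assoc, ← Matrix.mul_assoc K, hKK, Matrix.one_mul, hGH]
    obtain ⟨A, hA⟩ : ∃ A, A = G * K := ⟨_, rfl⟩
    obtain ⟨B, hB⟩ : ∃ B, B = K' * H := ⟨_, rfl⟩
    have hGA : G = A * K' := by rw [hA, Matrix.mul_assoc, hKK, Matrix.mul_one]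
    have hHB : H = K * B := by rw [hB, ← Matrix.mul_assoc, hKK, Matrix.one_mul]
    rw [← hA, ← hB] at hAB
    -- `A = G K` and its inverse `B` are block upper triangular
    have hA21 : A.toBlocks₂₁ = 0 := by
      refine Matrix.ext fun i j => ?_
      have := hrow (Sum.inl j) (by simp)
      rw [hA]
      rw [Subsingleton.elim i 0]
      exact this
    obtain ⟨a, ha⟩ : ∃ a : Af F, A.toBlocks₂₂ = a • 1 := ⟨A.toBlocks₂₂ 0 0, by
      ext i j; rw [Subsingleton.elim i 0, Subsingleton.elim j 0]; simp⟩
    obtain ⟨b, hb⟩ : ∃ b : Af F, B.toBlocks₂₂ = b • 1 := ⟨B.toBlocks₂₂ 0 0, by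
      ext i j; rw [Subsingleton.elim i 0, Subsingleton.elim j 0]; simp⟩
    rw [← Matrix.fromBlocks_toBlocks A, ← Matrix.fromBlocks_toBlocks B,
      Matrix.fromBlocks_multiply, ← Matrix.fromBlocks_one, Matrix.fromBlocks_inj, hA21, ha, hb] at hAB
    obtain ⟨h11, -, h21, h22⟩ := hAB
    simp only [Matrix.zero_mul, zero_add, Matrix.smul_mul, Matrix.one_mul] at h21 h22
    have hab : a * b = 1 := by
      have := congrFun (congrFun h22 0) 0
      simpa [Matrix.smul_apply] using this
    have hB21 : B.toBlocks₂₁ = 0 := by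
      have := congrArg (fun X => b • X) h21
      simpa only [smul_smul, mul_comm b a, hab, one_smul, smul_zero] using this
    rw [hB21, Matrix.mul_zero, add_zero] at h11
    obtain ⟨δ₁, δ₁', hδ, hδA, hδB⟩ := ih _ _ h11
    obtain ⟨β, hβ, hβ1, hβ2⟩ := hclass ⟨a, b, hab, by rw [mul_comm, hab]⟩
    simp only [Units.inv_mk] at hβ1 hβ2
    set φ := algebraMap F (Af F) with hφ
    set α : Af F := φ β⁻¹ * a with hα
    set α' : Af F := b * φ β with hα'
    have hββ : φ β⁻¹ * φ β = 1 := by rw [← map_mul, inv_mul_cancel₀ hβ, map_one]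
    have hαα : α * α' = 1 := by
      rw [hα, hα']
      linear_combination (φ β⁻¹ * φ β) * hab + hββ
    have hαM : φ M * α ∈ intAdeles F := by
      have : φ M * α = a * φ (β⁻¹ * M) := by rw [hα, map_mul]; ring
      rw [this]; exact hβ2
    -- strong approximation for the last column
    choose y hy using fun i : Fin m =>
      exists_sub_mem_intAdeles (α' * (finMat δ₁ * A.toBlocks₁₂) i 0)
    set Y : Matrix (Fin m) (Fin 1) F := Matrix.of fun i _ => - y i with hY
    set Z : Matrix (Fin m) (Fin 1) (Af F) := α' • (finMat δ₁ * A.toBlocks₁₂) + finMat Y with hZ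
    have hZint : IntMat Z := by
      intro i j
      rw [Subsingleton.elim j 0]
      have := hy i
      rw [hZ, Matrix.add_apply, Matrix.smul_apply, smul_eq_mul]
      simpa [hY, sub_eq_add_neg] using this
    have hδf : finMat δ₁ * finMat δ₁' = 1 := by
      rw [← Matrix.map_mul, hδ, Matrix.map_one _ (map_zero _) (map_one _)]
    set X : Matrix (Fin m ⊕ Fin 1) (Fin m ⊕ Fin 1) (Af F) :=
      Matrix.fromBlocks (finMat δ₁ * A.toBlocks₁₁) (α • Z) 0 (α • 1) with hX
    set X' : Matrix (Fin m ⊕ Fin 1) (Fin m ⊕ Fin 1) (Af F) :=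
      Matrix.fromBlocks (B.toBlocks₁₁ * finMat δ₁') (-(B.toBlocks₁₁ * finMat δ₁' * Z)) 0
        (α' • 1) with hX'
    have hXX1 : (finMat δ₁ * A.toBlocks₁₁) * (B.toBlocks₁₁ * finMat δ₁') = 1 := by
      rw [Matrix.mul_assoc, ← Matrix.mul_assoc A.toBlocks₁₁, h11, Matrix.one_mul, hδf]
    have hXX : X * X' = 1 := by
      rw [hX, hX', Matrix.fromBlocks_multiply, ← Matrix.fromBlocks_one, Matrix.fromBlocks_inj]
      refine ⟨?_, ?_, ?_, ?_⟩
      · rw [Matrix.mul_zero, add_zero, hXX1]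
      · rw [Matrix.mul_neg, ← Matrix.mul_assoc, hXX1, Matrix.one_mul, Matrix.mul_smul,
          Matrix.mul_one, smul_smul, mul_comm α' α, hαα, one_smul, neg_add_cancel]
      · simp
      · rw [Matrix.zero_mul, zero_add, Matrix.smul_mul, Matrix.one_mul, smul_smul, hαα, one_smul]
    set δ : Matrix (Fin m ⊕ Fin 1) (Fin m ⊕ Fin 1) F :=
      Matrix.fromBlocks δ₁ (β⁻¹ • Y) 0 (β⁻¹ • 1) with hδdef
    set δ' : Matrix (Fin m ⊕ Fin 1) (Fin m ⊕ Fin 1) F :=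
      Matrix.fromBlocks δ₁' (-(δ₁' * Y)) 0 (β • 1) with hδ'def
    have hδδ : δ * δ' = 1 := by
      rw [hδdef, hδ'def, Matrix.fromBlocks_multiply, ← Matrix.fromBlocks_one,
        Matrix.fromBlocks_inj]
      refine ⟨?_, ?_, ?_, ?_⟩
      · rw [Matrix.mul_zero, add_zero, hδ]
      · rw [Matrix.mul_neg, ← Matrix.mul_assoc, hδ, Matrix.one_mul, Matrix.mul_smul,
          Matrix.mul_one, smul_smul, mul_inv_cancel₀ hβ, one_smul, neg_add_cancel]
      · simp
      · rw [Matrix.zero_mul, zero_add, Matrix.smul_mul, Matrix.one_mul, smul_smul,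
          inv_mul_cancel₀ hβ, one_smul]
    have hδA' : finMat δ * A = X := by
      rw [← Matrix.fromBlocks_toBlocks A, hA21, ha, hδdef, finMat, Matrix.fromBlocks_map,
        Matrix.fromBlocks_multiply, hX, Matrix.fromBlocks_inj]
      have e1 : (β⁻¹ • (1 : Matrix (Fin 1) (Fin 1) F)).map φ = φ β⁻¹ • 1 := by
        ext i j; rw [Subsingleton.elim i 0, Subsingleton.elim j 0]; simp
      have e2 : (β⁻¹ • Y).map φ = φ β⁻¹ • finMat Y := by
        ext i j; simp [hφ]
      refine ⟨?_, ?_, ?_, ?_⟩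
      · rw [Matrix.mul_zero, add_zero]
      · rw [e2, hZ, smul_add, smul_smul, hαα, one_smul, Matrix.mul_smul, Matrix.mul_one, smul_smul,
          mul_comm a]
      · simp
      · rw [e1, Matrix.map_zero _ (map_zero φ), Matrix.zero_mul, zero_add, Matrix.smul_mul,
          Matrix.one_mul, smul_smul]
    have hBδ' : B * finMat δ' = X' := by
      have h1 : X * (B * finMat δ') = 1 := by
        rw [← hδA', Matrix.mul_assoc, ← Matrix.mul_assoc A]
        have h2 : A * B = 1 := by
          have : G * H = A * (K' * K) * B := by
            rw [hGA, hHB]; simp only [Matrix.mul_assoc]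
          rw [mul_eq_one_comm.1 hKK, Matrix.mul_one, hGH] at this
          exact this.symm
        rw [h2, Matrix.one_mul, finMat, finMat, ← Matrix.map_mul, hδδ,
          Matrix.map_one _ (map_zero _) (map_one _)]
      calc B * finMat δ' = (X' * X) * (B * finMat δ') := by
            rw [mul_eq_one_comm.1 hXX, Matrix.one_mul]
        _ = X' := by rw [Matrix.mul_assoc, h1, Matrix.mul_one]
    have hNM : φ ((N * M : 𝓞 F) : F) = φ N * φ M := by
      rw [← map_mul]; rfl
    have hNi : φ N ∈ intAdeles F := algebraMap_int_mem N
    have hMi : φ M ∈ intAdeles F := algebraMap_int_mem M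
    refine ⟨δ, δ', hδδ, ?_, ?_⟩
    · rw [hGA, ← Matrix.mul_assoc, hδA', ← Matrix.smul_mul]
      refine IntMat.mul ?_ hK'
      rw [hX, Matrix.fromBlocks_smul]
      refine IntMat.fromBlocks ?_ ?_ ?_ ?_
      · rw [hNM, mul_comm, mul_smul]
        exact hδA.smul hMi
      · rw [hNM, smul_smul, mul_assoc]
        exact hZint.smul (mul_mem hNi hαM)
      · rw [smul_zero]; exact IntMat.zero
      · rw [hNM, smul_smul, mul_assoc]
        exact IntMat.one_smul_one (mul_mem hNi hαM)
    · rw [hHB, Matrix.mul_assoc, hBδ', ← Matrix.mul_smul]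
      refine IntMat.mul hK ?_
      rw [hX', Matrix.fromBlocks_smul]
      refine IntMat.fromBlocks ?_ ?_ ?_ ?_
      · rw [hNM, mul_comm, mul_smul]
        exact hδB.smul hMi
      · rw [hNM, mul_comm, mul_smul, smul_neg, ← Matrix.smul_mul]
        exact (hδB.mul hZint).neg.smul hMi
      · rw [smul_zero]; exact IntMat.zero
      · rw [hNM, smul_smul]
        exact IntMat.one_smul_one (mul_mem (mul_mem hNi hMi) hβ1)

end

section

open scoped Classical

/-! ### Reduction theory for `GL_m(𝔸)` and for the ideles -/

/-- Bounded archimedean components and bounded denominators cut out a compact set of adeles. -/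
theorem isCompact_bounded_adeles (B : ℝ) {N : 𝓞 F} (hN : N ≠ 0) :
    IsCompact {x : 𝔸 F | ‖archProj F x‖ ≤ B ∧
      algebraMap F (Af F) N * finProj F x ∈ intAdeles F} := by
  have hN' : (N : F) ≠ 0 := by simpa using hN
  have h1 : algebraMap F (Af F) ((N : F)⁻¹) * algebraMap F (Af F) N = 1 := by
    rw [← map_mul, inv_mul_cancel₀ hN', map_one]
  have h2 : IsCompact ((fun x : Af F => algebraMap F (Af F) ((N : F)⁻¹) * x) ''
      (intAdeles F : Set (Af F))) := isCompact_intAdeles.image (continuous_const_mul _)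
  refine (((isCompact_closedBall (0 : E F) B).prod h2).image continuous_adeleEquiv).of_isClosed_subset
    ?_ ?_
  · refine IsClosed.inter (isClosed_le (continuous_archProj.norm) continuous_const) ?_
    exact isCompact_intAdeles.isClosed.preimage (continuous_const.mul continuous_finProj)
  · rintro x ⟨hx1, hx2⟩
    refine ⟨(archProj F x, finProj F x), ⟨by simpa using hx1, ?_⟩, adeleEquiv_proj x⟩
    exact ⟨_, hx2, by simp only [← mul_assoc, h1, one_mul]⟩

variable {m : ℕ}

/-- The elements of `GL_m(𝔸)` such that they and their inverses have archimedean entries bounded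
by `B` and finite entries with denominator dividing `N`. -/
def boundedGL (m : ℕ) (B : ℝ) (N : 𝓞 F) : Set (GLm m (𝔸 F)) :=
  {g | (∀ i j, ‖(archPart g).val i j‖ ≤ B ∧
      algebraMap F (Af F) N * (finPart g).val i j ∈ intAdeles F) ∧
    ∀ i j, ‖((archPart g)⁻¹ : GLm m (E F)).val i j‖ ≤ B ∧
      algebraMap F (Af F) N * ((finPart g)⁻¹ : GLm m (Af F)).val i j ∈ intAdeles F}

theorem isCompact_boundedGL (B : ℝ) {N : 𝓞 F} (hN : N ≠ 0) : IsCompact (boundedGL m B N) := by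
  have h := isCompact_gl (m := m) (isCompact_bounded_adeles B hN) (isCompact_bounded_adeles B hN)
  refine h.of_isClosed_subset ?_ fun g hg => ?_
  · have h1 : boundedGL m B N = {g : GLm m (𝔸 F) |
        (∀ i j, (g : Matrix (Fin m) (Fin m) (𝔸 F)) i j ∈ {x : 𝔸 F | ‖archProj F x‖ ≤ B ∧
          algebraMap F (Af F) N * finProj F x ∈ intAdeles F}) ∧
        ∀ i j, ((g⁻¹ : GLm m (𝔸 F)) : Matrix (Fin m) (Fin m) (𝔸 F)) i j ∈
          {x : 𝔸 F | ‖archProj F x‖ ≤ B ∧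
          algebraMap F (Af F) N * finProj F x ∈ intAdeles F}} := by
      ext g
      rw [boundedGL, Set.mem_ofPred_eq, ← map_inv, ← map_inv]
      rfl
    rw [h1]
    exact h.isClosed
  · rw [boundedGL, Set.mem_ofPred_eq, ← map_inv, ← map_inv] at hg
    exact hg

/-- The number two as a unit. -/
def two : ℝˣ := Units.mk0 2 two_ne_zero

/-- Reduction theory: `GL_m(𝔸)` is the union of the sets `GL_m(F) t C`, for a compact set `C` and
`t` running through the archimedean diagonal matrices whose entries are powers of two. -/
theorem exists_reduction (F : Type*) [Field F] [NumberField F] (m : ℕ) :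
    ∃ C : Set (GLm m (𝔸 F)), IsCompact C ∧
    ∀ g, ∃ k : Fin m → ℤ, ∃ γ ∈ rationalGL F m, ∃ κ ∈ C,
      γ * g = archGL (archDiag fun j => two ^ k j) * κ := by
  obtain ⟨N, hN, hfin⟩ := exists_fin_reduction_matrix F m
  obtain ⟨B, hB, M, hM, harch⟩ := exists_arch_reduction F m
  refine ⟨boundedGL m (2 * B) (N * M), isCompact_boundedGL _ (mul_ne_zero hN hM), fun g => ?_⟩
  obtain ⟨δ, δ', hδ, hδ1, hδ2⟩ := hfin (finPart g).val ((finPart g)⁻¹ : GLm m (Af F)).val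
    (finPart g).mul_inv
  set δG : GLm m F := ⟨δ, δ', hδ, mul_eq_one_comm.1 hδ⟩ with hδG
  obtain ⟨γ, hγ1, hγ2, t, ht, κ, hκ, hκB⟩ := harch (embGL δG * archPart g)
  choose k hk using fun j => exists_mem_Ico_zpow (ht j) (one_lt_two : (1 : ℝ) < 2)
  have htwo : ∀ j, ((two ^ k j : ℝˣ) : ℝ) = 2 ^ k j := fun j => by
    rw [Units.val_zpow_eq_zpow_val]; rfl
  set γ' : GLm m F := γ * δG with hγ'
  have hgeq : ratGL γ' * g = archGL (archDiag fun j => two ^ k j) *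
      ((archGL (archDiag fun j => two ^ k j))⁻¹ * (ratGL γ' * g)) := by rw [mul_inv_cancel_left]
  refine ⟨k, ratGL γ', ratGL_mem _, _, ?_, hgeq⟩
  have ha : archPart ((archGL (archDiag fun j => two ^ k j))⁻¹ * (ratGL γ' * g)) =
      archDiag (fun j => (two ^ k j)⁻¹ * t j) * κ := by
    have h1 : (archDiag (F := F) fun j => (two ^ k j)⁻¹ * t j) =
        (archDiag fun j => two ^ k j)⁻¹ * archDiag t := by
      rw [← map_inv, ← map_mul]; rfl
    rw [map_mul, map_mul, map_inv, archPart_archGL, archPart_ratGL, h1, mul_assoc, ← hκ, hγ',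
      map_mul, mul_assoc]
    rfl
  have hf : finPart ((archGL (archDiag fun j => two ^ k j))⁻¹ * (ratGL γ' * g)) =
      finPart (ratGL γ) * (finPart (ratGL δG) * finPart g) := by
    rw [map_mul, map_inv, finPart_archGL, inv_one, one_mul, map_mul, hγ', map_mul, map_mul,
      mul_assoc]
  set φ := algebraMap F (Af F) with hφ
  have hNM : φ ((N * M : 𝓞 F) : F) = φ N * φ M := by
    rw [← map_mul]; rfl
  have hτ : ∀ j, 1 ≤ (((two ^ k j)⁻¹ * t j : ℝˣ) : ℝ) ∧ (((two ^ k j)⁻¹ * t j : ℝˣ) : ℝ) ≤ 2 := by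
    intro j
    have h2 : (0 : ℝ) < 2 ^ k j := by positivity
    rw [Units.val_mul, Units.val_inv_eq_inv_val, htwo, inv_mul_eq_div]
    refine ⟨(one_le_div h2).2 (hk j).1, (div_le_iff₀ h2).2 ?_⟩
    have := (hk j).2.le
    rwa [zpow_add_one₀ two_ne_zero, mul_comm] at this
  refine ⟨fun i j => ⟨?_, ?_⟩, fun i j => ⟨?_, ?_⟩⟩
  · rw [ha, Units.val_mul, archDiag_val, Matrix.diagonal_mul, ← Algebra.smul_def, norm_smul,
      Real.norm_eq_abs, abs_of_nonneg (zero_le_one.trans (hτ i).1)]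
    exact mul_le_mul (hτ i).2 (hκB i j).1 (norm_nonneg _) zero_le_two
  · rw [hf, hNM]
    have h1 : IntMat (finPart (ratGL γ)).val := by
      intro i j
      obtain ⟨a, ha⟩ := hγ1 i j
      have : (finPart (ratGL γ)).val i j = φ a := by rw [ha]; rfl
      rw [this]
      exact algebraMap_int_mem a
    have h2 := ((h1.mul hδ1).smul (algebraMap_int_mem M)) i j
    rw [Matrix.mul_smul, Matrix.smul_apply, Matrix.smul_apply, smul_eq_mul, smul_eq_mul,
      ← mul_assoc, mul_comm (algebraMap F (Af F) M)] at h2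
    exact h2
  · rw [ha, mul_inv_rev, ← map_inv, Units.val_mul, archDiag_val, Matrix.mul_diagonal, mul_comm,
      ← Algebra.smul_def, norm_smul, Pi.inv_apply, Units.val_inv_eq_inv_val, norm_inv,
      Real.norm_eq_abs, abs_of_nonneg (zero_le_one.trans (hτ j).1)]
    refine (mul_le_mul (inv_le_one_of_one_le₀ (hτ j).1) (hκB i j).2 (norm_nonneg _)
      zero_le_one).trans ?_
    linarith
  · rw [hf, mul_inv_rev, mul_inv_rev, hNM]
    have h1 : IntMat (φ M • ((finPart (ratGL γ))⁻¹ : GLm m (Af F)).val) := by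
      intro i j
      obtain ⟨a, ha⟩ := hγ2 i j
      have : (φ M • ((finPart (ratGL γ))⁻¹ : GLm m (Af F)).val) i j = φ a := by
        rw [ha, map_mul, ← map_inv, ← map_inv]; rfl
      rw [this]
      exact algebraMap_int_mem a
    have h3 : ((finPart (ratGL δG))⁻¹ : GLm m (Af F)).val = finMat δ' := by
      rw [← map_inv, ← map_inv]; rfl
    have h2 := (hδ2.mul h1) i j
    rw [Matrix.mul_smul, Matrix.smul_mul, smul_smul, mul_comm (φ M)] at h2
    rw [Units.val_mul, Units.val_mul, h3]
    exact h2

/-- The idele with archimedean components `t` and finite components `1`. -/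
def realIdele : ℝˣ →* (𝔸 F)ˣ :=
  (Matrix.GeneralLinearGroup.det.comp archGL).comp
    ((archDiag (F := F) (m := 1)).comp (Pi.constMonoidHom (Fin 1) ℝˣ))

theorem realIdele_apply (t : ℝˣ) : (realIdele t : (𝔸 F)ˣ) =
    Matrix.GeneralLinearGroup.det (archGL (archDiag (F := F) fun _ : Fin 1 => t)) := rfl

theorem archProj_realIdele (t : ℝˣ) :
    archProj F (realIdele t : (𝔸 F)ˣ) = algebraMap ℝ (E F) t := by
  rw [realIdele_apply, Matrix.GeneralLinearGroup.val_det_apply, Matrix.det_fin_one]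
  change (archPart (archGL (archDiag (F := F) fun _ : Fin 1 => t))).val 0 0 = _
  rw [archPart_archGL, archDiag_val]
  simp

theorem finProj_realIdele (t : ℝˣ) : finProj F (realIdele t : (𝔸 F)ˣ) = 1 := by
  rw [realIdele_apply, Matrix.GeneralLinearGroup.val_det_apply, Matrix.det_fin_one]
  change (finPart (archGL (archDiag (F := F) fun _ : Fin 1 => t))).val 0 0 = _
  rw [finPart_archGL]
  rfl

/-- Reduction theory for the ideles. -/
theorem exists_reduction_ideles (F : Type*) [Field F] [NumberField F] :
    ∃ C : Set (𝔸 F)ˣ, IsCompact C ∧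
    ∀ u, ∃ k : ℤ, ∃ γ ∈ rationalIdeles F, ∃ κ ∈ C, γ * u = realIdele (two ^ k) * κ := by
  obtain ⟨C, hC, h⟩ := exists_reduction F 1
  refine ⟨Matrix.GeneralLinearGroup.det '' C,
    hC.image Matrix.GeneralLinearGroup.continuous_det, fun u => ?_⟩
  obtain ⟨k, _, ⟨γ, rfl⟩, κ, hκ, hg⟩ := h (Matrix.GeneralLinearGroup.scalar (Fin 1) u)
  refine ⟨k 0, _, ⟨Matrix.GeneralLinearGroup.det γ, rfl⟩, _, ⟨κ, hκ, rfl⟩, ?_⟩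
  have h1 := congrArg Matrix.GeneralLinearGroup.det hg
  rw [map_mul, map_mul] at h1
  have h2 : Matrix.GeneralLinearGroup.det (Matrix.GeneralLinearGroup.scalar (Fin 1) u) = u := by
    refine Units.ext ?_
    simp
  have h3 : (fun j => two ^ k j) = fun _ : Fin 1 => two ^ k 0 := by
    funext j
    rw [Subsingleton.elim j 0]
  rw [h2, h3, ← realIdele_apply] at h1
  rw [← h1]
  congr 1
  refine Units.ext ?_
  rw [Matrix.GeneralLinearGroup.val_det_apply, Matrix.det_fin_one]
  change algebraMap F (𝔸 F) _ = algebraMap F (𝔸 F) _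
  congr 1
  exact Matrix.det_fin_one _

end

section

/-! ### Oscillation of smooth periodic functions -/

/-- The oscillation of a smooth function of period one is bounded by any of its derivatives: the
derivative has mean value zero, so it is bounded by its own oscillation. -/
theorem norm_sub_le_of_periodic (q : ℕ) : ∀ {φ : ℝ → ℂ} (_ : ContDiff ℝ ∞ φ)
    (_ : ∀ s, φ (s + 1) = φ s) {B : ℝ}
    (_ : ∀ s ∈ Set.Icc (0 : ℝ) 1, ‖iteratedDeriv (q + 1) φ s‖ ≤ B),
    ∀ s ∈ Set.Icc (0 : ℝ) 1, ∀ s' ∈ Set.Icc (0 : ℝ) 1, ‖φ s - φ s'‖ ≤ B := by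
  have base : ∀ {φ : ℝ → ℂ} (_ : ContDiff ℝ ∞ φ) {B : ℝ}
      (_ : ∀ s ∈ Set.Icc (0 : ℝ) 1, ‖deriv φ s‖ ≤ B),
      ∀ s ∈ Set.Icc (0 : ℝ) 1, ∀ s' ∈ Set.Icc (0 : ℝ) 1, ‖φ s - φ s'‖ ≤ B := by
    intro φ hφ B hB s hs s' hs'
    have h1 := (convex_Icc (0 : ℝ) 1).norm_image_sub_le_of_norm_deriv_le
      (fun x _ => (hφ.differentiable (by simp)).differentiableAt) hB hs' hs
    have h2 : ‖s - s'‖ ≤ 1 := by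
      rw [Real.norm_eq_abs, abs_le]
      constructor <;> linarith [hs.1, hs.2, hs'.1, hs'.2]
    have h3 : 0 ≤ B := (norm_nonneg _).trans (hB s hs)
    exact h1.trans (mul_le_of_le_one_right h3 h2)
  induction q with
  | zero =>
    intro φ hφ _ B hB
    exact base hφ (by simpa using hB)
  | succ q ih =>
    intro φ hφ hper B hB
    have hφ' : ContDiff ℝ ∞ (deriv φ) := (contDiff_infty_iff_deriv.1 hφ).2
    have hper' : ∀ s, deriv φ (s + 1) = deriv φ s := by
      intro s
      have : (fun x => φ (x + 1)) = φ := funext hper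
      rw [← deriv_comp_add_const, this]
    have hosc := ih hφ' hper' (B := B) (by
      intro s hs
      rw [← iteratedDeriv_succ']
      exact hB s hs)
    refine base hφ fun s hs => ?_
    have hcont : Continuous (deriv φ) := hφ'.continuous
    have h0 : ∫ u in (0 : ℝ)..1, deriv φ u = 0 := by
      rw [intervalIntegral.integral_deriv_eq_sub
        (fun x _ => (hφ.differentiable (by simp)).differentiableAt) (hcont.intervalIntegrable _ _)]
      have := hper 0
      rw [zero_add] at this
      rw [this, sub_self]
    have h1 : deriv φ s = ∫ u in (0 : ℝ)..1, (deriv φ s - deriv φ u) := by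
      rw [intervalIntegral.integral_sub (continuous_const.intervalIntegrable _ _)
        (hcont.intervalIntegrable _ _), h0]
      simp
    rw [h1]
    refine (intervalIntegral.norm_integral_le_of_norm_le_const (C := B) fun u hu => ?_).trans
      (by simp)
    rw [Set.uIoc_of_le zero_le_one] at hu
    exact hosc s hs u ⟨hu.1.le, hu.2⟩

/-- If a function on the unit cube varies by at most `B` in each variable separately, it varies by
at most `B` times the number of variables. -/
theorem norm_sub_le_of_cube {ι : Type*} [Fintype ι] [DecidableEq ι] {f : (ι → ℝ) → ℂ} {B : ℝ}
    (h : ∀ x, (∀ i, x i ∈ Set.Icc (0 : ℝ) 1) → ∀ i, ∀ s ∈ Set.Icc (0 : ℝ) 1,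
      ‖f x - f (Function.update x i s)‖ ≤ B)
    {x y : ι → ℝ} (hx : ∀ i, x i ∈ Set.Icc (0 : ℝ) 1) (hy : ∀ i, y i ∈ Set.Icc (0 : ℝ) 1) :
    ‖f x - f y‖ ≤ Fintype.card ι * B := by
  have key : ∀ S : Finset ι, ‖f x - f (S.piecewise y x)‖ ≤ S.card * B := by
    intro S
    induction S using Finset.induction_on with
    | empty => simp
    | insert i S hi ih =>
      rw [Finset.piecewise_insert, Finset.card_insert_of_notMem hi]
      have h1 := h (S.piecewise y x) (fun j => by
        by_cases hj : j ∈ S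
        · rw [Finset.piecewise_eq_of_mem _ _ _ hj]; exact hy j
        · rw [Finset.piecewise_eq_of_notMem _ _ _ hj]; exact hx j) i (y i) (hy i)
      have h2 := norm_sub_le_norm_sub_add_norm_sub (f x) (f (S.piecewise y x))
        (f (Function.update (S.piecewise y x) i (y i)))
      push_cast
      linarith
  have := key Finset.univ
  rwa [Finset.piecewise_univ] at this

end

section

open scoped Classical

/-! ### Archimedean derivatives -/

variable {m : ℕ}

theorem eventually_isUnit_one_add :
    ∀ᶠ X : Fin m → Fin m → E F in 𝓝 0, IsUnit (1 + Matrix.of X) := by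
  have hc : Continuous fun X : Fin m → Fin m → E F => (1 + Matrix.of X).det :=
    Continuous.matrix_det (continuous_const.add (f := fun _ => (1 : Matrix (Fin m) (Fin m) (E F)))
      (g := fun X : Fin m → Fin m → E F => Matrix.of X) continuous_id)
  have h1 : {X : Fin m → Fin m → E F | IsUnit (1 + Matrix.of X).det} ∈ 𝓝 0 := by
    refine (Units.isOpen.preimage hc).mem_nhds ?_
    change IsUnit (1 + Matrix.of (0 : Fin m → Fin m → E F)).det
    have : Matrix.of (0 : Fin m → Fin m → E F) = 0 := rfl
    rw [this, add_zero, Matrix.det_one]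
    exact isUnit_one
  filter_upwards [h1] with X hX
  exact (Matrix.isUnit_iff_isUnit_det _).2 hX

/-- A matrix over `F ⊗ ℝ` as an element of the normed space of functions of two indices. -/
def toFn : LieGL F m ≃ₗ[ℝ] (Fin m → Fin m → E F) := (Matrix.ofLinearEquiv ℝ).symm

/-- The element of `GL_m(𝔸)` with archimedean component `1 + X` and finite component `1`. -/
def oneAdd (X : LieGL F m) : GLm m (𝔸 F) := archOneAdd (toFn X)

theorem lieDeriv_def (X : LieGL F m) (f : GLm m (𝔸 F) → ℂ) (g : GLm m (𝔸 F)) :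
    lieDeriv X f g = deriv (fun t : ℝ => f (g * oneAdd (t • X))) 0 := rfl

theorem oneAdd_eq {X : LieGL F m} {a : GLm m (E F)} (h : a.val = 1 + X) :
    oneAdd X = archGL a := archOneAdd_eq h

theorem oneAdd_mul {X Y : LieGL F m} (hX : IsUnit (1 + X)) (hY : IsUnit (1 + Y)) :
    oneAdd X * oneAdd Y = oneAdd (X + (1 + X) * Y) := by
  obtain ⟨a, ha⟩ := hX
  obtain ⟨b, hb⟩ := hY
  rw [oneAdd_eq ha, oneAdd_eq hb, ← map_mul]
  refine (oneAdd_eq ?_).symm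
  rw [Units.val_mul, ha, hb, mul_add, mul_one, add_assoc]

theorem IsArchSmooth.hasDerivAt_fderiv {f : GLm m (𝔸 F) → ℂ} (hf : IsArchSmooth f)
    (X : LieGL F m) (g : GLm m (𝔸 F)) :
    HasDerivAt (fun t : ℝ => f (g * oneAdd (t • X)))
      (fderiv ℝ (fun Y : Fin m → Fin m → E F => f (g * archOneAdd Y)) 0 (toFn X)) 0 := by
  have h1 : HasFDerivAt (fun Y : Fin m → Fin m → E F => f (g * archOneAdd Y))
      (fderiv ℝ (fun Y : Fin m → Fin m → E F => f (g * archOneAdd Y)) 0)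
      ((0 : ℝ) • toFn X) := by
    rw [zero_smul]
    exact ((hf g).differentiableAt (by simp)).hasFDerivAt
  have h2 : HasDerivAt (fun t : ℝ => t • toFn X) (toFn X) 0 := by
    simpa using (hasDerivAt_id (0 : ℝ)).smul_const (toFn X)
  have h3 := h1.comp_hasDerivAt 0 h2
  refine h3.congr_of_eventuallyEq (Filter.Eventually.of_forall fun t => ?_)
  rfl

theorem IsArchSmooth.lieDeriv_eq {f : GLm m (𝔸 F) → ℂ} (hf : IsArchSmooth f) (X : LieGL F m)
    (g : GLm m (𝔸 F)) :
    lieDeriv X f g =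
      fderiv ℝ (fun Y : Fin m → Fin m → E F => f (g * archOneAdd Y)) 0 (toFn X) :=
  (hf.hasDerivAt_fderiv X g).deriv

theorem IsArchSmooth.hasDerivAt {f : GLm m (𝔸 F) → ℂ} (hf : IsArchSmooth f) (X : LieGL F m)
    (g : GLm m (𝔸 F)) :
    HasDerivAt (fun t : ℝ => f (g * oneAdd (t • X))) (lieDeriv X f g) 0 :=
  (hf.hasDerivAt_fderiv X g).differentiableAt.hasDerivAt

theorem IsArchSmooth.lieDeriv_sum_smul {f : GLm m (𝔸 F) → ℂ} (hf : IsArchSmooth f) {ι : Type*}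
    (s : Finset ι) (c : ι → ℝ) (X : ι → LieGL F m) (g : GLm m (𝔸 F)) :
    lieDeriv (∑ i ∈ s, c i • X i) f g = ∑ i ∈ s, (c i : ℂ) * lieDeriv (X i) f g := by
  simp only [hf.lieDeriv_eq, map_sum, map_smul, Complex.real_smul]

theorem lieDeriv_sum_mul {ι : Type*} (s : Finset ι) (c : ι → ℂ) {f : ι → GLm m (𝔸 F) → ℂ}
    (hf : ∀ i, IsArchSmooth (f i)) (X : LieGL F m) :
    lieDeriv X (fun g => ∑ i ∈ s, c i * f i g) = fun g => ∑ i ∈ s, c i * lieDeriv X (f i) g := by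
  funext g
  exact (HasDerivAt.fun_sum fun i (_ : i ∈ s) => ((hf i).hasDerivAt X g).const_mul (c i)).deriv

/-- Derivatives of functions smooth in the archimedean variable are again smooth: near `g`, the
derivative along `X` is `Y ↦ dG_Y ((1 + Y) X)`, where `G Y = f (g (1 + Y))`. -/
theorem IsArchSmooth.lieDeriv {f : GLm m (𝔸 F) → ℂ} (hf : IsArchSmooth f) (X : LieGL F m) :
    IsArchSmooth (lieDeriv X f) := by
  intro g
  set G : (Fin m → Fin m → E F) → ℂ := fun Y => f (g * archOneAdd Y) with hG
  have hGs : ContDiffAt ℝ ∞ G 0 := hf g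
  let L : (Fin m → Fin m → E F) →L[ℝ] (Fin m → Fin m → E F) :=
    LinearMap.toContinuousLinearMap
      (toFn.toLinearMap ∘ₗ (LinearMap.mulRight ℝ X) ∘ₗ toFn.symm.toLinearMap)
  have hL : ∀ Y, L Y = toFn (Matrix.of Y * X) := fun Y => rfl
  have h1 : ContDiffAt ℝ ∞ (fun Y => fderiv ℝ G Y (toFn X + L Y)) 0 := by
    refine ContDiffAt.clm_apply (hGs.fderiv_right (by simp)) ?_
    exact contDiffAt_const.add L.contDiff.contDiffAt
  refine h1.congr_of_eventuallyEq ?_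
  have h2 : ∀ᶠ Y in 𝓝 (0 : Fin m → Fin m → E F), ContDiffAt ℝ 1 G Y :=
    (hGs.of_le (by simp)).eventually (by simp)
  filter_upwards [h2, eventually_isUnit_one_add] with Y hY hYu
  have h3 : HasDerivAt (fun t : ℝ => Y + t • (toFn X + L Y)) (toFn X + L Y) 0 := by
    simpa using ((hasDerivAt_id (0 : ℝ)).smul_const (toFn X + L Y)).const_add Y
  have h4 : HasFDerivAt G (fderiv ℝ G Y) (Y + (0 : ℝ) • (toFn X + L Y)) := by
    rw [zero_smul, add_zero]
    exact (hY.differentiableAt (by simp)).hasFDerivAt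
  rw [← (h4.comp_hasDerivAt 0 h3).deriv, lieDeriv_def]
  refine Filter.EventuallyEq.deriv_eq ?_
  have h5 : Filter.Tendsto (fun t : ℝ => t • toFn X) (𝓝 0) (𝓝 0) := by
    have : Continuous fun t : ℝ => t • toFn X := by fun_prop
    simpa using this.tendsto 0
  filter_upwards [h5.eventually eventually_isUnit_one_add] with t ht
  have h6 : archOneAdd Y * oneAdd (t • X) = archOneAdd (Y + t • (toFn X + L Y)) := by
    have h7 : IsUnit (1 + t • X) := ht
    have h8 := oneAdd_mul hYu h7
    have h9 : Matrix.of Y + (1 + Matrix.of Y) * (t • X) =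
        Matrix.of (Y + t • (toFn X + L Y)) := by
      rw [Matrix.mul_smul, add_mul, one_mul]
      rfl
    rw [h9] at h8
    exact h8
  change f (g * archOneAdd Y * oneAdd (t • X)) = f (g * _)
  rw [mul_assoc, h6]

theorem IsArchSmooth.wordDeriv {f : GLm m (𝔸 F) → ℂ} (hf : IsArchSmooth f)
    (w : List (LieGL F m)) : IsArchSmooth (wordDeriv w f) := by
  induction w with
  | nil => exact hf
  | cons X w ih => exact ih.lieDeriv X

theorem wordDeriv_append (w w' : List (LieGL F m)) (f : GLm m (𝔸 F) → ℂ) :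
    wordDeriv (w ++ w') f = wordDeriv w (wordDeriv w' f) := by
  simp [wordDeriv]

theorem wordDeriv_sum_mul {ι : Type*} (s : Finset ι) (c : ι → ℂ) {f : ι → GLm m (𝔸 F) → ℂ}
    (hf : ∀ i, IsArchSmooth (f i)) (w : List (LieGL F m)) :
    wordDeriv w (fun g => ∑ i ∈ s, c i * f i g) = fun g => ∑ i ∈ s, c i * wordDeriv w (f i) g := by
  induction w with
  | nil => rfl
  | cons X w ih =>
    change AdelicPeriods.lieDeriv X (AdelicPeriods.wordDeriv w _) = _
    rw [ih, lieDeriv_sum_mul s c (fun i => (hf i).wordDeriv w)]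
    rfl

/-- Uniform moderate growth for the powers of all `Z` in a bounded set. -/
theorem exists_bound_wordDeriv_replicate {f : GLm m (𝔸 F) → ℂ} (hf : IsArchSmooth f)
    {H : GLm m (𝔸 F) → ℝ} (hfH : ∀ w : List (LieGL F m), ∃ C : ℝ, ∀ g, ‖wordDeriv w f g‖ ≤ C * H g)
    {ι : Type*} [Fintype ι] (b : Module.Basis ι ℝ (LieGL F m)) (c : ℝ) (q : ℕ) :
    ∀ w : List (LieGL F m), ∃ C : ℝ, ∀ Z : LieGL F m, (∀ i, |b.repr Z i| ≤ c) →
      ∀ g, ‖wordDeriv (List.replicate q Z ++ w) f g‖ ≤ C * H g := by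
  induction q with
  | zero =>
    intro w
    obtain ⟨C, hC⟩ := hfH w
    exact ⟨C, fun Z _ g => by simpa using hC g⟩
  | succ q ih =>
    intro w
    choose C hC using fun i => ih (b i :: w)
    refine ⟨∑ i, c * C i, fun Z hZ g => ?_⟩
    have h1 : wordDeriv (List.replicate (q + 1) Z ++ w) f g =
        ∑ i, (b.repr Z i : ℂ) * wordDeriv (List.replicate q Z ++ (b i :: w)) f g := by
      rw [List.replicate_succ', List.append_assoc, wordDeriv_append]
      have h2 : wordDeriv ([Z] ++ w) f = fun g => ∑ i, (b.repr Z i : ℂ) * wordDeriv (b i :: w) f g := by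
        funext g
        have h3 := (hf.wordDeriv w).lieDeriv_sum_smul Finset.univ (fun i => b.repr Z i) b g
        rw [b.sum_repr] at h3
        exact h3
      rw [h2, wordDeriv_sum_mul _ _ fun i => hf.wordDeriv _]
      simp only [wordDeriv_append]
    rw [h1, Finset.sum_mul]
    refine (norm_sum_le _ _).trans (Finset.sum_le_sum fun i _ => ?_)
    rw [norm_mul, Complex.norm_real, Real.norm_eq_abs, mul_assoc]
    exact mul_le_mul (hZ i) (hC i Z hZ g) (norm_nonneg _) ((abs_nonneg _).trans (hZ i))

/-! ### One-parameter subgroups `1 + s Z` with `Z ^ 2 = 0` -/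

theorem isUnit_one_add_of_sq {Z : LieGL F m} (hZ : Z * Z = 0) (s : ℝ) :
    IsUnit (1 + s • Z) := by
  refine IsUnit.of_mul_eq_one (1 - s • Z) ?_
  rw [add_mul, one_mul, mul_sub, mul_one, smul_mul_smul_comm, hZ, smul_zero]
  abel

theorem oneAdd_add_of_sq {Z : LieGL F m} (hZ : Z * Z = 0) (s t : ℝ) :
    oneAdd ((s + t) • Z) = oneAdd (s • Z) * oneAdd (t • Z) := by
  rw [oneAdd_mul (isUnit_one_add_of_sq hZ s) (isUnit_one_add_of_sq hZ t), add_mul, one_mul,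
    smul_mul_smul_comm, hZ, smul_zero, add_zero, add_smul]

theorem IsArchSmooth.contDiff_of_sq {f : GLm m (𝔸 F) → ℂ} (hf : IsArchSmooth f) {Z : LieGL F m}
    (hZ : Z * Z = 0) (g : GLm m (𝔸 F)) :
    ContDiff ℝ ∞ fun s : ℝ => f (g * oneAdd (s • Z)) := by
  refine contDiff_iff_contDiffAt.2 fun s₀ => ?_
  have h1 : (fun s : ℝ => f (g * oneAdd (s • Z))) =
      fun s => (fun Y : Fin m → Fin m → E F => f (g * oneAdd (s₀ • Z) * archOneAdd Y))
        ((s - s₀) • toFn Z) := by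
    funext s
    have h2 : oneAdd (s • Z) = oneAdd (s₀ • Z) * archOneAdd ((s - s₀) • toFn Z) := by
      have h3 := oneAdd_add_of_sq hZ s₀ (s - s₀)
      rw [add_sub_cancel] at h3
      exact h3
    simp only [h2, mul_assoc]
  rw [h1]
  refine ContDiffAt.comp s₀ (g := fun Y : Fin m → Fin m → E F =>
    f (g * oneAdd (s₀ • Z) * archOneAdd Y)) ?_ ?_
  · rw [sub_self, zero_smul]
    exact hf _
  · exact ((contDiff_id.sub contDiff_const).smul contDiff_const).contDiffAt

theorem iteratedDeriv_eq_wordDeriv {f : GLm m (𝔸 F) → ℂ} {Z : LieGL F m}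
    (hZ : Z * Z = 0) (g : GLm m (𝔸 F)) (q : ℕ) :
    iteratedDeriv q (fun s : ℝ => f (g * oneAdd (s • Z))) =
      fun s => wordDeriv (List.replicate q Z) f (g * oneAdd (s • Z)) := by
  induction q with
  | zero => rw [iteratedDeriv_zero]; rfl
  | succ q ih =>
    rw [iteratedDeriv_succ, ih]
    funext s
    rw [List.replicate_succ]
    change _ = lieDeriv Z (wordDeriv (List.replicate q Z) f) _
    rw [lieDeriv_def]
    have h1 : (fun t : ℝ => wordDeriv (List.replicate q Z) f
        (g * oneAdd (s • Z) * oneAdd (t • Z))) =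
        fun t => (fun u : ℝ => wordDeriv (List.replicate q Z) f
          (g * oneAdd (u • Z))) (s + t) := by
      funext t
      simp only
      rw [oneAdd_add_of_sq hZ, mul_assoc]
    rw [h1, deriv_comp_const_add (f := fun u : ℝ => wordDeriv (List.replicate q Z) f
          (g * oneAdd (u • Z))), add_zero]

/-- Functions that are smooth in the archimedean variable and right invariant under an open
subgroup at the finite places are continuous. -/
theorem IsAutomorphicForm.continuous {f : GLm m (𝔸 F) → ℂ} (hf : IsAutomorphicForm f) :
    Continuous f := by
  obtain ⟨U, hU, hUf⟩ := hf.finite_smooth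
  refine continuous_iff_continuousAt.2 fun g => ?_
  have h1 : ContinuousAt (fun X : Fin m → Fin m → E F => f (g * archOneAdd X)) 0 :=
    (hf.arch_smooth g).continuousAt
  -- the coordinate `X` of `g⁻¹ h`
  let X : GLm m (𝔸 F) → (Fin m → Fin m → E F) := fun h =>
    ((archPart (g⁻¹ * h)).val - 1 : Matrix (Fin m) (Fin m) (E F))
  have hX : ContinuousAt X g := by
    refine Continuous.continuousAt ?_
    have : Continuous fun h => (archPart (g⁻¹ * h)).val :=
      Units.continuous_val.comp (continuous_archPart.comp (continuous_const_mul _))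
    exact this.sub continuous_const
  have hXg : X g = 0 := by
    change (archPart (g⁻¹ * g)).val - 1 = 0
    rw [inv_mul_cancel, map_one, Units.val_one, sub_self]
  have h2 : ContinuousAt (fun h => f (g * archOneAdd (X h))) g := by
    refine ContinuousAt.comp (g := fun X : Fin m → Fin m → E F => f (g * archOneAdd X)) ?_ hX
    rw [hXg]
    exact h1
  refine h2.congr ?_
  have h3 : ContinuousAt (fun h => finGL (finPart (g⁻¹ * h))) g :=
    (continuous_finGL.comp (continuous_finPart.comp (continuous_const_mul _))).continuousAt
  have h4 : ∀ᶠ h in 𝓝 g, finGL (finPart (g⁻¹ * h)) ∈ U := by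
    refine h3 ?_
    simp only [inv_mul_cancel, map_one]
    exact hU
  filter_upwards [h4] with h hh
  have h5 : archOneAdd (X h) = archGL (archPart (g⁻¹ * h)) := by
    refine archOneAdd_eq ?_
    change _ = 1 + ((archPart (g⁻¹ * h)).val - 1)
    rw [add_sub_cancel]
  have h6 : h = g * archOneAdd (X h) * finGL (finPart (g⁻¹ * h)) := by
    rw [h5, mul_assoc, arch_mul_fin, mul_inv_cancel_left]
  conv_rhs => rw [h6]
  refine (hUf _ hh (fun i j => ?_) _).symm
  have h7 := congrArg (fun a : GLm m (E F) => a.val i j)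
    (archPart_finGL (F := F) (finPart (g⁻¹ * h)))
  have h8 : archProj F ((finGL (finPart (g⁻¹ * h)) : GLm m (𝔸 F)).val i j) =
      archProj F ((1 : Matrix (Fin m) (Fin m) (𝔸 F)) i j) := by
    refine h7.trans ?_
    simp only [Units.val_one, Matrix.one_apply]
    split_ifs <;> simp
  exact (InfiniteAdeleRing.ringEquiv_mixedSpace F).injective h8

end

section

/-! ### Unipotent radicals of maximal parabolic subgroups -/

section Unipotent

variable {m : ℕ} (k : ℕ) {R S : Type*} [CommRing R] [CommRing S]

/-- The upper right block of a matrix, for the block decomposition `m = k + (m - k)`. -/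
def nilPart (x : Matrix (Fin m) (Fin m) R) : Matrix (Fin m) (Fin m) R :=
  Matrix.of fun i j => if (i : ℕ) < k ∧ k ≤ (j : ℕ) then x i j else 0

theorem nilPart_apply (x : Matrix (Fin m) (Fin m) R) (i j : Fin m) :
    nilPart k x i j = if (i : ℕ) < k ∧ k ≤ (j : ℕ) then x i j else 0 := rfl

theorem nilPart_mul_nilPart (x y : Matrix (Fin m) (Fin m) R) : nilPart k x * nilPart k y = 0 := by
  refine Matrix.ext fun i j => ?_
  rw [Matrix.mul_apply]
  refine Finset.sum_eq_zero fun l _ => ?_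
  rw [nilPart_apply, nilPart_apply]
  split_ifs with h1 h2
  · omega
  · simp
  · simp
  · simp

theorem nilPart_add (x y : Matrix (Fin m) (Fin m) R) :
    nilPart k (x + y) = nilPart k x + nilPart k y := by
  refine Matrix.ext fun i j => ?_
  simp only [nilPart_apply, Matrix.add_apply]
  split_ifs <;> simp

theorem nilPart_map (f : R →+* S) (x : Matrix (Fin m) (Fin m) R) :
    nilPart k (x.map f) = (nilPart k x).map f := by
  refine Matrix.ext fun i j => ?_
  simp only [nilPart_apply, Matrix.map_apply]
  split_ifs <;> simp

/-- The block matrix `(1 x; 0 1)`. -/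
def uni (x : Matrix (Fin m) (Fin m) R) : GLm m R where
  val := 1 + nilPart k x
  inv := 1 - nilPart k x
  val_inv := by rw [mul_sub, add_mul, add_mul, nilPart_mul_nilPart]; simp
  inv_val := by rw [mul_add, sub_mul, sub_mul, nilPart_mul_nilPart]; simp

theorem uni_val (x : Matrix (Fin m) (Fin m) R) : (uni k x).val = 1 + nilPart k x := rfl

theorem uni_add (x y : Matrix (Fin m) (Fin m) R) : uni k (x + y) = uni k x * uni k y := by
  refine Units.ext ?_
  rw [Units.val_mul, uni_val, uni_val, uni_val, nilPart_add, add_mul, one_mul, mul_add, mul_one,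
    nilPart_mul_nilPart, add_zero]
  abel

theorem uni_zero : uni k (0 : Matrix (Fin m) (Fin m) R) = 1 := by
  refine Units.ext (Matrix.ext fun i j => ?_)
  simp [uni_val, nilPart_apply]

theorem map_uni (f : R →+* S) (x : Matrix (Fin m) (Fin m) R) :
    Matrix.GeneralLinearGroup.map f (uni k x) = uni k (x.map f) := by
  refine Units.ext ?_
  rw [uni_val, nilPart_map]
  refine Matrix.ext fun i j => ?_
  simp only [uni_val, Matrix.GeneralLinearGroup.map_apply, Matrix.add_apply, Matrix.map_apply,
    map_add, Matrix.one_apply]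
  split_ifs <;> simp

theorem uni_mem (x : Matrix (Fin m) (Fin m) R) : uni k x ∈ unipotentRadical m k R := by
  intro i j hij
  rw [uni_val, Matrix.add_apply, nilPart_apply, if_neg hij, add_zero]

theorem uni_of_mem {u : GLm m R} (hu : u ∈ unipotentRadical m k R) : uni k u.val = u := by
  refine Units.ext (Matrix.ext fun i j => ?_)
  rw [uni_val, Matrix.add_apply, nilPart_apply]
  split_ifs with h
  · have : i ≠ j := by rintro rfl; omega
    rw [Matrix.one_apply_ne this, zero_add]
  · rw [add_zero]
    exact (hu i j h).symm

theorem continuous_uni [TopologicalSpace R] [IsTopologicalRing R] :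
    Continuous (uni k : Matrix (Fin m) (Fin m) R → GLm m R) := by
  have h1 : Continuous (nilPart k : Matrix (Fin m) (Fin m) R → Matrix (Fin m) (Fin m) R) := by
    refine continuous_matrix fun i j => ?_
    by_cases h : (i : ℕ) < k ∧ k ≤ (j : ℕ)
    · simp only [nilPart_apply, if_pos h]
      exact continuous_id.matrix_elem i j
    · simp only [nilPart_apply, if_neg h]
      exact continuous_const
  exact Units.continuous_iff.2 ⟨continuous_const.add h1, continuous_const.sub h1⟩

end Unipotent

variable {m : ℕ} {k : ℕ}

theorem archPart_uni (x : Matrix (Fin m) (Fin m) (𝔸 F)) :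
    archPart (uni k x) = uni k (x.map (archProj F)) := map_uni k _ x

theorem finPart_uni (x : Matrix (Fin m) (Fin m) (𝔸 F)) :
    finPart (uni k x) = uni k (x.map (finProj F)) := map_uni k _ x

theorem isCompact_intMat : IsCompact {A : Matrix (Fin m) (Fin m) (Af F) | IntMat A} := by
  have := isCompact_univ_pi (fun _ : Fin m => isCompact_univ_pi
    (fun _ : Fin m => isCompact_intAdeles (F := F)))
  convert! this using 1
  ext A
  change (∀ i j, A i j ∈ _) ↔ ∀ i, _ → ∀ j, _ → A i j ∈ _
  simp

/-- Right invariance under small unipotent matrices at the finite places, uniformly for `κ` in a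
compact set. -/
theorem IsAutomorphicForm.exists_invariance {f : GLm m (𝔸 F) → ℂ} (hf : IsAutomorphicForm f)
    (k : ℕ) {C : Set (GLm m (𝔸 F))} (hC : IsCompact C) :
    ∃ M : 𝓞 F, M ≠ 0 ∧ ∀ κ ∈ C, ∀ z : Matrix (Fin m) (Fin m) (Af F), IntMat z →
      ∀ h, f (h * finGL (uni k (algebraMap F (Af F) M • z)) * κ) = f (h * κ) := by
  obtain ⟨U, hU, hUf⟩ := hf.finite_smooth
  let T : (GLm m (𝔸 F) × Matrix (Fin m) (Fin m) (Af F)) × Af F → GLm m (𝔸 F) := fun p =>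
    p.1.1⁻¹ * finGL (uni k (p.2 • p.1.2)) * p.1.1
  have hT : Continuous T := by
    have h1 : Continuous fun p : (GLm m (𝔸 F) × Matrix (Fin m) (Fin m) (Af F)) × Af F =>
        finGL (uni k (p.2 • p.1.2)) :=
      continuous_finGL.comp ((continuous_uni k).comp
        (continuous_snd.smul (continuous_snd.comp continuous_fst)))
    have h2 : Continuous fun p : (GLm m (𝔸 F) × Matrix (Fin m) (Fin m) (Af F)) × Af F => p.1.1 :=
      continuous_fst.comp continuous_fst
    exact (h2.inv.mul h1).mul h2
  obtain ⟨u, v, -, hv, hu', hv', huv⟩ := generalized_tube_lemma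
    (hC.prod (isCompact_intMat (F := F) (m := m))) (isCompact_singleton (x := (0 : Af F)))
    (isOpen_interior.preimage hT : IsOpen (T ⁻¹' interior U)) (by
      rintro ⟨⟨κ, z⟩, a⟩ ⟨-, ha⟩
      obtain rfl : a = 0 := ha
      simp only [Set.mem_preimage, T, zero_smul, uni_zero, map_one, mul_one, inv_mul_cancel]
      exact mem_interior_iff_mem_nhds.2 hU)
  obtain ⟨M, hM, hMv⟩ := exists_int_mul_mem_of_nhds (hv.mem_nhds (hv' rfl))
  refine ⟨M, hM, fun κ hκ z hz h => ?_⟩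
  have hmem : T ((κ, z), algebraMap F (Af F) M) ∈ U := by
    refine interior_subset (huv (Set.mk_mem_prod (hu' ⟨hκ, hz⟩) ?_))
    simpa using hMv 1 (one_mem _)
  have harch : archPart (T ((κ, z), algebraMap F (Af F) M)) = 1 := by
    simp only [T, map_mul, map_inv, archPart_finGL, mul_one, inv_mul_cancel]
  have h1 := hUf _ hmem (fun i j => by
    have h7 := congrArg (fun a : GLm m (E F) => a.val i j) harch
    have h8 : archProj F ((T ((κ, z), algebraMap F (Af F) M)).val i j) =
        archProj F ((1 : Matrix (Fin m) (Fin m) (𝔸 F)) i j) := by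
      refine h7.trans ?_
      simp only [Units.val_one, Matrix.one_apply]
      split_ifs <;> simp
    exact (InfiniteAdeleRing.ringEquiv_mixedSpace F).injective h8) (h * κ)
  rw [← h1]
  congr 1
  simp only [T]
  group

/-! ### A relatively compact set of representatives for adelic unipotent groups -/

/-- The adeles whose archimedean component lies in the unit box of the basis of `𝓞 F`, and whose
finite component is integral. -/
def unitBox (F : Type*) [Field F] [NumberField F] : Set (𝔸 F) :=
  {x | (∀ a, (latB F).repr (archProj F x) a ∈ Set.Icc (0 : ℝ) 1) ∧ finProj F x ∈ intAdeles F}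

theorem isCompact_unitBox : IsCompact (unitBox F) := by
  let e := (latB F).equivFunL
  have h1 : IsCompact (e ⁻¹' Set.pi Set.univ fun _ => Set.Icc (0 : ℝ) 1) := by
    have h := (isCompact_univ_pi fun _ : Fin (Module.finrank ℚ F) =>
      (isCompact_Icc : IsCompact (Set.Icc (0 : ℝ) 1))).image e.symm.continuous
    rwa [e.symm.image_eq_preimage_symm] at h
  have h2 := (h1.prod (isCompact_intAdeles (F := F))).image continuous_adeleEquiv
  convert! h2 using 1
  ext x
  constructor
  · rintro ⟨h3, h4⟩
    exact ⟨(archProj F x, finProj F x), ⟨fun a _ => h3 a, h4⟩, adeleEquiv_proj x⟩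
  · rintro ⟨⟨a, b⟩, ⟨h3, h4⟩, rfl⟩
    refine ⟨fun i => ?_, ?_⟩
    · rw [archProj_adeleEquiv]; exact h3 i trivial
    · rw [finProj_adeleEquiv]; exact h4

/-- `𝔸 = F + unitBox F`: strong approximation at the finite places, then translation by `𝓞 F` at the
archimedean ones. -/
theorem exists_add_mem_unitBox (x : 𝔸 F) : ∃ a : F, algebraMap F (𝔸 F) a + x ∈ unitBox F := by
  obtain ⟨a, ha⟩ := exists_sub_mem_intAdeles (finProj F x)
  set y := x - algebraMap F (𝔸 F) a with hy
  set b : 𝓞 F := ∑ i, ⌊(latB F).repr (archProj F y) i⌋ • intBasis F i with hb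
  have hb' : mixedEmbedding F (b : F) =
      ∑ i, (⌊(latB F).repr (archProj F y) i⌋ : ℝ) • latB F i := by
    rw [hb]
    simp only [map_sum, map_zsmul, latB_apply, Int.cast_smul_eq_zsmul]
  refine ⟨-a - b, ?_, ?_⟩
  · intro i
    have h1 : archProj F (algebraMap F (𝔸 F) (-a - b) + x) = archProj F y - mixedEmbedding F b := by
      simp only [hy, map_add, map_sub, map_neg, archProj_algebraMap]
      abel
    rw [h1, map_sub, Finsupp.sub_apply, hb', Module.Basis.repr_sum_self]
    exact ⟨Int.fract_nonneg _, (Int.fract_lt_one _).le⟩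
  · have h1 : finProj F (algebraMap F (𝔸 F) (-a - b) + x) =
        (finProj F x - algebraMap F (Af F) a) - algebraMap F (Af F) (b : F) := by
      simp only [map_add, map_sub, map_neg, finProj_algebraMap]
      abel
    rw [h1]
    exact sub_mem ha (algebraMap_int_mem b)

theorem exists_add_mem_mul_unitBox (x : 𝔸 F) {M : F} (hM : M ≠ 0) :
    ∃ a : F, ∃ y ∈ unitBox F, algebraMap F (𝔸 F) a + x = algebraMap F (𝔸 F) M * y := by
  obtain ⟨a, ha⟩ := exists_add_mem_unitBox (algebraMap F (𝔸 F) M⁻¹ * x)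
  refine ⟨M * a, _, ha, ?_⟩
  rw [mul_add, ← mul_assoc, ← map_mul, ← map_mul, mul_inv_cancel₀ hM, map_one, one_mul]

/-- The block matrices `(1 x; 0 1)` as elements of the unipotent radical. -/
def uniRad (k : ℕ) (x : Matrix (Fin m) (Fin m) (𝔸 F)) : unipotentRadical m k (𝔸 F) :=
  ⟨uni k x, uni_mem k x⟩

/-- For `M ≠ 0`, a compact subset of `U(𝔸)` that meets every orbit of `U(F)`. The factor `M` makes
its finite components as divisible as a given level requires. -/
def uniBox (m k : ℕ) (M : F) : Set (unipotentRadical m k (𝔸 F)) :=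
  (fun y : Matrix (Fin m) (Fin m) (𝔸 F) => uniRad k (algebraMap F (𝔸 F) M • y)) ''
    {y | ∀ i j, y i j ∈ unitBox F}

theorem isCompact_uniBox (M : F) : IsCompact (uniBox m k M) := by
  have h1 : IsCompact {y : Matrix (Fin m) (Fin m) (𝔸 F) | ∀ i j, y i j ∈ unitBox F} := by
    have := isCompact_univ_pi (fun _ : Fin m => isCompact_univ_pi
      (fun _ : Fin m => isCompact_unitBox (F := F)))
    convert! this using 1
    ext A
    change (∀ i j, A i j ∈ _) ↔ ∀ i, _ → ∀ j, _ → A i j ∈ _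
    simp
  refine h1.image ?_
  exact Continuous.subtype_mk ((continuous_uni k).comp (continuous_const_smul _)) _

theorem exists_mul_mem_uniBox (u : unipotentRadical m k (𝔸 F)) {M : F} (hM : M ≠ 0) :
    ∃ γ ∈ rationalUnipotent F m k, γ * u ∈ uniBox m k M := by
  choose a y hy hay using fun i j => exists_add_mem_mul_unitBox ((u : GLm m (𝔸 F)).val i j) hM
  refine ⟨uniRad k ((Matrix.of a).map (algebraMap F (𝔸 F))), ?_, Matrix.of y, hy, ?_⟩
  · refine Subgroup.mem_subgroupOf.2 ⟨uni k (Matrix.of a), ?_⟩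
    exact map_uni k _ _
  · refine Subtype.ext ?_
    have h1 : (algebraMap F (𝔸 F) M • Matrix.of y) =
        (Matrix.of a).map (algebraMap F (𝔸 F)) + (u : GLm m (𝔸 F)).val := by
      refine Matrix.ext fun i j => ?_
      exact (hay i j).symm
    change uni k _ = uni k _ * (u : GLm m (𝔸 F))
    rw [h1, uni_add, uni_of_mem k u.2]

theorem isClosed_unipotentRadical :
    IsClosed (unipotentRadical m k (𝔸 F) : Set (GLm m (𝔸 F))) := by
  have : (unipotentRadical m k (𝔸 F) : Set (GLm m (𝔸 F))) =
      ⋂ i, ⋂ j, ⋂ (_ : ¬ ((i : Fin m) < k ∧ k ≤ ((j : Fin m) : ℕ))),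
        {g : GLm m (𝔸 F) | g.val i j = (1 : Matrix (Fin m) (Fin m) (𝔸 F)) i j} := by
    ext g
    simp only [Set.mem_iInter]
    rfl
  rw [this]
  refine isClosed_iInter fun i => isClosed_iInter fun j => isClosed_iInter fun _ => ?_
  exact isClosed_eq (Units.continuous_val.matrix_elem i j) continuous_const

instance : LocallyCompactSpace (unipotentRadical m k (𝔸 F)) :=
  isClosed_unipotentRadical.isClosedEmbedding_subtypeVal.locallyCompactSpace

instance : SecondCountableTopology (unipotentRadical m k (𝔸 F)) :=
  inferInstanceAs (SecondCountableTopology (unipotentRadical m k (𝔸 F) : Set (GLm m (𝔸 F))))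

/-- If a cusp form varies by at most `B` on the compact set of representatives of `U(F) \ U(𝔸)`
then it is bounded by `B`, since its mean value is zero. -/
theorem IsCuspForm.norm_le_of_oscillation {Φ : GLm m (𝔸 F) → ℂ} (hΦ : IsCuspForm Φ)
    (hk : 0 < k) (hkm : k < m) {M : F} (hM : M ≠ 0) (g : GLm m (𝔸 F)) {B : ℝ}
    (hB : ∀ u ∈ uniBox m k M, ‖Φ g - Φ (u * g)‖ ≤ B) : ‖Φ g‖ ≤ B := by
  set U := unipotentRadical m k (𝔸 F)
  set Γ := rationalUnipotent F m k with hΓ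
  let du : Measure U := Measure.haar
  have hcount : Countable Γ := by
    have : Function.Injective fun γ : Γ => (⟨((γ : U) : GLm m (𝔸 F)),
        Subgroup.mem_subgroupOf.1 γ.2⟩ : rationalGL F m) := by
      intro γ δ h
      exact Subtype.ext (Subtype.ext (congrArg (fun x : rationalGL F m => (x : GLm m (𝔸 F))) h))
    exact this.countable
  have hdisc : ∃ V ∈ 𝓝 (1 : U), ∀ γ ∈ Γ, γ ∈ V → γ = 1 := by
    obtain ⟨V, hV, hV'⟩ := exists_nhds_rationalGL (F := F) m
    refine ⟨Subtype.val ⁻¹' V, continuous_subtype_val.continuousAt hV, fun γ hγ hγV => ?_⟩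
    exact Subtype.ext (hV' _ (Subgroup.mem_subgroupOf.1 hγ) hγV)
  obtain ⟨𝓕, h𝓕m, h𝓕⟩ := exists_fundamentalSet Γ hdisc
  have h𝓕' : IsFundamentalDomain Γ 𝓕 du := isFundamentalDomain_of_existsUnique h𝓕m h𝓕
  have hinv : ∀ γ ∈ Γ, ∀ u : U, Φ ((γ * u : U) * g) = Φ (u * g) := by
    intro γ hγ u
    rw [Subgroup.coe_mul, mul_assoc]
    exact hΦ.left_invariant _ (Subgroup.mem_subgroupOf.1 hγ) _
  have hcont : Continuous fun u : U => Φ (u * g) :=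
    hΦ.toIsAutomorphicForm.continuous.comp (continuous_subtype_val.mul continuous_const)
  have hfin : du 𝓕 ≠ ⊤ := by
    have h1 := lintegral_fundamentalDomain_le h𝓕' (ι := Unit) (S := fun _ => uniBox m k M)
      (fun _ => (isCompact_uniBox M).isClosed.measurableSet)
      (fun u => ⟨(), exists_mul_mem_uniBox u hM⟩) (f := fun _ => 1) (fun _ _ _ => rfl)
      measurable_const
    simp only [lintegral_const, Measure.restrict_apply MeasurableSet.univ, Set.univ_inter,
      one_mul, tsum_fintype, Finset.univ_unique, Finset.sum_singleton] at h1
    exact (h1.trans_lt (isCompact_uniBox M).measure_lt_top).ne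
  have hpos : du 𝓕 ≠ 0 := h𝓕'.measure_ne_zero (NeZero.ne du)
  have hosc : ∀ u : U, ‖Φ g - Φ (u * g)‖ ≤ B := by
    intro u
    obtain ⟨γ, hγ, hmem⟩ := exists_mul_mem_uniBox u hM
    rw [← hinv γ hγ u]
    exact hB _ hmem
  have hint : IntegrableOn (fun u : U => Φ (u * g)) 𝓕 du := by
    have hfm : IsFiniteMeasure (du.restrict 𝓕) := ⟨by
      rw [Measure.restrict_apply MeasurableSet.univ, Set.univ_inter]; exact hfin.lt_top⟩
    refine Integrable.of_bound hcont.aestronglyMeasurable (‖Φ g‖ + B)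
      (Filter.Eventually.of_forall fun u => ?_)
    have h1 := norm_sub_norm_le (Φ (u * g)) (Φ g)
    have h2 := hosc u
    rw [norm_sub_rev] at h2
    linarith
  have h0 : ∫ u in 𝓕, Φ (u * g) ∂du = 0 := by
    have h1 := hΦ.cuspidal k hk hkm du g
    rw [quotientIntegral_eq h𝓕' hinv hcont.measurable] at h1
    exact h1
  have hconst : IntegrableOn (fun _ : U => Φ g) 𝓕 du := integrableOn_const hfin
  have h1 : ∫ u in 𝓕, (Φ g - Φ (u * g)) ∂du = (du.real 𝓕) • Φ g := by
    rw [integral_sub hconst hint, h0, sub_zero, setIntegral_const]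
  have h2 : ‖∫ u in 𝓕, (Φ g - Φ (u * g)) ∂du‖ ≤ B * du.real 𝓕 :=
    norm_setIntegral_le_of_norm_le_const hfin.lt_top fun u _ => hosc u
  have h3 : 0 < du.real 𝓕 := ENNReal.toReal_pos hpos hfin
  rw [h1, norm_smul, Real.norm_eq_abs, abs_of_pos h3, mul_comm] at h2
  exact le_of_mul_le_mul_right h2 h3

end

section

open scoped Classical

/-! ### Heights and conjugation on the diagonal torus -/

variable {m : ℕ} {k : ℕ}

theorem height_nonneg (g : GLm m (𝔸 F)) : 0 ≤ height g := by
  refine mul_nonneg (Finset.prod_nonneg fun v _ => pow_nonneg (Real.iSup_nonneg fun p => ?_) _)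
    (finprod_nonneg fun v => Real.iSup_nonneg fun p => ?_)
  · exact le_max_of_le_left (norm_nonneg _)
  · exact le_max_of_le_left (norm_nonneg _)

theorem norm_mul_apply_le {A B : Matrix (Fin m) (Fin m) (E F)} {a b : ℝ}
    (hA : ∀ i j, ‖A i j‖ ≤ a) (hB : ∀ i j, ‖B i j‖ ≤ b) (i j : Fin m) :
    ‖(A * B) i j‖ ≤ m * (a * b) := by
  rw [Matrix.mul_apply]
  refine (norm_sum_le _ _).trans ?_
  refine (Finset.sum_le_sum (g := fun _ => a * b) fun l _ => ?_).trans (by simp)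
  exact (norm_mul_le _ _).trans
    (mul_le_mul (hA i l) (hB l j) (norm_nonneg _) ((norm_nonneg _).trans (hA i l)))

theorem norm_diagonal_apply_le {t : Fin m → ℝ} {R : ℝ} (hR : 0 ≤ R) (h : ∀ i, |t i| ≤ R)
    (i j : Fin m) :
    ‖Matrix.diagonal (fun i => algebraMap ℝ (E F) (t i)) i j‖ ≤ R * ‖(1 : E F)‖ := by
  by_cases hij : i = j
  · subst hij
    rw [Matrix.diagonal_apply_eq, norm_algebraMap, Real.norm_eq_abs]
    exact mul_le_mul_of_nonneg_right (h i) (norm_nonneg _)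
  · rw [Matrix.diagonal_apply_ne _ hij, norm_zero]
    positivity

theorem exists_norm_le_of_isCompact {C : Set (GLm m (𝔸 F))} (hC : IsCompact C) :
    ∃ K : ℝ, 0 ≤ K ∧ ∀ κ ∈ C, (∀ i j, ‖(archPart κ).val i j‖ ≤ K) ∧
      ∀ i j, ‖(archPart κ⁻¹).val i j‖ ≤ K := by
  have h1 : Continuous fun κ : GLm m (𝔸 F) =>
      ∑ i, ∑ j, (‖(archPart κ).val i j‖ + ‖(archPart κ⁻¹).val i j‖) := by
    refine continuous_finsetSum _ fun i _ => continuous_finsetSum _ fun j _ => ?_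
    refine Continuous.add ?_ ?_
    · exact ((Units.continuous_val.comp continuous_archPart).matrix_elem i j).norm
    · exact ((Units.continuous_val.comp (continuous_archPart.comp continuous_inv)).matrix_elem
        i j).norm
  obtain ⟨K, hK⟩ := (hC.image h1).bddAbove
  have h2 : ∀ κ ∈ C, ∀ i j, ‖(archPart κ).val i j‖ + ‖(archPart κ⁻¹).val i j‖ ≤ max K 0 := by
    intro κ hκ i j
    refine le_trans ?_ ((hK ⟨κ, hκ, rfl⟩).trans (le_max_left _ _))
    refine le_trans ?_ (Finset.single_le_sum (fun i _ => ?_) (Finset.mem_univ i))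
    · exact Finset.single_le_sum (f := fun j => ‖(archPart κ).val i j‖ + ‖(archPart κ⁻¹).val i j‖)
        (fun j _ => by positivity) (Finset.mem_univ j)
    · exact Finset.sum_nonneg fun j _ => by positivity
  refine ⟨max K 0, le_max_right _ _, fun κ hκ => ⟨fun i j => ?_, fun i j => ?_⟩⟩
  · linarith [h2 κ hκ i j, norm_nonneg ((archPart κ⁻¹).val i j)]
  · linarith [h2 κ hκ i j, norm_nonneg ((archPart κ).val i j)]

/-- The height on `C₁ A C₂`, for compact `C₁`, `C₂` and the diagonal torus `A`. -/
theorem exists_height_le {C₁ C₂ : Set (GLm m (𝔸 F))} (hC₁ : IsCompact C₁) (hC₂ : IsCompact C₂) :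
    ∃ K : ℝ, 0 ≤ K ∧ ∀ (t : Fin m → ℝˣ) (R : ℝ), 0 ≤ R → (∀ i, |(t i : ℝ)| ≤ R) →
      (∀ i, |((t i)⁻¹ : ℝ)| ≤ R) → ∀ κ₁ ∈ C₁, ∀ κ₂ ∈ C₂,
        height (κ₁ * archGL (archDiag t) * κ₂) ≤ K * R ^ Module.finrank ℚ F := by
  obtain ⟨K₁, hK₁, h₁⟩ := exists_norm_le_of_isCompact hC₁
  obtain ⟨K₂, hK₂, h₂⟩ := exists_norm_le_of_isCompact hC₂
  obtain ⟨K₃, h₃⟩ := ((hC₁.mul hC₂).image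
    (continuous_finHeight.comp (continuous_finPart (F := F) (m := m)))).bddAbove
  set L : ℝ := m * ((m * (K₁ * ‖(1 : E F)‖)) * K₂) + m * ((m * (K₂ * ‖(1 : E F)‖)) * K₁)
  have hL : 0 ≤ L := by positivity
  refine ⟨L ^ Module.finrank ℚ F * max K₃ 0, by positivity, ?_⟩
  intro t R hR ht ht' κ₁ hκ₁ κ₂ hκ₂
  have hf : finPart (κ₁ * archGL (archDiag t) * κ₂) = finPart (κ₁ * κ₂) := by simp
  have h := height_le (g := κ₁ * archGL (archDiag t) * κ₂) (S := L * R) (by positivity) ?_ ?_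
  · refine h.trans ?_
    rw [hf, mul_pow, mul_right_comm]
    refine mul_le_mul_of_nonneg_right (mul_le_mul_of_nonneg_left ?_ (by positivity)) (by positivity)
    exact (h₃ ⟨_, Set.mul_mem_mul hκ₁ hκ₂, rfl⟩).trans (le_max_left _ _)
  · intro i j
    rw [map_mul, map_mul, archPart_archGL, Units.val_mul, Units.val_mul]
    refine (norm_mul_apply_le (norm_mul_apply_le (h₁ κ₁ hκ₁).1
      (norm_diagonal_apply_le hR ht)) (h₂ κ₂ hκ₂).1 i j).trans ?_
    have h5 : 0 ≤ (m : ℝ) * ((m * (K₂ * ‖(1 : E F)‖)) * K₁) * R := by positivity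
    calc (m : ℝ) * (m * (K₁ * (R * ‖(1 : E F)‖)) * K₂)
        = m * ((m * (K₁ * ‖(1 : E F)‖)) * K₂) * R := by ring
      _ ≤ L * R := by simp only [L]; linarith
  · intro i j
    rw [mul_inv_rev, mul_inv_rev, map_mul, map_mul, ← map_inv archGL, archPart_archGL,
      ← map_inv archDiag, Units.val_mul, Units.val_mul, ← mul_assoc]
    have h6 : ∀ i, |((t⁻¹ i : ℝˣ) : ℝ)| ≤ R := fun i => by
      rw [Pi.inv_apply, Units.val_inv_eq_inv_val]
      exact ht' i
    refine (norm_mul_apply_le (norm_mul_apply_le (h₂ κ₂ hκ₂).2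
      (norm_diagonal_apply_le hR h6)) (h₁ κ₁ hκ₁).2 i j).trans ?_
    have h5 : 0 ≤ (m : ℝ) * ((m * (K₁ * ‖(1 : E F)‖)) * K₂) * R := by positivity
    calc (m : ℝ) * (m * (K₂ * (R * ‖(1 : E F)‖)) * K₁)
        = m * ((m * (K₂ * ‖(1 : E F)‖)) * K₁) * R := by ring
      _ ≤ L * R := by simp only [L]; linarith

/-- The element `τ⁻¹ X τ` of the Lie algebra. -/
def conjLie (τ : GLm m (𝔸 F)) (X : Matrix (Fin m) (Fin m) (E F)) : LieGL F m :=
  (archPart τ)⁻¹.val * X * (archPart τ).val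

theorem conjLie_mul_self (τ : GLm m (𝔸 F)) (X : Matrix (Fin m) (Fin m) (E F)) :
    conjLie τ (nilPart k X) * conjLie τ (nilPart k X) = 0 := by
  unfold conjLie
  calc _ = (archPart τ)⁻¹.val * nilPart k X * ((archPart τ).val * (archPart τ)⁻¹.val) *
        nilPart k X * (archPart τ).val := by simp only [mul_assoc]
    _ = 0 := by
      rw [Units.mul_inv, mul_one, mul_assoc (archPart τ)⁻¹.val, nilPart_mul_nilPart, mul_zero,
        zero_mul]

theorem nilPart_smul (s : ℝ) (X : Matrix (Fin m) (Fin m) (E F)) :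
    nilPart k (s • X) = s • nilPart k X := by
  refine Matrix.ext fun i j => ?_
  simp only [nilPart_apply, Matrix.smul_apply]
  split_ifs <;> simp

theorem archGL_uni_mul (τ : GLm m (𝔸 F)) (X : Matrix (Fin m) (Fin m) (E F)) (s : ℝ) :
    archGL (uni k (s • X)) * τ = τ * oneAdd (s • conjLie τ (nilPart k X)) := by
  set a := archPart τ with ha
  have h1 : ((a⁻¹ * uni k (s • X) * a : GLm m (E F))).val =
      1 + s • conjLie τ (nilPart k X) := by
    rw [Units.val_mul, Units.val_mul, uni_val, nilPart_smul, mul_add, add_mul, mul_one,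
      Units.inv_mul, mul_smul_comm, smul_mul_assoc]
    rfl
  rw [oneAdd_eq h1]
  refine gl_ext ?_ ?_
  · simp only [map_mul, archPart_archGL, ← ha]
    group
  · simp

theorem conjLie_diag (t : Fin m → ℝˣ) (κ : GLm m (𝔸 F)) (i j : Fin m) (e : E F) :
    conjLie (archGL (archDiag t) * κ) (Matrix.single i j e) =
      ((t j : ℝ) / (t i : ℝ)) • conjLie κ (Matrix.single i j e) := by
  unfold conjLie
  rw [map_mul, archPart_archGL, mul_inv_rev, Units.val_mul, Units.val_mul]
  have h1 : ((archDiag t)⁻¹ : GLm m (E F)).val * Matrix.single i j e * (archDiag t).val =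
      ((t j : ℝ) / (t i : ℝ)) • Matrix.single i j e := by
    rw [← map_inv, archDiag_val, archDiag_val]
    refine Matrix.ext fun a b => ?_
    rw [Matrix.mul_diagonal, Matrix.diagonal_mul, Matrix.smul_apply, Matrix.single_apply]
    split_ifs with h
    · obtain ⟨rfl, rfl⟩ := h
      rw [Pi.inv_apply, Units.val_inv_eq_inv_val, Algebra.smul_def, div_eq_mul_inv, map_mul]
      ring
    · simp
  calc _ = (archPart κ)⁻¹.val * (((archDiag t)⁻¹ : GLm m (E F)).val * Matrix.single i j e *
        (archDiag t).val) * (archPart κ).val := by simp only [mul_assoc]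
    _ = _ := by rw [h1, mul_smul_comm, smul_mul_assoc]

theorem nilPart_single {i j : Fin m} (h : (i : ℕ) < k ∧ k ≤ (j : ℕ)) (e : E F) :
    nilPart k (Matrix.single i j e) = Matrix.single i j e := by
  refine Matrix.ext fun a b => ?_
  rw [nilPart_apply, Matrix.single_apply]
  split_ifs with h1 h2 h2
  · rfl
  · rfl
  · obtain ⟨rfl, rfl⟩ := h2
    exact absurd h h1
  · rfl

theorem exists_conjLie_bound {C : Set (GLm m (𝔸 F))} (hC : IsCompact C)
    {ι : Type*} [Fintype ι] (b : Module.Basis ι ℝ (LieGL F m)) (X : Matrix (Fin m) (Fin m) (E F)) :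
    ∃ c : ℝ, ∀ κ ∈ C, ∀ l, |b.repr (conjLie κ X) l| ≤ c := by
  have h1 : Continuous fun κ : GLm m (𝔸 F) => conjLie κ X := by
    unfold conjLie
    refine Continuous.mul (Continuous.mul ?_ continuous_const) ?_
    · exact Units.continuous_val.comp (continuous_archPart.inv)
    · exact Units.continuous_val.comp continuous_archPart
  have h2 : ∀ l, Continuous fun X : LieGL F m => b.repr X l := fun l =>
    (b.coord l).continuous_of_finiteDimensional
  have h3 : Continuous fun κ : GLm m (𝔸 F) => ∑ l, |b.repr (conjLie κ X) l| :=
    continuous_finsetSum _ fun l _ => ((h2 l).comp h1).abs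
  obtain ⟨c, hc⟩ := (hC.image h3).bddAbove
  refine ⟨c, fun κ hκ l => ?_⟩
  exact (Finset.single_le_sum (f := fun l => |b.repr (conjLie κ X) l|)
    (fun l _ => abs_nonneg _) (Finset.mem_univ l)).trans (hc ⟨κ, hκ, rfl⟩)

end

section

open scoped Classical

/-! ### Decay of cusp forms along one maximal parabolic subgroup -/

variable {m : ℕ} {k : ℕ}

/-- The matrix over `F ⊗ ℝ` with coordinates `c` in the basis of the ideal `(M)` given by the basis
of `𝓞 F`. -/
def boxPt (M : 𝓞 F) (c : Fin m × Fin m × Fin (Module.finrank ℚ F) → ℝ) :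
    Matrix (Fin m) (Fin m) (E F) :=
  Matrix.of fun i j => ∑ b, c (i, j, b) • (mixedEmbedding F M * latB F b)

theorem boxPt_zero (M : 𝓞 F) : boxPt (m := m) M 0 = 0 :=
  Matrix.ext fun i j => by simp [boxPt]

theorem continuous_boxPt (M : 𝓞 F) : Continuous (boxPt (m := m) M) := by
  refine continuous_matrix fun i j => ?_
  change Continuous fun c : Fin m × Fin m × Fin (Module.finrank ℚ F) → ℝ =>
    ∑ b, c (i, j, b) • (mixedEmbedding F M * latB F b)
  exact continuous_finsetSum _ fun b _ => (continuous_apply (i, j, b)).smul continuous_const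

theorem boxPt_update (M : 𝓞 F) (c : Fin m × Fin m × Fin (Module.finrank ℚ F) → ℝ)
    (l : Fin m × Fin m × Fin (Module.finrank ℚ F)) (s : ℝ) :
    boxPt M (Function.update c l s) = boxPt M (Function.update c l 0) +
      s • Matrix.single l.1 l.2.1 (mixedEmbedding F M * latB F l.2.2) := by
  obtain ⟨i, j, b⟩ := l
  refine Matrix.ext fun i' j' => ?_
  simp only [boxPt, Matrix.add_apply, Matrix.of_apply, Matrix.smul_apply, Matrix.single_apply]
  by_cases h : i = i' ∧ j = j'
  · obtain ⟨rfl, rfl⟩ := h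
    rw [if_pos ⟨rfl, rfl⟩, ← Finset.add_sum_erase _ _ (Finset.mem_univ b),
      ← Finset.add_sum_erase (a := b) _ (fun b' => Function.update c (i, j, b) 0 (i, j, b') • _)
        (Finset.mem_univ b), Function.update_self, Function.update_self, zero_smul, zero_add,
      add_comm]
    congr 1
    refine Finset.sum_congr rfl fun b' hb' => ?_
    have : (i, j, b') ≠ (i, j, b) := by simpa using (Finset.mem_erase.1 hb').1
    rw [Function.update_of_ne this, Function.update_of_ne this]
  · rw [if_neg h, smul_zero, add_zero]
    refine Finset.sum_congr rfl fun b' _ => ?_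
    have : (i', j', b') ≠ (i, j, b) := by
      rintro h'
      simp only [Prod.mk.injEq] at h'
      exact h ⟨h'.1.symm, h'.2.1.symm⟩
    rw [Function.update_of_ne this, Function.update_of_ne this]

/-- On the compact set of representatives of `U(F) \ U(𝔸)`, only the archimedean coordinates matter
for a function that is right invariant under the integral points at the finite places. -/
theorem exists_boxPt_of_mem_uniBox {f : GLm m (𝔸 F) → ℂ} {M : 𝓞 F} {κ : GLm m (𝔸 F)}
    (hinv : ∀ z : Matrix (Fin m) (Fin m) (Af F), IntMat z →
      ∀ h, f (h * finGL (uni k (algebraMap F (Af F) M • z)) * κ) = f (h * κ))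
    {u : unipotentRadical m k (𝔸 F)} (hu : u ∈ uniBox m k (M : F)) (a : GLm m (E F)) :
    ∃ c : Fin m × Fin m × Fin (Module.finrank ℚ F) → ℝ, (∀ l, c l ∈ Set.Icc (0 : ℝ) 1) ∧
      f (u * (archGL a * κ)) = f (archGL (uni k (boxPt M c)) * (archGL a * κ)) := by
  obtain ⟨y, hy, rfl⟩ := hu
  refine ⟨fun l => (latB F).repr (archProj F (y l.1 l.2.1)) l.2.2, fun l => (hy _ _).1 _, ?_⟩
  have h1 : (uni k (algebraMap F (𝔸 F) M • y) : GLm m (𝔸 F)) =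
      archGL (uni k (boxPt M fun l => (latB F).repr (archProj F (y l.1 l.2.1)) l.2.2)) *
        finGL (uni k (algebraMap F (Af F) M • y.map (finProj F))) := by
    refine gl_ext ?_ ?_
    · rw [archPart_uni, map_mul, archPart_archGL, archPart_finGL, mul_one]
      congr 1
      refine Matrix.ext fun i j => ?_
      simp only [boxPt, Matrix.map_apply, Matrix.smul_apply, smul_eq_mul, map_mul,
        archProj_algebraMap, Matrix.of_apply]
      simp only [← mul_smul_comm, ← Finset.mul_sum]
      rw [(latB F).sum_repr]
    · rw [finPart_uni, map_mul, finPart_archGL, finPart_finGL, one_mul]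
      congr 1
  change f (uni k (algebraMap F (𝔸 F) M • y) * (archGL a * κ)) = _
  rw [h1]
  have h2 := hinv (y.map (finProj F)) (fun i j => (hy i j).2)
    (archGL (uni k (boxPt M fun l => (latB F).repr (archProj F (y l.1 l.2.1)) l.2.2)) * archGL a)
  refine (congrArg f ?_).trans (h2.trans (congrArg f (mul_assoc _ _ _)))
  rw [mul_assoc (archGL _) (archGL a), commute_archGL_finGL a _]
  simp only [mul_assoc]

/-- The oscillation of an automorphic form in one coordinate of `U`: it is periodic in this
coordinate, and each derivative gives a factor `t_j / t_i`. -/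
theorem IsAutomorphicForm.exists_oscillation {f : GLm m (𝔸 F) → ℂ} (hf : IsAutomorphicForm f)
    {r : ℕ} (hr : ∀ w : List (LieGL F m), ∃ C : ℝ, ∀ g, ‖wordDeriv w f g‖ ≤ C * height g ^ r)
    {C : Set (GLm m (𝔸 F))} (hC : IsCompact C) {M : 𝓞 F}
    (hinv : ∀ κ ∈ C, ∀ z : Matrix (Fin m) (Fin m) (Af F), IntMat z →
      ∀ h, f (h * finGL (uni k (algebraMap F (Af F) M • z)) * κ) = f (h * κ))
    (l : Fin m × Fin m × Fin (Module.finrank ℚ F)) (hl : (l.1 : ℕ) < k ∧ k ≤ (l.2.1 : ℕ)) (q : ℕ) :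
    ∃ B : ℝ, 0 ≤ B ∧ ∀ (t : Fin m → ℝˣ) (R ρ : ℝ), 0 ≤ R → (∀ i, |(t i : ℝ)| ≤ R) →
      (∀ i, |((t i)⁻¹ : ℝ)| ≤ R) → |(t l.2.1 : ℝ) / t l.1| ≤ ρ → ∀ κ ∈ C,
      ∀ c : Fin m × Fin m × Fin (Module.finrank ℚ F) → ℝ, (∀ l, c l ∈ Set.Icc (0 : ℝ) 1) →
      ∀ s ∈ Set.Icc (0 : ℝ) 1,
        ‖f (archGL (uni k (boxPt M c)) * (archGL (archDiag t) * κ)) -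
          f (archGL (uni k (boxPt M (Function.update c l s))) * (archGL (archDiag t) * κ))‖ ≤
          B * ρ ^ (q + 1) * R ^ (Module.finrank ℚ F * r) := by
  set X : Matrix (Fin m) (Fin m) (E F) :=
    Matrix.single l.1 l.2.1 (mixedEmbedding F M * latB F l.2.2) with hX
  have hnX : nilPart k X = X := nilPart_single hl _
  have hC₁ : IsCompact ((fun c => archGL (uni k (boxPt M c))) ''
      (Set.univ.pi fun _ : Fin m × Fin m × Fin (Module.finrank ℚ F) => Set.Icc (0 : ℝ) 1)) :=
    (isCompact_univ_pi fun _ => isCompact_Icc).image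
      (continuous_archGL.comp ((continuous_uni k).comp (continuous_boxPt M)))
  obtain ⟨K, hK, hheight⟩ := exists_height_le hC₁ hC
  let b := Module.finBasis ℝ (LieGL F m)
  obtain ⟨c₀, hc₀⟩ := exists_conjLie_bound hC b X
  obtain ⟨B, hB⟩ := exists_bound_wordDeriv_replicate hf.arch_smooth hr b c₀ (q + 1) []
  refine ⟨max B 0 * K ^ r, by positivity, ?_⟩
  intro t R ρ hR ht ht' hρ κ hκ c hc s hs
  set τ := archGL (archDiag t) * κ with hτ
  set Z := conjLie κ X with hZ
  have hZ2 : Z * Z = 0 := by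
    have := conjLie_mul_self (k := k) κ X
    rwa [hnX] at this
  set ρ₀ : ℝ := (t l.2.1 : ℝ) / t l.1 with hρ₀
  set g₀ := archGL (uni k (boxPt M (Function.update c l 0))) * τ with hg₀
  have hpt : ∀ s, archGL (uni k (boxPt M (Function.update c l s))) * τ =
      g₀ * oneAdd ((ρ₀ * s) • Z) := by
    intro s
    have h1 : conjLie τ X = ρ₀ • Z := conjLie_diag t κ _ _ _
    rw [boxPt_update, uni_add, map_mul, mul_assoc, archGL_uni_mul, hnX, h1, smul_smul,
      mul_comm s, hg₀]
    simp only [mul_assoc]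
  set φ : ℝ → ℂ := fun s => f (archGL (uni k (boxPt M (Function.update c l s))) * τ) with hφ
  have hφ' : φ = fun s => (fun s => f (g₀ * oneAdd (s • Z))) (ρ₀ * s) := by
    funext s
    simp only [hφ, hpt]
  have hcd := hf.arch_smooth.contDiff_of_sq hZ2 g₀
  have hφcd : ContDiff ℝ ∞ φ := by
    rw [hφ']
    exact hcd.comp (contDiff_const.mul contDiff_id)
  -- a translation by one is left multiplication by a rational unipotent matrix, whose finite
  -- component is absorbed by the right invariance of `f`
  have hper : ∀ s, φ (s + 1) = φ s := by
    intro s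
    let ξ : F := (M : F) * (intBasis F l.2.2 : F)
    have h1 : archGL (uni k (boxPt M (Function.update c l (s + 1)))) =
        archGL (uni k X) * archGL (uni k (boxPt M (Function.update c l s))) := by
      rw [← map_mul, ← uni_add, boxPt_update M c l s, boxPt_update M c l (s + 1), add_smul,
        one_smul]
      congr 2
      abel
    have h2 : ratGL (uni k (Matrix.single l.1 l.2.1 ξ)) = archGL (uni k X) *
        finGL (uni k (algebraMap F (Af F) M •
          Matrix.single l.1 l.2.1 (algebraMap F (Af F) (intBasis F l.2.2)))) := by
      refine gl_ext ?_ ?_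
      · rw [archPart_ratGL, map_uni, map_mul, archPart_archGL, archPart_finGL, mul_one]
        congr 1
        refine Matrix.ext fun i j => ?_
        rw [hX, Matrix.map_apply, Matrix.single_apply, Matrix.single_apply, latB_apply,
          ← map_mul]
        split_ifs <;> simp [ξ]
      · rw [finPart_ratGL, map_uni, map_mul, finPart_archGL, finPart_finGL, one_mul]
        congr 1
        refine Matrix.ext fun i j => ?_
        rw [Matrix.map_apply, Matrix.smul_apply, Matrix.single_apply, Matrix.single_apply,
          smul_eq_mul]
        split_ifs
        · exact map_mul _ _ _
        · rw [map_zero, mul_zero]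
    have h3 : IntMat (Matrix.single l.1 l.2.1
        (algebraMap F (Af F) (intBasis F l.2.2))) := by
      intro i j
      rw [Matrix.single_apply]
      split_ifs
      · exact algebraMap_int_mem _
      · exact zero_mem _
    set b := archGL (uni k (boxPt M (Function.update c l s))) with hb
    set v := finGL (uni k (algebraMap F (Af F) M •
      Matrix.single l.1 l.2.1 (algebraMap F (Af F) (intBasis F l.2.2)))) with hv
    have h4 : b * archGL (archDiag t) * v = v * (b * archGL (archDiag t)) := by
      rw [hb, hv, ← map_mul]
      exact commute_archGL_finGL _ _
    calc f (archGL (uni k (boxPt M (Function.update c l (s + 1)))) * τ)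
        = f (archGL (uni k X) * (b * archGL (archDiag t)) * κ) := by
          rw [h1, hτ]
          simp only [mul_assoc]
      _ = f (archGL (uni k X) * (b * archGL (archDiag t)) * v * κ) := (hinv κ hκ _ h3 _).symm
      _ = f (ratGL (uni k (Matrix.single l.1 l.2.1 ξ)) * (b * τ)) := by
          rw [h2, mul_assoc (archGL (uni k X)) _ v, h4, hτ]
          simp only [mul_assoc]
      _ = f (b * τ) := hf.left_invariant _ (ratGL_mem _) _
  have hcube : ∀ s ∈ Set.Icc (0 : ℝ) 1, ∀ l', Function.update c l s l' ∈ Set.Icc (0 : ℝ) 1 := by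
    intro s hs l'
    by_cases h : l' = l
    · subst h; rwa [Function.update_self]
    · rw [Function.update_of_ne h]; exact hc _
  have hbd : ∀ s ∈ Set.Icc (0 : ℝ) 1, ‖iteratedDeriv (q + 1) φ s‖ ≤
      max B 0 * K ^ r * ρ ^ (q + 1) * R ^ (Module.finrank ℚ F * r) := by
    intro s hs
    rw [hφ', iteratedDeriv_comp_const_smul (hcd.of_le (by exact_mod_cast le_top)) ρ₀,
      iteratedDeriv_eq_wordDeriv hZ2]
    simp only [norm_smul, norm_pow, Real.norm_eq_abs, ← hpt]
    have h1 := hB Z (hc₀ κ hκ) (archGL (uni k (boxPt M (Function.update c l s))) * τ)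
    rw [List.append_nil] at h1
    have h2 := hheight t R hR ht ht' _ ⟨Function.update c l s, fun l' _ => hcube s hs l', rfl⟩ κ hκ
    rw [mul_assoc, ← hτ] at h2
    have h3 : height (archGL (uni k (boxPt M (Function.update c l s))) * τ) ^ r ≤
        K ^ r * R ^ (Module.finrank ℚ F * r) := by
      rw [pow_mul, ← mul_pow]
      exact pow_le_pow_left₀ (height_nonneg _) h2 r
    calc _ ≤ ρ ^ (q + 1) * (max B 0 * (K ^ r * R ^ (Module.finrank ℚ F * r))) := by
          refine mul_le_mul (pow_le_pow_left₀ (abs_nonneg _) hρ _) (h1.trans ?_) (norm_nonneg _)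
            (pow_nonneg ((abs_nonneg _).trans hρ) _)
          refine (mul_le_mul_of_nonneg_right (le_max_left B 0)
            (pow_nonneg (height_nonneg _) _)).trans ?_
          exact mul_le_mul_of_nonneg_left h3 (le_max_right _ _)
      _ = _ := by ring
  have := norm_sub_le_of_periodic q hφcd hper hbd (c l) (hc l) s hs
  simpa only [hφ, Function.update_eq_self] using this

/-- Decay of a cusp form along a maximal parabolic subgroup: the form is small where the roots
`t_i / t_j` in its unipotent radical are large. -/
theorem IsCuspForm.exists_decay_of_ratio {Φ : GLm m (𝔸 F) → ℂ} (hΦ : IsCuspForm Φ)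
    (hk : 0 < k) (hkm : k < m) {C : Set (GLm m (𝔸 F))} (hC : IsCompact C) :
    ∃ A : ℕ, ∀ q : ℕ, ∃ B : ℝ, 0 ≤ B ∧ ∀ (t : Fin m → ℝˣ) (R ρ : ℝ), (∀ i, |(t i : ℝ)| ≤ R) →
      (∀ i, |((t i)⁻¹ : ℝ)| ≤ R) →
      (∀ i j : Fin m, (i : ℕ) < k → k ≤ (j : ℕ) → |(t j : ℝ) / t i| ≤ ρ) →
      ∀ κ ∈ C, ‖Φ (archGL (archDiag t) * κ)‖ ≤ B * ρ ^ (q + 1) * R ^ A := by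
  obtain ⟨r, hr⟩ := hΦ.moderate_growth
  obtain ⟨M, hM, hinv⟩ := hΦ.toIsAutomorphicForm.exists_invariance k hC
  refine ⟨Module.finrank ℚ F * r, fun q => ?_⟩
  have hdir : ∀ l : Fin m × Fin m × Fin (Module.finrank ℚ F), ∃ B : ℝ, 0 ≤ B ∧
      ((l.1 : ℕ) < k ∧ k ≤ (l.2.1 : ℕ) → ∀ (t : Fin m → ℝˣ) (R ρ : ℝ), 0 ≤ R →
      (∀ i, |(t i : ℝ)| ≤ R) →
      (∀ i, |((t i)⁻¹ : ℝ)| ≤ R) → |(t l.2.1 : ℝ) / t l.1| ≤ ρ → ∀ κ ∈ C,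
      ∀ c : Fin m × Fin m × Fin (Module.finrank ℚ F) → ℝ, (∀ l, c l ∈ Set.Icc (0 : ℝ) 1) →
      ∀ s ∈ Set.Icc (0 : ℝ) 1,
        ‖Φ (archGL (uni k (boxPt M c)) * (archGL (archDiag t) * κ)) -
          Φ (archGL (uni k (boxPt M (Function.update c l s))) * (archGL (archDiag t) * κ))‖ ≤
          B * ρ ^ (q + 1) * R ^ (Module.finrank ℚ F * r)) := by
    intro l
    by_cases hl : (l.1 : ℕ) < k ∧ k ≤ (l.2.1 : ℕ)
    · obtain ⟨B, hB, h⟩ := hΦ.toIsAutomorphicForm.exists_oscillation hr hC hinv l hl q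
      exact ⟨B, hB, fun _ => h⟩
    · exact ⟨0, le_rfl, fun h => absurd h hl⟩
  choose B hB hosc using hdir
  set N := Fintype.card (Fin m × Fin m × Fin (Module.finrank ℚ F))
  refine ⟨N * ∑ l, B l, mul_nonneg (Nat.cast_nonneg _) (Finset.sum_nonneg fun l _ => hB l), ?_⟩
  intro t R ρ ht ht' hρ κ hκ
  have hR : 0 ≤ R := (abs_nonneg _).trans (ht ⟨0, by omega⟩)
  have hρ0 : 0 ≤ ρ := (abs_nonneg _).trans (hρ ⟨0, by omega⟩ ⟨k, hkm⟩ hk le_rfl)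
  refine hΦ.norm_le_of_oscillation hk hkm (M := (M : F)) (by simpa using hM) _ fun u hu => ?_
  obtain ⟨c, hc, hcu⟩ := exists_boxPt_of_mem_uniBox (hinv κ hκ) hu (archDiag t)
  rw [hcu]
  have h0 : Φ (archGL (archDiag t) * κ) =
      Φ (archGL (uni k (boxPt M 0)) * (archGL (archDiag t) * κ)) := by
    rw [boxPt_zero, uni_zero, map_one, one_mul]
  rw [h0]
  have h1 := norm_sub_le_of_cube (f := fun c => Φ (archGL (uni k (boxPt M c)) *
    (archGL (archDiag t) * κ))) (B := (∑ l, B l) * ρ ^ (q + 1) * R ^ (Module.finrank ℚ F * r))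
    (x := 0) (y := c) ?_ (fun _ => ⟨le_rfl, zero_le_one⟩) hc
  · refine h1.trans (le_of_eq ?_)
    ring
  · intro x hx l s hs
    by_cases hl : (l.1 : ℕ) < k ∧ k ≤ (l.2.1 : ℕ)
    · refine (hosc l hl t R ρ hR ht ht' (hρ _ _ hl.1 hl.2) κ hκ x hx s hs).trans ?_
      refine mul_le_mul_of_nonneg_right (mul_le_mul_of_nonneg_right ?_ (by positivity))
        (by positivity)
      exact Finset.single_le_sum (fun l _ => hB l) (Finset.mem_univ l)
    · have h2 : uni k (boxPt M (Function.update x l s)) = uni k (boxPt M x) := by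
        have h3 : nilPart k (Matrix.single l.1 l.2.1 (mixedEmbedding F M * latB F l.2.2)) = 0 := by
          refine Matrix.ext fun a b => ?_
          rw [nilPart_apply, Matrix.single_apply, Matrix.zero_apply]
          split_ifs with h4 h5
          · obtain ⟨rfl, rfl⟩ := h5
            exact absurd h4 hl
          · rfl
          · rfl
        have h4 : ∀ s, uni k (boxPt M (Function.update x l s)) =
            uni k (boxPt M (Function.update x l 0)) := by
          intro s
          refine Units.ext ?_
          rw [uni_val, uni_val, boxPt_update, nilPart_add, nilPart_smul, h3, smul_zero, add_zero]
        rw [h4, ← h4 (x l), Function.update_eq_self]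
      simp only [h2, sub_self, norm_zero]
      have : 0 ≤ ∑ l, B l := Finset.sum_nonneg fun l _ => hB l
      positivity

end

section

open scoped Classical

/-! ### Decay of cusp forms on the diagonal torus -/

variable {m : ℕ}

/-- One of the `N` successive quotients of a sequence is at least their geometric mean. -/
theorem exists_ratio_le {T : ℕ → ℝ} (hT : ∀ k, 0 < T k) {N : ℕ} (hN : 0 < N) :
    ∃ k < N, T 0 / T N ≤ (T k / T (k + 1)) ^ N := by
  by_contra! h
  have h1 : ∏ k ∈ Finset.range N, (T k / T (k + 1)) ^ N <
      ∏ _k ∈ Finset.range N, T 0 / T N :=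
    Finset.prod_lt_prod_of_nonempty (fun k _ => pow_pos (div_pos (hT _) (hT _)) _)
      (fun k hk => h k (Finset.mem_range.1 hk)) (Finset.nonempty_range_iff.2 hN.ne')
  have h2 : ∀ n, ∏ k ∈ Finset.range n, (T k / T (k + 1)) = T 0 / T n := by
    intro n
    induction n with
    | zero => simp [(hT 0).ne']
    | succ n ih =>
      rw [Finset.prod_range_succ, ih, div_mul_div_cancel₀ (hT n).ne']
  rw [Finset.prod_pow, h2, Finset.prod_const, Finset.card_range] at h1
  exact lt_irrefl _ h1

/-- Decay of a cusp form in the positive Weyl chamber: the largest simple root is at least a power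
of the quotient of the extreme entries, and the corresponding maximal parabolic subgroup gives the
decay. -/
theorem IsCuspForm.exists_decay_of_antitone {Φ : GLm m (𝔸 F) → ℂ} (hΦ : IsCuspForm Φ)
    (hm : 2 ≤ m) {C : Set (GLm m (𝔸 F))} (hC : IsCompact C) (q : ℕ) :
    ∃ B : ℝ, 0 ≤ B ∧ ∀ t : Fin m → ℝˣ, (∀ i, 0 < (t i : ℝ)) →
      (Antitone fun i => (t i : ℝ)) → (∃ j, t j = 1) → ∀ κ ∈ C, ∀ i j,
        ‖Φ (archGL (archDiag t) * κ)‖ * ((t i : ℝ) / t j) ^ q ≤ B := by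
  have hA : ∀ k : Fin (m - 1), _ := fun k =>
    hΦ.exists_decay_of_ratio (k := k + 1) (by omega) (by omega) hC
  choose A hA using hA
  choose B hB0 hB using fun k => hA k ((m - 1) * (q + A k))
  refine ⟨∑ k, B k, Finset.sum_nonneg fun k _ => hB0 k, ?_⟩
  rintro t ht hanti ⟨j₀, hj₀⟩ κ hκ i j
  let T : ℕ → ℝ := fun k => if h : k < m then t ⟨k, h⟩ else 1
  have hTlt : ∀ k (h : k < m), T k = t ⟨k, h⟩ := fun k h => dif_pos h
  have hT : ∀ k, 0 < T k := by
    intro k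
    simp only [T]
    split_ifs with h
    · exact ht _
    · exact one_pos
  -- `k` is the place of the largest simple root, `R` the largest quotient of two entries
  obtain ⟨k, hk, hkR⟩ := exists_ratio_le hT (N := m - 1) (by omega)
  set R := T 0 / T (m - 1) with hR
  have hRpos : 0 < R := div_pos (hT _) (hT _)
  have hmax : ∀ i, (t i : ℝ) ≤ T 0 := by
    intro i
    rw [hTlt 0 (by omega)]
    exact hanti (Fin.mk_le_of_le_val (Nat.zero_le _))
  have hmin : ∀ i, T (m - 1) ≤ t i := by
    intro i
    rw [hTlt (m - 1) (by omega)]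
    exact hanti (Fin.le_def.2 (by have := i.2; simp only; omega))
  have hratio : ∀ i j, (t i : ℝ) / t j ≤ R := fun i j =>
    div_le_div₀ (hT _).le (hmax i) (hT _) (hmin j)
  have hj₀' : (t j₀ : ℝ) = 1 := by rw [hj₀]; rfl
  have h1 : ∀ i, |(t i : ℝ)| ≤ R := by
    intro i
    rw [abs_of_pos (ht i)]
    simpa [hj₀'] using hratio i j₀
  have h2 : ∀ i, |((t i)⁻¹ : ℝ)| ≤ R := by
    intro i
    rw [abs_of_pos (inv_pos.2 (ht i))]
    simpa [hj₀'] using hratio j₀ i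
  set ρ := T (k + 1) / T k with hρ
  have hρpos : 0 < ρ := div_pos (hT _) (hT _)
  have h3 : ∀ i j : Fin m, (i : ℕ) < k + 1 → k + 1 ≤ (j : ℕ) → |(t j : ℝ) / t i| ≤ ρ := by
    intro i j hi hj
    rw [abs_of_pos (div_pos (ht _) (ht _)), hρ, hTlt _ (by omega : k + 1 < m),
      hTlt _ (by omega : k < m)]
    exact div_le_div₀ (ht _).le (hanti (Fin.le_def.2 hj)) (ht _)
      (hanti (Fin.le_def.2 (by simp only; omega)))
  have hρ1 : ρ ≤ 1 := by
    rw [hρ, div_le_one (hT _), hTlt _ (by omega : k + 1 < m), hTlt _ (by omega : k < m)]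
    exact hanti (Fin.le_def.2 (by simp))
  have h4 := hB ⟨k, hk⟩ t R ρ h1 h2 h3 κ hκ
  have h5 : ρ ^ (m - 1) * R ≤ 1 := by
    have h6 : ρ ^ (m - 1) * (T k / T (k + 1)) ^ (m - 1) = 1 := by
      rw [← mul_pow, hρ, div_mul_div_cancel₀ (hT _).ne', div_self (hT _).ne', one_pow]
    rw [← h6]
    exact mul_le_mul_of_nonneg_left hkR (by positivity)
  calc ‖Φ (archGL (archDiag t) * κ)‖ * ((t i : ℝ) / t j) ^ q
      ≤ B ⟨k, hk⟩ * ρ ^ ((m - 1) * (q + A ⟨k, hk⟩) + 1) * R ^ A ⟨k, hk⟩ * R ^ q := by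
        refine mul_le_mul h4 (pow_le_pow_left₀ (div_pos (ht _) (ht _)).le (hratio i j) q)
          (pow_nonneg (div_pos (ht _) (ht _)).le _) ((norm_nonneg _).trans h4)
    _ = B ⟨k, hk⟩ * ((ρ ^ (m - 1) * R) ^ (q + A ⟨k, hk⟩) * ρ) := by ring
    _ ≤ B ⟨k, hk⟩ * 1 := by
        refine mul_le_mul_of_nonneg_left ?_ (hB0 _)
        exact mul_le_one₀ (pow_le_one₀ (by positivity) h5) hρpos.le hρ1
    _ ≤ ∑ k, B k := by
        rw [mul_one]
        exact Finset.single_le_sum (fun k _ => hB0 k) (Finset.mem_univ _)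

/-- Permutation matrices. -/
def permGL (R : Type*) [CommRing R] (σ : Equiv.Perm (Fin m)) : GLm m R where
  val := σ.permMatrix R
  inv := σ⁻¹.permMatrix R
  val_inv := by rw [← Matrix.permMatrix_mul]; simp
  inv_val := by rw [← Matrix.permMatrix_mul]; simp

theorem permGL_apply (R : Type*) [CommRing R] (σ : Equiv.Perm (Fin m)) (i j : Fin m) :
    (permGL R σ).val i j = if σ i = j then 1 else 0 := by
  simp [permGL, Equiv.Perm.permMatrix, PEquiv.toMatrix_apply, eq_comm]

theorem map_permGL {R S : Type*} [CommRing R] [CommRing S] (f : R →+* S)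
    (σ : Equiv.Perm (Fin m)) :
    Matrix.GeneralLinearGroup.map f (permGL R σ) = permGL S σ := by
  refine Units.ext (Matrix.ext fun i j => ?_)
  rw [Matrix.GeneralLinearGroup.map_apply, permGL_apply, permGL_apply]
  split_ifs <;> simp

theorem ratGL_permGL_mul (σ : Equiv.Perm (Fin m)) (t : Fin m → ℝˣ) :
    ratGL (permGL F σ) * archGL (archDiag t) =
      archGL (archDiag (t ∘ σ)) * ratGL (permGL F σ) := by
  refine gl_ext ?_ ?_
  · rw [map_mul, map_mul, archPart_ratGL, map_permGL, archPart_archGL, archPart_archGL]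
    refine Units.ext (Matrix.ext fun i j => ?_)
    rw [Units.val_mul, Units.val_mul, archDiag_val, archDiag_val, Matrix.mul_diagonal,
      Matrix.diagonal_mul, permGL_apply]
    split_ifs with h
    · rw [← h, Function.comp_apply, one_mul, mul_one]
    · rw [zero_mul, mul_zero]
  · simp

/-- A cusp form is rapidly decreasing in all directions of the diagonal torus modulo the
centre. -/
theorem IsCuspForm.exists_decay {Φ : GLm m (𝔸 F) → ℂ} (hΦ : IsCuspForm Φ)
    (hm : 2 ≤ m) {C : Set (GLm m (𝔸 F))} (hC : IsCompact C) (q : ℕ) :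
    ∃ B : ℝ, 0 ≤ B ∧ ∀ t : Fin m → ℝˣ, (∀ i, 0 < (t i : ℝ)) → (∃ j, t j = 1) → ∀ κ ∈ C, ∀ i j,
        ‖Φ (archGL (archDiag t) * κ)‖ * ((t i : ℝ) / t j) ^ q ≤ B := by
  choose B hB0 hB using fun σ : Equiv.Perm (Fin m) => hΦ.exists_decay_of_antitone hm
    (hC.image (continuous_const_mul (ratGL (permGL F σ)))) q
  refine ⟨∑ σ, B σ, Finset.sum_nonneg fun σ _ => hB0 σ, ?_⟩
  rintro t ht ⟨j₀, hj₀⟩ κ hκ i j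
  set σ : Equiv.Perm (Fin m) := Tuple.sort fun i => -(t i : ℝ) with hσ
  have hanti : Antitone fun i => ((t ∘ σ) i : ℝ) := fun a b hab =>
    neg_le_neg_iff.1 (Tuple.monotone_sort (fun i => -(t i : ℝ)) hab)
  have h1 := hB σ (t ∘ σ) (fun i => ht _) hanti ⟨σ.symm j₀, by simp [hj₀]⟩ _ ⟨κ, hκ, rfl⟩
    (σ.symm i) (σ.symm j)
  simp only [Function.comp_apply, Equiv.apply_symm_apply] at h1
  have h2 : Φ (archGL (archDiag (t ∘ σ)) * (ratGL (permGL F σ) * κ)) =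
      Φ (archGL (archDiag t) * κ) := by
    rw [← mul_assoc, ← ratGL_permGL_mul, mul_assoc]
    exact hΦ.left_invariant _ (ratGL_mem _) _
  rw [h2] at h1
  exact h1.trans (Finset.single_le_sum (fun σ _ => hB0 σ) (Finset.mem_univ σ))

end

section

open scoped Classical

/-! ### The embedding of `GL_m × GL_1` into `GL_{m+2}` -/

section Corner

variable {m : ℕ} {R S : Type*} [CommRing R] [CommRing S]

@[simp] theorem corner_castSucc_castSucc (h : GLm m R) (i j : Fin m) :
    (corner h).val i.castSucc j.castSucc = h.val i j := by
  change Matrix.fromBlocks _ _ _ _ (finSumFinEquiv.symm (Fin.castAdd 1 i))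
    (finSumFinEquiv.symm (Fin.castAdd 1 j)) = _
  simp

@[simp] theorem corner_castSucc_last (h : GLm m R) (i : Fin m) :
    (corner h).val i.castSucc (Fin.last m) = 0 := by
  change Matrix.fromBlocks _ _ _ _ (finSumFinEquiv.symm (Fin.castAdd 1 i))
    (finSumFinEquiv.symm (Fin.last m)) = _
  simp

@[simp] theorem corner_last_castSucc (h : GLm m R) (j : Fin m) :
    (corner h).val (Fin.last m) j.castSucc = 0 := by
  change Matrix.fromBlocks _ _ _ _ (finSumFinEquiv.symm (Fin.last m))
    (finSumFinEquiv.symm (Fin.castAdd 1 j)) = _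
  simp

@[simp] theorem corner_last_last (h : GLm m R) :
    (corner h).val (Fin.last m) (Fin.last m) = 1 := by
  change Matrix.fromBlocks _ _ _ _ (finSumFinEquiv.symm (Fin.last m))
    (finSumFinEquiv.symm (Fin.last m)) = _
  simp

/-- Two invertible matrices with the last row and column of the identity are equal if their upper
left blocks are. -/
theorem gl_ext_corner {g g' : GLm (m + 1) R}
    (h₁ : ∀ i j : Fin m, g.val i.castSucc j.castSucc = g'.val i.castSucc j.castSucc)
    (h₂ : ∀ i : Fin m, g.val i.castSucc (Fin.last m) = g'.val i.castSucc (Fin.last m))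
    (h₃ : ∀ j : Fin m, g.val (Fin.last m) j.castSucc = g'.val (Fin.last m) j.castSucc)
    (h₄ : g.val (Fin.last m) (Fin.last m) = g'.val (Fin.last m) (Fin.last m)) : g = g' := by
  refine Units.ext (Matrix.ext fun i j => ?_)
  induction i using Fin.lastCases with
  | last =>
    induction j using Fin.lastCases with
    | last => exact h₄
    | cast j => exact h₃ j
  | cast i =>
    induction j using Fin.lastCases with
    | last => exact h₂ i
    | cast j => exact h₁ i j

theorem corner_mul (g h : GLm m R) : corner (g * h) = corner g * corner h := by
  refine gl_ext_corner ?_ ?_ ?_ ?_ <;> intros <;>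
    simp [Matrix.mul_apply, Fin.sum_univ_castSucc]

theorem map_corner (f : R →+* S) (h : GLm m R) :
    Matrix.GeneralLinearGroup.map f (corner h) = corner (Matrix.GeneralLinearGroup.map f h) := by
  refine gl_ext_corner ?_ ?_ ?_ ?_ <;> intros <;> simp

theorem corner_one : corner (1 : GLm m R) = 1 := by
  refine gl_ext_corner ?_ ?_ ?_ ?_ <;> intros <;>
    simp [Matrix.one_apply, (Fin.castSucc_ne_last _).symm]

theorem det_corner (h : GLm m R) :
    Matrix.GeneralLinearGroup.det (corner h) = Matrix.GeneralLinearGroup.det h := by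
  refine Units.ext ?_
  rw [Matrix.GeneralLinearGroup.val_det_apply, Matrix.GeneralLinearGroup.val_det_apply]
  change Matrix.det (Matrix.reindex finSumFinEquiv finSumFinEquiv _) = _
  rw [Matrix.det_reindex_self, Matrix.det_fromBlocks_zero₁₂, Matrix.det_one, mul_one]

theorem continuous_corner [TopologicalSpace R] [IsTopologicalRing R] :
    Continuous (corner : GLm m R → GLm (m + 1) R) := by
  have h : Continuous fun h : GLm m R => (corner h).val := by
    refine continuous_matrix fun i j => ?_
    induction i using Fin.lastCases with
    | last =>
      induction j using Fin.lastCases with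
      | last => simpa using continuous_const
      | cast j => simpa using continuous_const
    | cast i =>
      induction j using Fin.lastCases with
      | last => simpa using continuous_const
      | cast j => simpa using Units.continuous_val.matrix_elem i j
  exact Units.continuous_iff.2 ⟨h, h.comp continuous_inv⟩

theorem scalar_apply (u : Rˣ) (i j : Fin m) :
    (Matrix.GeneralLinearGroup.scalar (Fin m) u).val i j = if i = j then (u : R) else 0 := by
  rw [Matrix.GeneralLinearGroup.coe_scalar]
  exact Matrix.diagonal_apply _ _ _

theorem scalar_commute (u : Rˣ) (h : GLm m R) :
    Matrix.GeneralLinearGroup.scalar (Fin m) u * h =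
      h * Matrix.GeneralLinearGroup.scalar (Fin m) u := by
  refine Units.ext ?_
  rw [Units.val_mul, Units.val_mul, Matrix.GeneralLinearGroup.coe_scalar]
  exact (Matrix.scalar_commute _ (fun r => Commute.all _ _) _).eq

theorem scalar_mul_apply (u : Rˣ) (h : GLm m R) (i j : Fin m) :
    (Matrix.GeneralLinearGroup.scalar (Fin m) u * h).val i j = u * h.val i j := by
  rw [Units.val_mul, Matrix.GeneralLinearGroup.coe_scalar]
  exact Matrix.diagonal_mul _ _ _ _

theorem continuous_scalar [TopologicalSpace R] [IsTopologicalRing R] :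
    Continuous (Matrix.GeneralLinearGroup.scalar (Fin m) : Rˣ → GLm m R) := by
  have h : Continuous fun u : Rˣ => (Matrix.GeneralLinearGroup.scalar (Fin m) u).val := by
    refine continuous_matrix fun i j => ?_
    simp only [scalar_apply]
    split_ifs
    · exact Units.continuous_val
    · exact continuous_const
  refine Units.continuous_iff.2 ⟨h, ?_⟩
  exact h.comp continuous_inv

/-- The matrix `(u h 0 0; 0 u 0; 0 0 1)`. -/
def twoCorner (h : GLm m R) (u : Rˣ) : GLm (m + 2) R :=
  corner (Matrix.GeneralLinearGroup.scalar (Fin (m + 1)) u * corner h)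

theorem twoCorner_mul (g h : GLm m R) (u v : Rˣ) :
    twoCorner (g * h) (u * v) = twoCorner g u * twoCorner h v := by
  unfold twoCorner
  rw [← corner_mul, corner_mul g h, map_mul]
  congr 1
  rw [mul_assoc, mul_assoc, ← mul_assoc _ (corner g), scalar_commute v]
  simp only [mul_assoc]

theorem continuous_twoCorner [TopologicalSpace R] [IsTopologicalRing R] :
    Continuous fun p : GLm m R × Rˣ => twoCorner p.1 p.2 :=
  continuous_corner.comp ((continuous_scalar.comp continuous_snd).mul
    (continuous_corner.comp continuous_fst))

theorem mul_weylSwap_apply (g : GLm (m + 2) R) (i j : Fin (m + 2)) :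
    (g * weylSwap m R).val i j =
      g.val i (Equiv.swap (Fin.last m).castSucc (Fin.last (m + 1)) j) := by
  rw [Units.val_mul]
  change (g.val * (Equiv.swap (Fin.last m).castSucc (Fin.last (m + 1))).permMatrix R) i j = _
  rw [Equiv.Perm.permMatrix, PEquiv.mul_toMatrix_toPEquiv, Matrix.submatrix_apply,
    Equiv.symm_swap]
  rfl

theorem weylSwap_mul_apply (g : GLm (m + 2) R) (i j : Fin (m + 2)) :
    (weylSwap m R * g).val i j =
      g.val (Equiv.swap (Fin.last m).castSucc (Fin.last (m + 1)) i) j := by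
  rw [Units.val_mul]
  change ((Equiv.swap (Fin.last m).castSucc (Fin.last (m + 1))).permMatrix R * g.val) i j = _
  rw [Equiv.Perm.permMatrix, PEquiv.toMatrix_toPEquiv_mul, Matrix.submatrix_apply]
  rfl

/-- Conjugation by the Weyl element exchanges `u` and `1` in `(u h 0 0; 0 u 0; 0 0 1)`; up to the
scalar `u`, the result is again of this form. -/
theorem twoCorner_mul_weylSwap (h : GLm m R) (u : Rˣ) :
    twoCorner h u * weylSwap m R = weylSwap m R *
      (Matrix.GeneralLinearGroup.scalar (Fin (m + 2)) u *
        twoCorner (Matrix.GeneralLinearGroup.scalar (Fin m) u * h) u⁻¹) := by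
  have hswap : ∀ i : Fin m, Equiv.swap (Fin.last m).castSucc (Fin.last (m + 1))
      i.castSucc.castSucc = i.castSucc.castSucc := fun i =>
    Equiv.swap_apply_of_ne_of_ne
      (fun h => Fin.castSucc_ne_last i (Fin.castSucc_injective _ h)) (Fin.castSucc_ne_last _)
  have hcases : ∀ i : Fin (m + 2), i = Fin.last (m + 1) ∨ i = (Fin.last m).castSucc ∨
      ∃ i' : Fin m, i = i'.castSucc.castSucc := by
    intro i
    induction i using Fin.lastCases with
    | last => exact Or.inl rfl
    | cast i =>
      induction i using Fin.lastCases with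
      | last => exact Or.inr (Or.inl rfl)
      | cast i => exact Or.inr (Or.inr ⟨i, rfl⟩)
  have huv : (u : R) * (u⁻¹ : Rˣ) = 1 := u.mul_inv
  have huv' : ∀ x : R, (u : R) * ((u⁻¹ : Rˣ) * x) = x := fun x => by
    rw [← mul_assoc, Units.mul_inv, one_mul]
  refine Units.ext (Matrix.ext fun i j => ?_)
  rw [mul_weylSwap_apply, weylSwap_mul_apply, scalar_mul_apply]
  unfold twoCorner
  -- otherwise `simp` rewrites the scalar matrix of `u⁻¹` as an inverse matrix
  generalize u⁻¹ = v at huv huv'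
  rcases hcases i with rfl | rfl | ⟨i, rfl⟩ <;> rcases hcases j with rfl | rfl | ⟨j, rfl⟩ <;>
    simp [scalar_mul_apply, hswap, huv, huv']

end Corner

theorem map_weylSwap {R S : Type*} [CommRing R] [CommRing S] (f : R →+* S) (m : ℕ) :
    Matrix.GeneralLinearGroup.map f (weylSwap m R) = weylSwap m S := map_permGL f _

theorem map_scalar_units {R S : Type*} [CommRing R] [CommRing S] (f : R →+* S) {m : ℕ} (u : Rˣ) :
    Matrix.GeneralLinearGroup.map f (Matrix.GeneralLinearGroup.scalar (Fin m) u) =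
      Matrix.GeneralLinearGroup.scalar (Fin m) (Units.map f.toMonoidHom u) := by
  refine Units.ext (Matrix.ext fun i j => ?_)
  rw [Matrix.GeneralLinearGroup.map_apply, scalar_apply, scalar_apply]
  split_ifs <;> simp

theorem weylSwap_mem (m : ℕ) : weylSwap m (𝔸 F) ∈ rationalGL F (m + 2) :=
  ⟨weylSwap m F, map_weylSwap _ m⟩

theorem twoCorner_mem {m : ℕ} {γ : GLm m (𝔸 F)} (hγ : γ ∈ rationalGL F m) {δ : (𝔸 F)ˣ}
    (hδ : δ ∈ rationalIdeles F) : twoCorner γ δ ∈ rationalGL F (m + 2) := by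
  obtain ⟨γ, rfl⟩ := hγ
  obtain ⟨δ, rfl⟩ := hδ
  refine ⟨twoCorner γ δ, ?_⟩
  unfold twoCorner
  rw [map_corner, map_mul, map_corner, map_scalar_units]

theorem corner_scalar_mem {m : ℕ} {δ : (𝔸 F)ˣ} (hδ : δ ∈ rationalIdeles F) :
    corner (Matrix.GeneralLinearGroup.scalar (Fin m) δ) ∈ rationalGL F (m + 1) := by
  obtain ⟨δ, rfl⟩ := hδ
  refine ⟨corner (Matrix.GeneralLinearGroup.scalar (Fin m) δ), ?_⟩
  rw [map_corner, map_scalar_units]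

variable {m : ℕ}

theorem corner_archGL_archDiag (t : Fin m → ℝˣ) :
    corner (archGL (F := F) (archDiag t)) = archGL (archDiag (Fin.snoc t 1 : Fin (m + 1) → ℝˣ)) := by
  refine gl_ext ?_ ?_
  · change Matrix.GeneralLinearGroup.map _ _ = _
    rw [map_corner]
    change corner (archPart _) = _
    rw [archPart_archGL, archPart_archGL]
    refine gl_ext_corner ?_ ?_ ?_ ?_ <;> intros <;>
      simp [archDiag_val, Matrix.diagonal_apply, (Fin.castSucc_ne_last _).symm]
    rfl
  · change Matrix.GeneralLinearGroup.map _ _ = _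
    rw [map_corner]
    change corner (finPart _) = _
    rw [finPart_archGL, finPart_archGL, corner_one]

theorem scalar_realIdele (a : ℝˣ) :
    Matrix.GeneralLinearGroup.scalar (Fin m) (realIdele a : (𝔸 F)ˣ) =
      archGL (archDiag fun _ => a) := by
  refine gl_ext ?_ ?_
  · change Matrix.GeneralLinearGroup.map _ _ = _
    rw [map_scalar_units, archPart_archGL]
    refine Units.ext (Matrix.ext fun i j => ?_)
    rw [scalar_apply, archDiag_val, Matrix.diagonal_apply]
    refine if_congr Iff.rfl ?_ rfl
    exact archProj_realIdele a
  · change Matrix.GeneralLinearGroup.map _ _ = _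
    rw [map_scalar_units, finPart_archGL]
    refine Units.ext (Matrix.ext fun i j => ?_)
    rw [scalar_apply, Units.val_one, Matrix.one_apply]
    refine if_congr Iff.rfl ?_ rfl
    exact finProj_realIdele a

theorem corner_scalar_realIdele (a : ℝˣ) :
    corner (Matrix.GeneralLinearGroup.scalar (Fin m) (realIdele a : (𝔸 F)ˣ)) =
      archGL (archDiag (Fin.snoc (fun _ => a) 1 : Fin (m + 1) → ℝˣ)) := by
  rw [scalar_realIdele, corner_archGL_archDiag]

theorem twoCorner_archGL (t : Fin m → ℝˣ) (a : ℝˣ) :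
    twoCorner (archGL (F := F) (archDiag t)) (realIdele a) =
      archGL (archDiag (Fin.snoc (fun i => a * (Fin.snoc t 1 : Fin (m + 1) → ℝˣ) i) 1 :
        Fin (m + 2) → ℝˣ)) := by
  unfold twoCorner
  rw [corner_archGL_archDiag, scalar_realIdele, ← map_mul, ← map_mul, corner_archGL_archDiag]
  rfl

theorem idelicNorm_realIdele (t : ℝˣ) :
    idelicNorm (realIdele t : (𝔸 F)ˣ) = |(t : ℝ)| ^ Module.finrank ℚ F := by
  rw [idelicNorm_eq, archProj_realIdele]
  have h : finNorm (realIdele t : (𝔸 F)ˣ) = 1 :=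
    finNorm_eq_one (by rw [finProj_realIdele]; exact one_mem _)
      (by rw [← map_inv, finProj_realIdele]; exact one_mem _)
  rw [h, mul_one]
  exact mixedEmbedding.norm_real _

theorem det_archGL_archDiag (t : Fin m → ℝˣ) :
    Matrix.GeneralLinearGroup.det (archGL (F := F) (archDiag t)) = realIdele (∏ i, t i) := by
  refine Units.ext (adele_ext ?_ ?_)
  · rw [archProj_realIdele, Matrix.GeneralLinearGroup.val_det_apply, RingHom.map_det]
    change (archPart (archGL (archDiag t))).val.det = _
    rw [archPart_archGL, archDiag_val, Matrix.det_diagonal]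
    simp
  · rw [finProj_realIdele, Matrix.GeneralLinearGroup.val_det_apply, RingHom.map_det]
    change (finPart (archGL (archDiag t))).val.det = _
    rw [finPart_archGL, Units.val_one, Matrix.det_one]

theorem det_scalar (u : (𝔸 F)ˣ) :
    Matrix.GeneralLinearGroup.det (Matrix.GeneralLinearGroup.scalar (Fin m) u) = u ^ m := by
  refine Units.ext ?_
  rw [Matrix.GeneralLinearGroup.val_det_apply, Matrix.GeneralLinearGroup.coe_scalar]
  simp

end

section

open scoped Classical

/-! ### Bounds on the representatives given by reduction theory -/

variable {m : ℕ}

/-- Rapid decrease in all directions of the diagonal torus modulo the centre. The torus modulo the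
centre is represented by the matrices with one entry equal to one. -/
def RapidlyDecreasing (Ψ : GLm m (𝔸 F) → ℂ) : Prop :=
  ∀ C : Set (GLm m (𝔸 F)), IsCompact C → ∀ q : ℕ, ∃ B : ℝ, 0 ≤ B ∧ ∀ t : Fin m → ℝˣ,
    (∀ i, 0 < (t i : ℝ)) → (∃ j, t j = 1) → ∀ κ ∈ C, ∀ i j,
      ‖Ψ (archGL (archDiag t) * κ)‖ * ((t i : ℝ) / t j) ^ q ≤ B

theorem IsCuspForm.rapidlyDecreasing {Φ : GLm m (𝔸 F) → ℂ} (hΦ : IsCuspForm Φ) (hm : 2 ≤ m) :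
    RapidlyDecreasing Φ := fun _ hC q => hΦ.exists_decay hm hC q

theorem RapidlyDecreasing.check {Φ : GLm (m + 2) (𝔸 F) → ℂ} (hΦ : RapidlyDecreasing Φ) :
    RapidlyDecreasing (check Φ) := by
  intro C hC q
  obtain ⟨B, hB0, hB⟩ := hΦ _ (hC.image (continuous_mul_const (weylSwap m (𝔸 F)))) q
  refine ⟨B, hB0, fun t ht ht1 κ hκ i j => ?_⟩
  have := hB t ht ht1 _ ⟨κ, hκ, rfl⟩ i j
  rwa [← mul_assoc] at this

theorem two_val : (two : ℝ) = 2 := rfl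

theorem two_zpow_val (k : ℤ) : ((two ^ k : ℝˣ) : ℝ) = 2 ^ k := by
  rw [Units.val_zpow_eq_zpow_val]
  rfl

/-- Two-sided decay in one ratio. -/
theorem mul_two_pow_natAbs_le {x B : ℝ} {q : ℕ} (k : ℤ) (h₁ : x * ((2 : ℝ) ^ k) ^ q ≤ B)
    (h₂ : x * ((2 : ℝ) ^ (-k)) ^ q ≤ B) : x * 2 ^ (q * k.natAbs) ≤ B := by
  rw [mul_comm q, pow_mul]
  rcases Int.natAbs_eq k with h | h
  · rw [h, zpow_natCast] at h₁
    simpa using h₁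
  · rw [h, neg_neg, zpow_natCast] at h₂
    simpa using h₂

/-- Rapid decay in all the torus coordinates of `GL_m × GL_1` at once: the `m + 1` ratios of entries
`k i` and `l` are each controlled by one decay estimate, and the estimates are multiplied. -/
theorem RapidlyDecreasing.exists_bound_twoCorner {Ψ : GLm (m + 2) (𝔸 F) → ℂ}
    (hΨ : RapidlyDecreasing Ψ) {C₁ : Set (GLm m (𝔸 F))} (hC₁ : IsCompact C₁) {C₂ : Set (𝔸 F)ˣ}
    (hC₂ : IsCompact C₂) (q : ℕ) :
    ∃ B : ℝ, 0 ≤ B ∧ ∀ (k : Fin m → ℤ) (l : ℤ), ∀ κ₁ ∈ C₁, ∀ κ₂ ∈ C₂,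
      ‖Ψ (twoCorner (archGL (archDiag fun i => two ^ k i) * κ₁) (realIdele (two ^ l) * κ₂))‖ *
        2 ^ (q * (∑ i, (k i).natAbs + l.natAbs)) ≤ B := by
  obtain ⟨B, hB0, hB⟩ := hΨ _ ((hC₁.prod hC₂).image continuous_twoCorner) ((m + 1) * q)
  -- the exponent `(m + 1) q` allows for an `(m + 1)`-st root after multiplying `m + 1` estimates
  refine ⟨B, hB0, fun k l κ₁ hκ₁ κ₂ hκ₂ => ?_⟩
  rw [twoCorner_mul, twoCorner_archGL]
  set T : Fin (m + 2) → ℝˣ := Fin.snoc (fun i => two ^ l *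
    (Fin.snoc (fun i => two ^ k i) 1 : Fin (m + 1) → ℝˣ) i) 1 with hT
  have hT1 : ∀ i : Fin m, (T i.castSucc.castSucc : ℝ) = 2 ^ l * 2 ^ k i := fun i => by
    simp [hT, two_val]
  have hT2 : (T (Fin.last m).castSucc : ℝ) = 2 ^ l := by
    simp [hT, two_val]
  have hT3 : T (Fin.last (m + 1)) = 1 := by simp [hT]
  have hpos : ∀ i, 0 < (T i : ℝ) := by
    intro i
    induction i using Fin.lastCases with
    | last => rw [hT3]; exact one_pos
    | cast i =>
      induction i using Fin.lastCases with
      | last => rw [hT2]; positivity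
      | cast i => rw [hT1]; positivity
  have hb := hB T hpos ⟨_, hT3⟩ _ ⟨(κ₁, κ₂), ⟨hκ₁, hκ₂⟩, rfl⟩
  simp only at hb
  set x := ‖Ψ (archGL (archDiag T) * twoCorner κ₁ κ₂)‖ with hx
  have hl : x * 2 ^ ((m + 1) * q * l.natAbs) ≤ B := by
    refine mul_two_pow_natAbs_le l ?_ ?_
    · have := hb (Fin.last m).castSucc (Fin.last (m + 1))
      rwa [hT2, hT3, Units.val_one, div_one] at this
    · have := hb (Fin.last (m + 1)) (Fin.last m).castSucc
      rwa [hT2, hT3, Units.val_one, one_div, ← zpow_neg] at this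
  have hk : ∀ i, x * 2 ^ ((m + 1) * q * (k i).natAbs) ≤ B := by
    intro i
    refine mul_two_pow_natAbs_le (k i) ?_ ?_
    · have := hb i.castSucc.castSucc (Fin.last m).castSucc
      rwa [hT1, hT2, mul_div_cancel_left₀ _ (by positivity)] at this
    · have := hb (Fin.last m).castSucc i.castSucc.castSucc
      rwa [hT1, hT2, div_mul_cancel_left₀ (by positivity), ← zpow_neg] at this
  refine le_of_pow_le_pow_left₀ (n := m + 1) (by omega) hB0 ?_
  have h1 : (∏ i, (x * 2 ^ ((m + 1) * q * (k i).natAbs))) * (x * 2 ^ ((m + 1) * q * l.natAbs)) ≤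
      B ^ m * B := by
    refine mul_le_mul ?_ hl (by positivity) (by positivity)
    refine (Finset.prod_le_prod (fun i _ => by positivity) fun i _ => hk i).trans (by simp)
  calc (x * 2 ^ (q * (∑ i, (k i).natAbs + l.natAbs))) ^ (m + 1)
      = (∏ i, (x * 2 ^ ((m + 1) * q * (k i).natAbs))) * (x * 2 ^ ((m + 1) * q * l.natAbs)) := by
        rw [Finset.prod_mul_distrib, Finset.prod_const, Finset.card_univ, Fintype.card_fin,
          Finset.prod_pow_eq_pow_sum, ← Finset.mul_sum]
        ring
    _ ≤ B ^ (m + 1) := by rw [pow_succ]; exact h1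

/-- Rapid decay along the centre of `GL_{m+1}`, for a fixed translate. -/
theorem RapidlyDecreasing.exists_bound_corner {Ψ : GLm (m + 2) (𝔸 F) → ℂ}
    (hΨ : RapidlyDecreasing Ψ) (h : GLm (m + 1) (𝔸 F)) {C₂ : Set (𝔸 F)ˣ}
    (hC₂ : IsCompact C₂) (q : ℕ) :
    ∃ B : ℝ, 0 ≤ B ∧ ∀ l : ℤ, ∀ κ₂ ∈ C₂,
      ‖Ψ (corner (Matrix.GeneralLinearGroup.scalar (Fin (m + 1)) (realIdele (two ^ l) * κ₂) * h))‖ *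
        2 ^ (q * l.natAbs) ≤ B := by
  have hcont : Continuous fun u : (𝔸 F)ˣ =>
      corner (Matrix.GeneralLinearGroup.scalar (Fin (m + 1)) u * h) :=
    continuous_corner.comp (continuous_scalar.mul continuous_const)
  obtain ⟨B, hB0, hB⟩ := hΨ _ (hC₂.image hcont) q
  refine ⟨B, hB0, fun l κ hκ => ?_⟩
  rw [map_mul, mul_assoc, corner_mul, corner_scalar_realIdele]
  set T : Fin (m + 2) → ℝˣ := Fin.snoc (fun _ => two ^ l) 1 with hT
  have hT1 : ∀ i : Fin (m + 1), (T i.castSucc : ℝ) = 2 ^ l := fun i => by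
    simp [hT, two_val]
  have hT3 : T (Fin.last (m + 1)) = 1 := by simp [hT]
  have hpos : ∀ i, 0 < (T i : ℝ) := by
    intro i
    induction i using Fin.lastCases with
    | last => rw [hT3]; exact one_pos
    | cast i => rw [hT1]; positivity
  have hb := hB T hpos ⟨_, hT3⟩ _ ⟨κ, hκ, rfl⟩
  refine mul_two_pow_natAbs_le l ?_ ?_
  · have := hb (Fin.castSucc 0) (Fin.last (m + 1))
    rwa [hT1, hT3, Units.val_one, div_one] at this
  · have := hb (Fin.last (m + 1)) (Fin.castSucc 0)
    rwa [hT1, hT3, Units.val_one, one_div, ← zpow_neg] at this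

theorem norm_cpow_idelicNorm (u : (𝔸 F)ˣ) (a : ℂ) :
    ‖(idelicNorm u : ℂ) ^ a‖ = idelicNorm u ^ a.re :=
  Complex.norm_cpow_eq_rpow_re_of_pos (idelicNorm_pos u) a

theorem exists_norm_cpow_le (a : ℂ) {C : Set (𝔸 F)ˣ} (hC : IsCompact C) :
    ∃ A : ℕ, ∃ B : ℝ, 0 ≤ B ∧ ∀ l : ℤ, ∀ κ ∈ C,
      ‖(idelicNorm (realIdele (two ^ l) * κ) : ℂ) ^ a‖ ≤ B * 2 ^ (A * l.natAbs) := by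
  have hcont : Continuous fun κ : (𝔸 F)ˣ => idelicNorm κ ^ a.re :=
    continuous_idelicNorm.rpow_const fun κ => Or.inl (idelicNorm_pos κ).ne'
  obtain ⟨B, hB⟩ := (hC.image hcont).bddAbove
  set d := Module.finrank ℚ F
  refine ⟨⌈d * |a.re|⌉₊, max B 0, le_max_right _ _, fun l κ hκ => ?_⟩
  rw [norm_cpow_idelicNorm, idelicNorm_mul, idelicNorm_realIdele, two_zpow_val,
    Real.mul_rpow (by positivity) (idelicNorm_pos κ).le, mul_comm]
  refine mul_le_mul ((hB ⟨κ, hκ, rfl⟩).trans (le_max_left _ _)) ?_ (by positivity)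
    (le_max_right _ _)
  rw [abs_of_pos (by positivity), ← Real.rpow_natCast, ← Real.rpow_intCast, ← Real.rpow_mul
    zero_le_two, ← Real.rpow_mul zero_le_two, ← Real.rpow_natCast 2]
  refine Real.rpow_le_rpow_of_exponent_le one_le_two ?_
  have h1 : (l : ℝ) * d * a.re ≤ |(l : ℝ)| * (d * |a.re|) := by
    rw [mul_assoc]
    refine (le_abs_self _).trans (le_of_eq ?_)
    rw [abs_mul, abs_mul, Nat.abs_cast]
  have h2 : ((l.natAbs : ℕ) : ℝ) = |(l : ℝ)| := by
    rw [Nat.cast_natAbs, Int.cast_abs]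
  push_cast
  rw [h2, mul_comm (_ : ℝ) |(l : ℝ)|]
  exact h1.trans (mul_le_mul_of_nonneg_left (Nat.le_ceil _) (abs_nonneg _))

theorem exists_norm_cpow_det_le (a : ℂ) {C : Set (GLm m (𝔸 F))} (hC : IsCompact C) :
    ∃ A : ℕ, ∃ B : ℝ, 0 ≤ B ∧ ∀ k : Fin m → ℤ, ∀ κ ∈ C,
      ‖(idelicNorm (Matrix.GeneralLinearGroup.det
        (archGL (archDiag fun i => two ^ k i) * κ)) : ℂ) ^ a‖ ≤
          B * 2 ^ (A * ∑ i, (k i).natAbs) := by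
  obtain ⟨A, B, hB0, hB⟩ := exists_norm_cpow_le a
    (hC.image (Matrix.GeneralLinearGroup.continuous_det))
  refine ⟨A, B, hB0, fun k κ hκ => ?_⟩
  have hprod : ∀ s : Finset (Fin m), ∏ i ∈ s, two ^ k i = two ^ ∑ i ∈ s, k i := by
    intro s
    induction s using Finset.induction_on with
    | empty => simp
    | insert i s hi ih => rw [Finset.prod_insert hi, Finset.sum_insert hi, zpow_add, ih]
  rw [map_mul, det_archGL_archDiag, hprod]
  refine (hB _ _ ⟨κ, hκ, rfl⟩).trans (mul_le_mul_of_nonneg_left ?_ hB0)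
  exact pow_le_pow_right₀ one_le_two (Nat.mul_le_mul_left _ (Int.natAbs_sum_le _ _))

/-- Moderate growth in terms of the torus coordinate of reduction theory. -/
theorem IsAutomorphicForm.exists_bound {φ : GLm m (𝔸 F) → ℂ} (hφ : IsAutomorphicForm φ)
    {C : Set (GLm m (𝔸 F))} (hC : IsCompact C) :
    ∃ A : ℕ, ∃ B : ℝ, 0 ≤ B ∧ ∀ k : Fin m → ℤ, ∀ κ ∈ C,
      ‖φ (archGL (archDiag fun i => two ^ k i) * κ)‖ ≤ B * 2 ^ (A * ∑ i, (k i).natAbs) := by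
  obtain ⟨r, hr⟩ := hφ.moderate_growth
  obtain ⟨B, hB⟩ := hr []
  obtain ⟨K, hK0, hK⟩ := exists_height_le (isCompact_singleton (x := (1 : GLm m (𝔸 F)))) hC
  refine ⟨Module.finrank ℚ F * r, max B 0 * K ^ r, by positivity, fun k κ hκ => ?_⟩
  have h1 : ∀ i, ((2 : ℝ) ^ (k i) ≤ 2 ^ ∑ i, (k i).natAbs) ∧
      ((2 : ℝ) ^ (-k i) ≤ 2 ^ ∑ i, (k i).natAbs) := by
    intro i
    have h2 : (k i).natAbs ≤ ∑ i, (k i).natAbs :=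
      Finset.single_le_sum (f := fun i => (k i).natAbs) (fun _ _ => Nat.zero_le _)
        (Finset.mem_univ i)
    rw [← zpow_natCast]
    exact ⟨zpow_le_zpow_right₀ one_le_two (by omega), zpow_le_zpow_right₀ one_le_two (by omega)⟩
  have h2 := hK (fun i => two ^ k i) (2 ^ ∑ i, (k i).natAbs) (by positivity)
    (fun i => by rw [two_zpow_val, abs_of_pos (by positivity)]; exact (h1 i).1)
    (fun i => by rw [two_zpow_val, ← zpow_neg, abs_of_pos (by positivity)]; exact (h1 i).2)
    1 rfl κ hκ
  rw [one_mul] at h2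
  refine (hB _).trans ?_
  calc B * height (archGL (archDiag fun i => two ^ k i) * κ) ^ r
      ≤ max B 0 * (K * (2 ^ ∑ i, (k i).natAbs) ^ Module.finrank ℚ F) ^ r := by
        refine mul_le_mul (le_max_left _ _) (pow_le_pow_left₀ (height_nonneg _) h2 r)
          (pow_nonneg (height_nonneg _) r) (le_max_right _ _)
    _ = _ := by ring

/-! ### Geometric series over `ℤ ^ m` -/

/-- The function `2 ^ (-|k|)` on the integers. -/
def geomWeight (k : ℤ) : ENNReal := ENNReal.ofReal ((1 / 2) ^ k.natAbs)

theorem tsum_geomWeight_ne_top : ∑' k, geomWeight k ≠ ⊤ := by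
  have h : Summable fun k : ℤ => ((1 / 2 : ℝ) ^ k.natAbs) := by
    refine Summable.of_nat_of_neg ?_ ?_
    · simpa using summable_geometric_two
    · simpa using summable_geometric_two
  exact h.tsum_ofReal_ne_top

theorem tsum_prod_geomWeight_ne_top : ∀ m : ℕ,
    ∑' k : Fin m → ℤ, ∏ i, geomWeight (k i) ≠ ⊤ := by
  intro m
  induction m with
  | zero => simp
  | succ m ih =>
    rw [← (Fin.consEquiv fun _ : Fin (m + 1) => ℤ).tsum_eq, ENNReal.tsum_prod']
    have h1 : ∀ (a : ℤ) (b : Fin m → ℤ), ∏ i, geomWeight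
        ((Fin.consEquiv fun _ : Fin (m + 1) => ℤ) (a, b) i) =
          geomWeight a * ∏ i, geomWeight (b i) := by
      intro a b
      rw [Fin.prod_univ_succ]
      rfl
    simp only [h1, ENNReal.tsum_mul_left, ENNReal.tsum_mul_right]
    exact ENNReal.mul_ne_top tsum_geomWeight_ne_top ih

end

section

/-! ### Absolute convergence of the double integral -/

/-- Change of variables in an integral over `Γ \ G`, for a measure preserving bijection of `G` that
maps `Γ`-orbits to `Γ`-orbits. -/
theorem setIntegral_comp_of_semiconj {G : Type*} [Group G] [MeasurableSpace G] [MeasurableMul G]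
    {Γ : Subgroup G} [Countable Γ] {μ : Measure G} [μ.IsMulLeftInvariant] {𝓕 : Set G}
    (h𝓕 : MeasurableSet 𝓕) (h𝓕' : ∀ g, ∃! γ : Γ, γ • g ∈ 𝓕) (e : G ≃ᵐ G)
    (he : MeasurePreserving e μ μ) (σ : Γ ≃ Γ) (hσ : ∀ (γ : Γ) g, e (γ • g) = σ γ • e g)
    {f : G → ℂ} (hf : ∀ γ ∈ Γ, ∀ g, f (γ * g) = f g) :
    ∫ x in 𝓕, f (e x) ∂μ = ∫ x in 𝓕, f x ∂μ := by
  have h1 : e ⁻¹' (e.symm ⁻¹' 𝓕) = 𝓕 := by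
    ext x
    simp
  have h2 := he.setIntegral_preimage_emb e.measurableEmbedding f (e.symm ⁻¹' 𝓕)
  rw [h1] at h2
  rw [h2]
  have hσ' : ∀ (γ : Γ) g, e.symm (σ γ • g) = γ • e.symm g := by
    intro γ g
    rw [e.symm_apply_eq, hσ, e.apply_symm_apply]
  refine (isFundamentalDomain_of_existsUnique (e.symm.measurable h𝓕) fun g => ?_).setIntegral_eq
    (isFundamentalDomain_of_existsUnique h𝓕 h𝓕') fun γ g => hf γ γ.2 g
  obtain ⟨γ, hγ, huniq⟩ := h𝓕' (e.symm g)
  refine ⟨σ γ, by simpa only [Set.mem_preimage, hσ'] using hγ, fun δ hδ => ?_⟩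
  have hδ' : σ.symm δ • e.symm g ∈ 𝓕 := by
    rw [← hσ', σ.apply_symm_apply]
    exact hδ
  rw [← huniq (σ.symm δ) hδ', σ.apply_symm_apply]

variable {m : ℕ}

theorem continuous_cpow_idelicNorm (a : ℂ) :
    Continuous fun u : (𝔸 F)ˣ => (idelicNorm u : ℂ) ^ a :=
  (Complex.continuous_ofReal.comp continuous_idelicNorm).cpow continuous_const
    fun u => Complex.ofReal_mem_slitPlane.2 (idelicNorm_pos u)

/-- The integrand `Ψ(u h, u, 1) φ(h) |det h|^a |u|^b` of the double integral over
`GL_m(F) \ GL_m(𝔸)` and `Fˣ \ 𝔸ˣ`. -/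
def periodKernel (Ψ : GLm (m + 2) (𝔸 F) → ℂ) (φ : GLm m (𝔸 F) → ℂ) (a b : ℂ)
    (p : GLm m (𝔸 F) × (𝔸 F)ˣ) : ℂ :=
  Ψ (twoCorner p.1 p.2) * φ p.1 * (idelicNorm (Matrix.GeneralLinearGroup.det p.1) : ℂ) ^ a *
    (idelicNorm p.2 : ℂ) ^ b

theorem continuous_periodKernel {Ψ : GLm (m + 2) (𝔸 F) → ℂ} (hΨ : Continuous Ψ)
    {φ : GLm m (𝔸 F) → ℂ} (hφ : Continuous φ) (a b : ℂ) :
    Continuous (periodKernel Ψ φ a b) :=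
  (((hΨ.comp continuous_twoCorner).mul (hφ.comp continuous_fst)).mul
    ((continuous_cpow_idelicNorm a).comp
      (Matrix.GeneralLinearGroup.continuous_det.comp continuous_fst))).mul
    ((continuous_cpow_idelicNorm b).comp continuous_snd)

theorem idelicNorm_det_rational {γ : GLm m (𝔸 F)} (hγ : γ ∈ rationalGL F m) :
    idelicNorm (Matrix.GeneralLinearGroup.det γ) = 1 := by
  obtain ⟨γ, rfl⟩ := hγ
  refine idelicNorm_rational ⟨Matrix.GeneralLinearGroup.det γ, Units.ext ?_⟩
  rw [Matrix.GeneralLinearGroup.val_det_apply]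
  change algebraMap F (𝔸 F) _ = _
  rw [Matrix.GeneralLinearGroup.val_det_apply, RingHom.map_det]
  rfl

theorem periodKernel_mul {Ψ : GLm (m + 2) (𝔸 F) → ℂ}
    (hΨ : ∀ γ ∈ rationalGL F (m + 2), ∀ g, Ψ (γ * g) = Ψ g) {φ : GLm m (𝔸 F) → ℂ}
    (hφ : ∀ γ ∈ rationalGL F m, ∀ g, φ (γ * g) = φ g) (a b : ℂ)
    {γ : GLm m (𝔸 F)} (hγ : γ ∈ rationalGL F m) {δ : (𝔸 F)ˣ} (hδ : δ ∈ rationalIdeles F)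
    (h : GLm m (𝔸 F)) (u : (𝔸 F)ˣ) :
    periodKernel Ψ φ a b (γ * h, δ * u) = periodKernel Ψ φ a b (h, u) := by
  simp only [periodKernel]
  rw [twoCorner_mul, hΨ _ (twoCorner_mem hγ hδ), hφ _ hγ, map_mul, idelicNorm_mul, idelicNorm_mul,
    idelicNorm_rational hδ, idelicNorm_det_rational hγ, one_mul, one_mul]

theorem periodKernel_mul_left {Ψ : GLm (m + 2) (𝔸 F) → ℂ}
    (hΨ : ∀ γ ∈ rationalGL F (m + 2), ∀ g, Ψ (γ * g) = Ψ g) {φ : GLm m (𝔸 F) → ℂ}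
    (hφ : ∀ γ ∈ rationalGL F m, ∀ g, φ (γ * g) = φ g) (a b : ℂ)
    {γ : GLm m (𝔸 F)} (hγ : γ ∈ rationalGL F m) (h : GLm m (𝔸 F)) (u : (𝔸 F)ˣ) :
    periodKernel Ψ φ a b (γ * h, u) = periodKernel Ψ φ a b (h, u) := by
  rw [← periodKernel_mul hΨ hφ a b hγ (one_mem _) h u, one_mul]

theorem periodKernel_mul_right {Ψ : GLm (m + 2) (𝔸 F) → ℂ}
    (hΨ : ∀ γ ∈ rationalGL F (m + 2), ∀ g, Ψ (γ * g) = Ψ g) {φ : GLm m (𝔸 F) → ℂ}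
    (hφ : ∀ γ ∈ rationalGL F m, ∀ g, φ (γ * g) = φ g) (a b : ℂ)
    {δ : (𝔸 F)ˣ} (hδ : δ ∈ rationalIdeles F) (h : GLm m (𝔸 F)) (u : (𝔸 F)ˣ) :
    periodKernel Ψ φ a b (h, δ * u) = periodKernel Ψ φ a b (h, u) := by
  rw [← periodKernel_mul hΨ hφ a b (one_mem _) hδ h u, one_mul]

theorem exists_fundamentalSet_rationalGL (F : Type*) [Field F] [NumberField F] (m : ℕ) :
    ∃ 𝓕 : Set (GLm m (𝔸 F)), MeasurableSet 𝓕 ∧ ∀ g, ∃! γ : rationalGL F m, γ • g ∈ 𝓕 :=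
  exists_fundamentalSet _ (exists_nhds_rationalGL m)

theorem exists_fundamentalSet_rationalIdeles (F : Type*) [Field F] [NumberField F] :
    ∃ 𝓓 : Set (𝔸 F)ˣ, MeasurableSet 𝓓 ∧ ∀ g, ∃! γ : rationalIdeles F, γ • g ∈ 𝓓 :=
  exists_fundamentalSet _ exists_nhds_rationalIdeles

/-- The rapid decrease of `Ψ` compensates the moderate growth of all other factors. -/
theorem exists_bound_periodKernel {Ψ : GLm (m + 2) (𝔸 F) → ℂ} (hΨ : RapidlyDecreasing Ψ)
    {φ : GLm m (𝔸 F) → ℂ} (hφ : IsAutomorphicForm φ) (a b : ℂ) {C₁ : Set (GLm m (𝔸 F))}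
    (hC₁ : IsCompact C₁) {C₂ : Set (𝔸 F)ˣ} (hC₂ : IsCompact C₂) :
    ∃ B : ℝ, 0 ≤ B ∧ ∀ (k : Fin m → ℤ) (l : ℤ), ∀ κ₁ ∈ C₁, ∀ κ₂ ∈ C₂,
      ‖periodKernel Ψ φ a b (archGL (archDiag fun i => two ^ k i) * κ₁, realIdele (two ^ l) * κ₂)‖ ≤
        B * ((∏ i, (1 / 2) ^ (k i).natAbs) * (1 / 2) ^ l.natAbs) := by
  obtain ⟨A₁, B₁, hB₁0, hB₁⟩ := hφ.exists_bound hC₁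
  obtain ⟨A₂, B₂, hB₂0, hB₂⟩ := exists_norm_cpow_det_le a hC₁
  obtain ⟨A₃, B₃, hB₃0, hB₃⟩ := exists_norm_cpow_le b hC₂
  obtain ⟨B, hB0, hB⟩ := hΨ.exists_bound_twoCorner hC₁ hC₂ (A₁ + A₂ + A₃ + 1)
  refine ⟨B * (B₁ * B₂ * B₃), by positivity, fun k l κ₁ hκ₁ κ₂ hκ₂ => ?_⟩
  have h0 := hB k l κ₁ hκ₁ κ₂ hκ₂
  have h1 := hB₁ k κ₁ hκ₁
  have h2 := hB₂ k κ₁ hκ₁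
  have h3 := hB₃ l κ₂ hκ₂
  simp only [periodKernel, norm_mul]
  rw [Finset.prod_pow_eq_pow_sum]
  set N := ∑ i, (k i).natAbs
  set L := l.natAbs
  set x := ‖Ψ (twoCorner (archGL (archDiag fun i => two ^ k i) * κ₁) (realIdele (two ^ l) * κ₂))‖
  have hx : 0 ≤ x := norm_nonneg _
  have h4 : x * (2 ^ (A₁ * N) * 2 ^ (A₂ * N) * 2 ^ (A₃ * L)) ≤ B * ((1 / 2) ^ N * (1 / 2) ^ L) := by
    have h5 : (2 : ℝ) ^ (A₁ * N) * 2 ^ (A₂ * N) * 2 ^ (A₃ * L) * (2 ^ N * 2 ^ L) ≤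
        2 ^ ((A₁ + A₂ + A₃ + 1) * (N + L)) := by
      rw [← pow_add, ← pow_add, ← pow_add, ← pow_add]
      refine pow_le_pow_right₀ one_le_two ?_
      nlinarith [Nat.zero_le (A₃ * N), Nat.zero_le ((A₁ + A₂) * L)]
    have h6 : (2 : ℝ) ^ N * 2 ^ L * ((1 / 2) ^ N * (1 / 2) ^ L) = 1 := by
      rw [mul_mul_mul_comm, ← mul_pow, ← mul_pow]
      norm_num
    calc x * (2 ^ (A₁ * N) * 2 ^ (A₂ * N) * 2 ^ (A₃ * L))
        = x * (2 ^ (A₁ * N) * 2 ^ (A₂ * N) * 2 ^ (A₃ * L) * (2 ^ N * 2 ^ L)) *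
            ((1 / 2) ^ N * (1 / 2) ^ L) := by
          rw [mul_assoc x, mul_assoc _ ((2 : ℝ) ^ N * 2 ^ L), h6, mul_one]
      _ ≤ B * ((1 / 2) ^ N * (1 / 2) ^ L) := by
          refine mul_le_mul_of_nonneg_right ?_ (by positivity)
          exact (mul_le_mul_of_nonneg_left h5 hx).trans h0
  calc _ ≤ x * (B₁ * 2 ^ (A₁ * N)) * (B₂ * 2 ^ (A₂ * N)) * (B₃ * 2 ^ (A₃ * L)) := by gcongr
    _ = x * (2 ^ (A₁ * N) * 2 ^ (A₂ * N) * 2 ^ (A₃ * L)) * (B₁ * B₂ * B₃) := by ring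
    _ ≤ B * ((1 / 2) ^ N * (1 / 2) ^ L) * (B₁ * B₂ * B₃) :=
        mul_le_mul_of_nonneg_right h4 (by positivity)
    _ = _ := by ring

theorem measure_image_mul_left {G : Type*} [Group G] [MeasurableSpace G] [MeasurableMul G]
    (μ : Measure G) [μ.IsMulLeftInvariant] (g : G) (S : Set G) : μ ((fun x => g * x) '' S) = μ S := by
  rw [Set.image_mul_left]
  exact measure_preimage_mul μ g⁻¹ S

/-- Absolute convergence of the double integral: its kernel decays geometrically along the sets
`t C` that cover both quotients. -/
theorem integrable_periodKernel {Ψ : GLm (m + 2) (𝔸 F) → ℂ} (hΨc : Continuous Ψ)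
    (hΨ : RapidlyDecreasing Ψ) (hΨl : ∀ γ ∈ rationalGL F (m + 2), ∀ g, Ψ (γ * g) = Ψ g)
    {φ : GLm m (𝔸 F) → ℂ} (hφ : IsAutomorphicForm φ) (a b : ℂ)
    {du : Measure (𝔸 F)ˣ} [du.IsHaarMeasure] {dh : Measure (GLm m (𝔸 F))} [dh.IsHaarMeasure]
    {𝓕 : Set (GLm m (𝔸 F))} (h𝓕 : IsFundamentalDomain (rationalGL F m) 𝓕 dh)
    {𝓓 : Set (𝔸 F)ˣ} (h𝓓 : IsFundamentalDomain (rationalIdeles F) 𝓓 du) :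
    Integrable (periodKernel Ψ φ a b) ((dh.restrict 𝓕).prod (du.restrict 𝓓)) := by
  obtain ⟨C₁, hC₁, hcov₁⟩ := exists_reduction F m
  obtain ⟨C₂, hC₂, hcov₂⟩ := exists_reduction_ideles F
  obtain ⟨B, hB0, hB⟩ := exists_bound_periodKernel hΨ hφ a b hC₁ hC₂
  refine integrable_prod_of_cover h𝓕 h𝓓
    (S := fun k : Fin m → ℤ => (fun κ => archGL (archDiag fun i => two ^ k i) * κ) '' C₁)
    (T := fun l : ℤ => (fun κ => realIdele (two ^ l) * κ) '' C₂)
    (c := fun k => ENNReal.ofReal B * ∏ i, geomWeight (k i)) (d := geomWeight)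
    (fun k => (hC₁.image (continuous_const_mul _)).isClosed.measurableSet)
    (fun l => (hC₂.image (continuous_const_mul _)).isClosed.measurableSet)
    (fun g => ?_) (fun u => ?_)
    (continuous_periodKernel hΨc hφ.continuous a b).measurable
    (fun γ hγ h u => periodKernel_mul_left hΨl hφ.left_invariant a b hγ h u)
    (fun δ hδ h u => periodKernel_mul_right hΨl hφ.left_invariant a b hδ h u) ?_ ?_ ?_
  · obtain ⟨k, γ, hγ, κ, hκ, h⟩ := hcov₁ g
    exact ⟨k, γ, hγ, κ, hκ, h.symm⟩
  · obtain ⟨l, γ, hγ, κ, hκ, h⟩ := hcov₂ u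
    exact ⟨l, γ, hγ, κ, hκ, h.symm⟩
  · rintro k l _ ⟨κ₁, hκ₁, rfl⟩ _ ⟨κ₂, hκ₂, rfl⟩
    rw [← ofReal_norm]
    refine (ENNReal.ofReal_le_ofReal (hB k l κ₁ hκ₁ κ₂ hκ₂)).trans (le_of_eq ?_)
    rw [ENNReal.ofReal_mul hB0, ENNReal.ofReal_mul (by positivity),
      ENNReal.ofReal_prod_of_nonneg (fun i _ => by positivity), ← mul_assoc]
    rfl
  · simp only [measure_image_mul_left, mul_assoc, ENNReal.tsum_mul_left, ENNReal.tsum_mul_right]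
    exact ENNReal.mul_ne_top ENNReal.ofReal_ne_top
      (ENNReal.mul_ne_top (tsum_prod_geomWeight_ne_top m) hC₁.measure_ne_top)
  · simp only [measure_image_mul_left, ENNReal.tsum_mul_right]
    exact ENNReal.mul_ne_top tsum_geomWeight_ne_top hC₂.measure_ne_top

theorem continuous_averageIntegrand {Ψ : GLm (m + 1) (𝔸 F) → ℂ} (hΨ : Continuous Ψ) (s : ℂ)
    (h : GLm m (𝔸 F)) : Continuous (averageIntegrand s Ψ h) :=
  (hΨ.comp (continuous_corner.comp (continuous_scalar.mul continuous_const))).mul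
    (continuous_cpow_idelicNorm _)

theorem averageIntegrand_mul {Ψ : GLm (m + 1) (𝔸 F) → ℂ}
    (hΨ : ∀ γ ∈ rationalGL F (m + 1), ∀ g, Ψ (γ * g) = Ψ g) (s : ℂ) (h : GLm m (𝔸 F))
    {δ : (𝔸 F)ˣ} (hδ : δ ∈ rationalIdeles F) (u : (𝔸 F)ˣ) :
    averageIntegrand s Ψ h (δ * u) = averageIntegrand s Ψ h u := by
  unfold averageIntegrand
  rw [map_mul, mul_assoc, corner_mul, hΨ _ (corner_scalar_mem hδ), idelicNorm_mul,
    idelicNorm_rational hδ, one_mul]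

/-- Absolute convergence of the central average. -/
theorem quotientIntegrable_averageIntegrand {Ψ : GLm (m + 2) (𝔸 F) → ℂ} (hΨc : Continuous Ψ)
    (hΨ : RapidlyDecreasing Ψ) (hΨl : ∀ γ ∈ rationalGL F (m + 2), ∀ g, Ψ (γ * g) = Ψ g)
    (du : Measure (𝔸 F)ˣ) [du.IsHaarMeasure] (s : ℂ) (h : GLm (m + 1) (𝔸 F)) :
    QuotientIntegrable (rationalIdeles F) du (averageIntegrand s Ψ h) := by
  obtain ⟨𝓓, h𝓓, h𝓓'⟩ := exists_fundamentalSet_rationalIdeles F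
  have hfd : IsFundamentalDomain (rationalIdeles F) 𝓓 du :=
    isFundamentalDomain_of_existsUnique h𝓓 h𝓓'
  rw [quotientIntegrable_iff hfd (fun δ hδ u => averageIntegrand_mul hΨl s h hδ u)
    (continuous_averageIntegrand hΨc s h).measurable]
  obtain ⟨C₂, hC₂, hcov₂⟩ := exists_reduction_ideles F
  obtain ⟨A, B, hB0, hB⟩ := exists_norm_cpow_le (((m + 1 : ℕ) : ℂ) * (s - 1 / 2)) hC₂
  obtain ⟨B', hB'0, hB'⟩ := hΨ.exists_bound_corner h hC₂ (A + 1)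
  refine integrableOn_of_cover hfd
    (S := fun l : ℤ => (fun κ => realIdele (two ^ l) * κ) '' C₂)
    (c := fun l => ENNReal.ofReal (B' * B) * geomWeight l)
    (fun l => (hC₂.image (continuous_const_mul _)).isClosed.measurableSet) (fun u => ?_)
    (continuous_averageIntegrand hΨc s h).measurable
    (fun δ hδ u => averageIntegrand_mul hΨl s h hδ u) ?_ ?_
  · obtain ⟨l, γ, hγ, κ, hκ, h⟩ := hcov₂ u
    exact ⟨l, γ, hγ, κ, hκ, h.symm⟩
  · rintro l _ ⟨κ, hκ, rfl⟩
    rw [geomWeight, ← ENNReal.ofReal_mul (by positivity), ← ofReal_norm]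
    refine ENNReal.ofReal_le_ofReal ?_
    simp only [averageIntegrand, norm_mul]
    have h1 := hB l κ hκ
    have h2 := hB' l κ hκ
    set x := ‖Ψ (corner (Matrix.GeneralLinearGroup.scalar (Fin (m + 1))
      (realIdele (two ^ l) * κ) * h))‖
    have h3 : (2 : ℝ) ^ l.natAbs * (1 / 2) ^ l.natAbs = 1 := by
      rw [← mul_pow]
      norm_num
    calc _ ≤ x * (B * 2 ^ (A * l.natAbs)) := by gcongr
      _ = x * 2 ^ ((A + 1) * l.natAbs) * (B * (1 / 2) ^ l.natAbs) := by
          rw [add_mul, one_mul, pow_add]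
          linear_combination (-x * B * 2 ^ (A * l.natAbs)) * h3
      _ ≤ B' * (B * (1 / 2) ^ l.natAbs) := mul_le_mul_of_nonneg_right h2 (by positivity)
      _ = _ := by ring
  · simp only [measure_image_mul_left, mul_assoc, ENNReal.tsum_mul_left, ENNReal.tsum_mul_right]
    exact ENNReal.mul_ne_top ENNReal.ofReal_ne_top
      (ENNReal.mul_ne_top tsum_geomWeight_ne_top hC₂.measure_ne_top)

/-! ### The period as a double integral -/

theorem periodIntegrand_eq {Ψ : GLm (m + 2) (𝔸 F) → ℂ} (hΨc : Continuous Ψ)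
    (hΨl : ∀ γ ∈ rationalGL F (m + 2), ∀ g, Ψ (γ * g) = Ψ g)
    (φ : GLm m (𝔸 F) → ℂ) (s w : ℂ) {du : Measure (𝔸 F)ˣ} [du.IsHaarMeasure]
    {𝓓 : Set (𝔸 F)ˣ} (h𝓓 : IsFundamentalDomain (rationalIdeles F) 𝓓 du) (h : GLm m (𝔸 F)) :
    periodIntegrand w (centralAverage du s Ψ) φ h =
      ∫ u in 𝓓, periodKernel Ψ φ (s + w - 1) ((m + 1) * (s - 1 / 2)) (h, u) ∂du := by
  have h1 : ∀ u, periodKernel Ψ φ (s + w - 1) ((m + 1) * (s - 1 / 2)) (h, u) =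
      averageIntegrand s Ψ (corner h) u *
        (φ h * (idelicNorm (Matrix.GeneralLinearGroup.det h) : ℂ) ^ (s + w - 1)) := by
    intro u
    simp only [periodKernel, averageIntegrand, twoCorner]
    push_cast
    ring
  simp only [h1]
  rw [integral_mul_const, periodIntegrand, centralAverage, det_corner,
    quotientIntegral_eq h𝓓 (fun δ hδ u => averageIntegrand_mul hΨl s _ hδ u)
      (continuous_averageIntegrand hΨc s _).measurable,
    show s + w - 1 = (s - 1 / 2) + (w - 1 / 2) by ring,
    Complex.cpow_add _ _ (Complex.ofReal_ne_zero.2 (idelicNorm_pos _).ne')]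
  ring

/-- The period of a central average converges absolutely, and is a double integral of
`periodKernel`. -/
theorem period_centralAverage {Ψ : GLm (m + 2) (𝔸 F) → ℂ} (hΨc : Continuous Ψ)
    (hΨ : RapidlyDecreasing Ψ) (hΨl : ∀ γ ∈ rationalGL F (m + 2), ∀ g, Ψ (γ * g) = Ψ g)
    {φ : GLm m (𝔸 F) → ℂ} (hφ : IsAutomorphicForm φ) (s w : ℂ)
    {du : Measure (𝔸 F)ˣ} [du.IsHaarMeasure] {dh : Measure (GLm m (𝔸 F))} [dh.IsHaarMeasure]
    {𝓕 : Set (GLm m (𝔸 F))} (h𝓕 : IsFundamentalDomain (rationalGL F m) 𝓕 dh)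
    {𝓓 : Set (𝔸 F)ˣ} (h𝓓 : IsFundamentalDomain (rationalIdeles F) 𝓓 du) :
    QuotientIntegrable (rationalGL F m) dh (periodIntegrand w (centralAverage du s Ψ) φ) ∧
      period dh w (centralAverage du s Ψ) φ = ∫ h in 𝓕, ∫ u in 𝓓,
        periodKernel Ψ φ (s + w - 1) ((m + 1) * (s - 1 / 2)) (h, u) ∂du ∂dh := by
  have heq : periodIntegrand w (centralAverage du s Ψ) φ = fun h => ∫ u in 𝓓,
      periodKernel Ψ φ (s + w - 1) ((m + 1) * (s - 1 / 2)) (h, u) ∂du :=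
    funext fun h => periodIntegrand_eq hΨc hΨl φ s w h𝓓 h
  have hinv : ∀ γ ∈ rationalGL F m, ∀ h, periodIntegrand w (centralAverage du s Ψ) φ (γ * h) =
      periodIntegrand w (centralAverage du s Ψ) φ h := by
    intro γ hγ h
    simp only [heq, periodKernel_mul_left hΨl hφ.left_invariant _ _ hγ]
  have hmeas : Measurable (periodIntegrand w (centralAverage du s Ψ) φ) := by
    rw [heq]
    exact ((continuous_periodKernel hΨc hφ.continuous _ _).stronglyMeasurable.integral_prod_right'
      (ν := du.restrict 𝓓)).measurable
  refine ⟨?_, ?_⟩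
  · rw [quotientIntegrable_iff h𝓕 hinv hmeas, heq]
    exact (integrable_periodKernel hΨc hΨ hΨl hφ _ _ h𝓕 h𝓓).integral_prod_left
  · rw [period, quotientIntegral_eq h𝓕 hinv hmeas, heq]

/-- The symmetry behind the identity: the Weyl element and the invariance under the centre turn the
kernel of `check Φ` at `(h, u)` into the kernel of `Φ` at `(u h, u⁻¹)`. -/
theorem periodKernel_check {Φ : GLm (m + 2) (𝔸 F) → ℂ}
    (hΦ : ∀ γ ∈ rationalGL F (m + 2), ∀ g, Φ (γ * g) = Φ g) (hΦZ : IsCentralInvariant Φ)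
    {φ : GLm m (𝔸 F) → ℂ} (hφZ : IsCentralInvariant φ) (a b : ℂ) (h : GLm m (𝔸 F)) (u : (𝔸 F)ˣ) :
    periodKernel (check Φ) φ a (m * a - b) (h, u) =
      periodKernel Φ φ a b (Matrix.GeneralLinearGroup.scalar (Fin m) u * h, u⁻¹) := by
  have hne : ∀ v : (𝔸 F)ˣ, (idelicNorm v : ℂ) ≠ 0 := fun v =>
    Complex.ofReal_ne_zero.2 (idelicNorm_pos v).ne'
  have hpow : ∀ (x : ℝ), 0 ≤ x → ∀ n : ℕ, ((x ^ n : ℝ) : ℂ) ^ a = ((x : ℂ) ^ a) ^ n := by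
    intro x hx n
    induction n with
    | zero => simp
    | succ n ih =>
      rw [pow_succ, Complex.ofReal_mul, Complex.mul_cpow_ofReal_nonneg (pow_nonneg hx n) hx, ih,
        pow_succ]
  have hinv : ((idelicNorm u : ℂ)⁻¹) ^ b = ((idelicNorm u : ℂ) ^ b)⁻¹ := by
    refine Complex.inv_cpow _ _ ?_
    rw [Complex.arg_ofReal_of_nonneg (idelicNorm_pos u).le]
    exact Real.pi_pos.ne
  simp only [periodKernel, check]
  rw [twoCorner_mul_weylSwap, hΦ _ (weylSwap_mem m), hΦZ, hφZ, map_mul, det_scalar, idelicNorm_mul,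
    idelicNorm_pow, idelicNorm_inv, Complex.cpow_sub _ _ (hne u), Complex.ofReal_mul,
    Complex.mul_cpow_ofReal_nonneg (pow_nonneg (idelicNorm_pos u).le m) (idelicNorm_pos _).le,
    Complex.ofReal_inv, hpow _ (idelicNorm_pos u).le, hinv, Complex.cpow_nat_mul]
  ring

/-- The two double integrals agree: Fubini's theorem, the substitution `h ↦ u⁻¹ h` in the inner
integral and the substitution `u ↦ u⁻¹` in the outer one. -/
theorem integral_periodKernel_check {Φ : GLm (m + 2) (𝔸 F) → ℂ} (hΦc : Continuous Φ)
    (hΦr : RapidlyDecreasing Φ) (hΦ : ∀ γ ∈ rationalGL F (m + 2), ∀ g, Φ (γ * g) = Φ g)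
    (hΦZ : IsCentralInvariant Φ)
    {φ : GLm m (𝔸 F) → ℂ} (hφ : IsAutomorphicForm φ) (hφZ : IsCentralInvariant φ) (a b : ℂ)
    {du : Measure (𝔸 F)ˣ} [du.IsHaarMeasure] {dh : Measure (GLm m (𝔸 F))} [dh.IsHaarMeasure]
    {𝓕 : Set (GLm m (𝔸 F))} (h𝓕 : MeasurableSet 𝓕)
    (h𝓕' : ∀ g, ∃! γ : rationalGL F m, γ • g ∈ 𝓕)
    {𝓓 : Set (𝔸 F)ˣ} (h𝓓 : MeasurableSet 𝓓)
    (h𝓓' : ∀ g, ∃! γ : rationalIdeles F, γ • g ∈ 𝓓) :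
    ∫ h in 𝓕, ∫ u in 𝓓, periodKernel (check Φ) φ a (m * a - b) (h, u) ∂du ∂dh =
      ∫ h in 𝓕, ∫ u in 𝓓, periodKernel Φ φ a b (h, u) ∂du ∂dh := by
  have hF : IsFundamentalDomain (rationalGL F m) 𝓕 dh := isFundamentalDomain_of_existsUnique h𝓕 h𝓕'
  have hD : IsFundamentalDomain (rationalIdeles F) 𝓓 du :=
    isFundamentalDomain_of_existsUnique h𝓓 h𝓓'
  have hcheckc : Continuous (check Φ) := hΦc.comp (continuous_mul_const _)
  have hcheck : ∀ γ ∈ rationalGL F (m + 2), ∀ g, check Φ (γ * g) = check Φ g := by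
    intro γ hγ g
    simp only [check, mul_assoc, hΦ γ hγ]
  rw [integral_integral_swap (f := fun h u => periodKernel (check Φ) φ a (m * a - b) (h, u))
      (integrable_periodKernel hcheckc hΦr.check hcheck hφ a (m * a - b) hF hD),
    integral_integral_swap (f := fun h u => periodKernel Φ φ a b (h, u))
      (integrable_periodKernel hΦc hΦr hΦ hφ a b hF hD)]
  have h1 : ∀ u, ∫ h in 𝓕, periodKernel (check Φ) φ a (m * a - b) (h, u) ∂dh =
      ∫ h in 𝓕, periodKernel Φ φ a b (h, u⁻¹) ∂dh := by
    intro u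
    simp only [periodKernel_check hΦ hΦZ hφZ]
    refine setIntegral_comp_of_semiconj h𝓕 h𝓕'
      (MeasurableEquiv.mulLeft (Matrix.GeneralLinearGroup.scalar (Fin m) u))
      (measurePreserving_mul_left dh _) (Equiv.refl _) (fun γ g => ?_)
      (f := fun h => periodKernel Φ φ a b (h, u⁻¹))
      (fun γ hγ g => periodKernel_mul_left hΦ hφ.left_invariant a b hγ g _)
    change _ * ((γ : GLm m (𝔸 F)) * g) = (γ : GLm m (𝔸 F)) * (_ * g)
    rw [← mul_assoc, scalar_commute, mul_assoc]
  simp only [h1]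
  refine setIntegral_comp_of_semiconj h𝓓 h𝓓' (MeasurableEquiv.inv _) (Measure.measurePreserving_inv du)
    (Equiv.inv _) (fun γ g => ?_) (f := fun u => ∫ h in 𝓕, periodKernel Φ φ a b (h, u) ∂dh)
    (fun δ hδ u => by simp only [periodKernel_mul_right hΦ hφ.left_invariant a b hδ])
  change ((γ : (𝔸 F)ˣ) * g)⁻¹ = (γ : (𝔸 F)ˣ)⁻¹ * g⁻¹
  exact mul_inv _ _

end

end AdelicPeriods

end

open AdelicPeriods in
theorem proposition3p4 (F : Type*) [Field F] [NumberField F] (m : ℕ) (hm : 1 ≤ m)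
    (du : MeasureTheory.Measure (𝔸 F)ˣ) [du.IsHaarMeasure]
    (dh : MeasureTheory.Measure (GLm m (𝔸 F))) [dh.IsHaarMeasure]
    (Φ : GLm (m + 2) (𝔸 F) → ℂ) (hΦ : IsCuspForm Φ) (hΦZ : IsCentralInvariant Φ)
    (φ : GLm m (𝔸 F) → ℂ) (hφ : IsAutomorphicForm φ) (hφZ : IsCentralInvariant φ)
    (s w s' w' : ℂ)
    (hs' : s' = (1 + m * w - s) / (m + 1))
    (hw' : w' = ((m + 2) * s + w - 1) / (m + 1)) :
    (∀ h, QuotientIntegrable (rationalIdeles F) du (averageIntegrand s Φ h)) ∧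
    (∀ h, QuotientIntegrable (rationalIdeles F) du (averageIntegrand s' (check Φ) h)) ∧
    QuotientIntegrable (rationalGL F m) dh (periodIntegrand w (centralAverage du s Φ) φ) ∧
    QuotientIntegrable (rationalGL F m) dh
      (periodIntegrand w' (centralAverage du s' (check Φ)) φ) ∧
    period dh w (centralAverage du s Φ) φ = period dh w' (centralAverage du s' (check Φ)) φ := by
  have hc : Continuous Φ := hΦ.toIsAutomorphicForm.continuous
  have hr : RapidlyDecreasing Φ := hΦ.rapidlyDecreasing (by omega)
  have hl := hΦ.left_invariant
  have hc' : Continuous (check Φ) := hc.comp (continuous_mul_const _)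
  have hl' : ∀ γ ∈ rationalGL F (m + 2), ∀ g, check Φ (γ * g) = check Φ g := by
    intro γ hγ g
    simp only [check, mul_assoc, hl γ hγ]
  obtain ⟨𝓕, h𝓕, h𝓕'⟩ := exists_fundamentalSet_rationalGL F m
  obtain ⟨𝓓, h𝓓, h𝓓'⟩ := exists_fundamentalSet_rationalIdeles F
  have hF : IsFundamentalDomain (rationalGL F m) 𝓕 dh := isFundamentalDomain_of_existsUnique h𝓕 h𝓕'
  have hD : IsFundamentalDomain (rationalIdeles F) 𝓓 du :=
    isFundamentalDomain_of_existsUnique h𝓓 h𝓓'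
  obtain ⟨h1, h2⟩ := period_centralAverage hc hr hl hφ s w hF hD
  obtain ⟨h3, h4⟩ := period_centralAverage hc' hr.check hl' hφ s' w' hF hD
  refine ⟨quotientIntegrable_averageIntegrand hc hr hl du s,
    quotientIntegrable_averageIntegrand hc' hr.check hl' du s', h1, h3, ?_⟩
  have hm0 : (m : ℂ) + 1 ≠ 0 := by exact_mod_cast Nat.succ_ne_zero m
  have ha : s' + w' - 1 = s + w - 1 := by
    rw [hs', hw']
    field_simp
    ring
  have hb : ((m : ℂ) + 1) * (s' - 1 / 2) = m * (s + w - 1) - (m + 1) * (s - 1 / 2) := by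
    rw [hs']
    field_simp
    ring
  rw [h2, h4, ha, hb]
  exact (integral_periodKernel_check hc hr hl hΦZ hφ hφZ _ _ h𝓕 h𝓕' h𝓓 h𝓓').symm
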